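/- Let $k \ge 2$. A set of vertices of a hypergraph is independent if it contains no hyperedge; a $q$-colouring is a map from the vertices to $q$ colours all of whose colour classes are independent; $\chi(H)$ is the least $q$ for which a $q$-colouring exists. Let $\mathcal H(n,p,k)$ be the random $k$-uniform hypergraph on $n$ labelled vertices in which each of the $\binom nk$ possible hyperedges is included independently with probability $p$, and let $\bar m = p\binom nk$ be its expected number of hyperedges. There are a constant $C = C_k > 0$ depending only on $k$ and a deterministic polynomial-time algorithm $A$ which takes as input a $k$-uniform hypergraph $H$ on $n$ vertices and the integer part $\lfloor \xi\rfloor$ of a real number $\xi \ge 0$, and outputs either "$\chi(H) > \xi$" or "fail", such that the following holds. (1) $A$ never errs: for every $n$, every $k$-uniform hypergraph $H$ on $n$ vertices and every real $\xi \ge 0$, if $A$ outputs "$\chi(H) > \xi$" then indeed $\chi(H) > \xi$. (2) For all sequences $p = p(n) \in [0,1]$ and $\xi = \xi(n) \ge 0$ such that, for all sufficiently large $n$, $$\xi \le \frac{n^{1/4}}{\log n} \qquad\text{and}\qquad \bar m = p\binom nk \ \ge\ C\,\xi^{2k}\, n^{k/2} \log^3 n ,$$ the probability, over $H \sim \mathcal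 H(n,p,k)$, that $A$ outputs "$\chi(H) > \xi$" tends to $1$ as $n \to \infty$. Here polynomial time means: on a random access machine with the logarithmic cost criterion, which is given $n$, $\lfloor\xi\rfloor$ and the $n^k$-entry incidence table of $H$, the running time is at most a polynomial (depending only on $k$) in $n$ and the number of bits of $\lfloor\xi\rfloor$. -/

import Mathlib

open Filter Topology ProbabilityTheory

/-! ### Hypergraphs: independent sets, colourings, chromatic number -/

namespace Hypergraph

variable {α : Type*}

/-- A set of vertices is independent if it contains no hyperedge. -/
def IsIndepSet (H : Hypergraph α) (S : Set α) : Prop :=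
  S ⊆ H.vertexSet ∧ ∀ e ∈ H.edgeSet, ¬ e ⊆ S

/-- A `q`-colouring is a map from the vertices to `q` colours all of whose colour classes are
independent. -/
def IsColoring (H : Hypergraph α) {q : ℕ} (f : H.vertexSet → Fin q) : Prop :=
  ∀ i : Fin q, H.IsIndepSet (Subtype.val '' (f ⁻¹' {i}))

/-- The least `q` for which there is a `q`-colouring. The set is nonempty for the hypergraphs
considered below, see `UniformHypergraph.exists_isColoring`. -/
noncomputable def chromaticNumber (H : Hypergraph α) : ℕ :=
  sInf {q : ℕ | ∃ f : H.vertexSet → Fin q, H.IsColoring f}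

end Hypergraph

/-- A `k`-uniform (unordered) hypergraph on the vertex set `Fin n`, given by its set of
hyperedges. -/
abbrev UniformHypergraph (n k : ℕ) : Type :=
  Set {e : Finset (Fin n) // e.card = k}

namespace UniformHypergraph

variable {n k : ℕ}

/-- The underlying hypergraph, with vertex set all of `Fin n`. -/
def toHypergraph (H : UniformHypergraph n k) : Hypergraph (Fin n) where
  vertexSet := Set.univ
  edgeSet := (fun e : {e : Finset (Fin n) // e.card = k} => (e.1 : Set (Fin n))) '' H
  subset_vertexSet_of_mem_edgeSet' := fun _ _ => Set.subset_univ _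

/-- The chromatic number `χ(H)`. -/
noncomputable def chromaticNumber (H : UniformHypergraph n k) : ℕ :=
  H.toHypergraph.chromaticNumber

/-- For `k ≥ 2`, giving all vertices different colours is a colouring. -/
theorem exists_isColoring (hk : 2 ≤ k) (H : UniformHypergraph n k) :
    ∃ f : H.toHypergraph.vertexSet → Fin n, H.toHypergraph.IsColoring f := by
  refine ⟨fun v => v.1, fun i => ⟨Set.subset_univ _, ?_⟩⟩
  rintro _ ⟨⟨e, he⟩, -, rfl⟩ hsub
  have h1 : e ⊆ {i} := by
    intro v hv
    obtain ⟨w, hw, hwv⟩ := hsub hv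
    have h2 : w.1 = i := hw
    rw [Finset.mem_singleton, ← h2]
    exact hwv.symm
  have h3 := Finset.card_le_card h1
  rw [Finset.card_singleton, he] at h3
  omega

/-- The distribution `H(n,p,k)`: each of the `n.choose k` possible hyperedges is included
independently with probability `p`. -/
noncomputable def random (n k : ℕ) (p : unitInterval) :
    MeasureTheory.Measure (UniformHypergraph n k) :=
  setBernoulli Set.univ p

end UniformHypergraph

/-! ### Random access machine with logarithmic cost -/

namespace LogRAM

/-- A machine state: registers, addressed by constants of the program, and a memory, addressed
indirectly; each cell holds a natural number. -/
structure State where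
  reg : ℕ → ℕ
  mem : ℕ → ℕ

/-- Write `v` into register `d`. -/
def State.setReg (s : State) (d v : ℕ) : State :=
  { s with reg := Function.update s.reg d v }

/-- Write `v` into memory cell `a`. -/
def State.setMem (s : State) (a v : ℕ) : State :=
  { s with mem := Function.update s.mem a v }

/-- Programs of the random access machine, with structured control flow. The arguments of the
instructions are indices of registers, except for the constant `c` of `const`. -/
inductive Program : Type
  | const (d c : ℕ)
  | copy (d a : ℕ)
  | add (d a b : ℕ)
  | sub (d a b : ℕ)
  | mul (d a b : ℕ)
  | div (d a b : ℕ)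
  | load (d a : ℕ)
  | store (a b : ℕ)
  | seq (P Q : Program)
  | cond (a : ℕ) (P Q : Program)
  | loop (a : ℕ) (P : Program)

/-- `Exec P s t s'`: started in the state `s`, the program `P` halts in the state `s'` after
time `t`. Each instruction and each test is charged one plus the number of bits of the operands,
including addresses (the logarithmic cost criterion). `cond a P Q` runs `P` if register `a` is
nonzero and `Q` otherwise; `loop a P` repeats `P` while register `a` is nonzero. -/
inductive Exec : Program → State → ℕ → State → Prop
  | const (d c : ℕ) (s : State) :
      Exec (.const d c) s (1 + c.size) (s.setReg d c)
  | copy (d a : ℕ) (s : State) :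
      Exec (.copy d a) s (1 + (s.reg a).size) (s.setReg d (s.reg a))
  | add (d a b : ℕ) (s : State) :
      Exec (.add d a b) s (1 + (s.reg a).size + (s.reg b).size)
        (s.setReg d (s.reg a + s.reg b))
  | sub (d a b : ℕ) (s : State) :
      Exec (.sub d a b) s (1 + (s.reg a).size + (s.reg b).size)
        (s.setReg d (s.reg a - s.reg b))
  | mul (d a b : ℕ) (s : State) :
      Exec (.mul d a b) s (1 + (s.reg a).size + (s.reg b).size)
        (s.setReg d (s.reg a * s.reg b))
  | div (d a b : ℕ) (s : State) :
      Exec (.div d a b) s (1 + (s.reg a).size + (s.reg b).size)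
        (s.setReg d (s.reg a / s.reg b))
  | load (d a : ℕ) (s : State) :
      Exec (.load d a) s (1 + (s.reg a).size + (s.mem (s.reg a)).size)
        (s.setReg d (s.mem (s.reg a)))
  | store (a b : ℕ) (s : State) :
      Exec (.store a b) s (1 + (s.reg a).size + (s.reg b).size)
        (s.setMem (s.reg a) (s.reg b))
  | seq {P Q : Program} {s s₁ s₂ : State} {t₁ t₂ : ℕ} :
      Exec P s t₁ s₁ → Exec Q s₁ t₂ s₂ → Exec (.seq P Q) s (t₁ + t₂) s₂
  | cond_pos {a : ℕ} {P Q : Program} {s s₁ : State} {t : ℕ} :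
      s.reg a ≠ 0 → Exec P s t s₁ → Exec (.cond a P Q) s (1 + (s.reg a).size + t) s₁
  | cond_zero {a : ℕ} {P Q : Program} {s s₁ : State} {t : ℕ} :
      s.reg a = 0 → Exec Q s t s₁ → Exec (.cond a P Q) s (1 + (s.reg a).size + t) s₁
  | loop_pos {a : ℕ} {P : Program} {s s₁ s₂ : State} {t₁ t₂ : ℕ} :
      s.reg a ≠ 0 → Exec P s t₁ s₁ → Exec (.loop a P) s₁ t₂ s₂ →
        Exec (.loop a P) s (1 + (s.reg a).size + t₁ + t₂) s₂
  | loop_zero {a : ℕ} {P : Program} {s : State} :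
      s.reg a = 0 → Exec (.loop a P) s (1 + (s.reg a).size) s

/-- The machine is deterministic. -/
theorem Exec.deterministic {P : Program} {s s₁ s₂ : State} {t₁ t₂ : ℕ}
    (h₁ : Exec P s t₁ s₁) (h₂ : Exec P s t₂ s₂) : t₁ = t₂ ∧ s₁ = s₂ := by
  induction h₁ generalizing t₂ s₂ with
  | seq _ _ ih ih' =>
    cases h₂ with
    | seq g g' =>
      obtain ⟨rfl, rfl⟩ := ih g
      obtain ⟨rfl, rfl⟩ := ih' g'
      exact ⟨rfl, rfl⟩
  | cond_pos h _ ih =>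
    cases h₂ with
    | cond_pos _ g => obtain ⟨rfl, rfl⟩ := ih g; exact ⟨rfl, rfl⟩
    | cond_zero g _ => exact absurd g h
  | cond_zero h _ ih =>
    cases h₂ with
    | cond_pos g _ => exact absurd h g
    | cond_zero _ g => obtain ⟨rfl, rfl⟩ := ih g; exact ⟨rfl, rfl⟩
  | loop_pos h _ _ ih ih' =>
    cases h₂ with
    | loop_pos _ g g' =>
      obtain ⟨rfl, rfl⟩ := ih g
      obtain ⟨rfl, rfl⟩ := ih' g'
      exact ⟨rfl, rfl⟩
    | loop_zero g => exact absurd g h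
  | loop_zero h =>
    cases h₂ with
    | loop_pos g _ _ => exact absurd h g
    | loop_zero _ => exact ⟨rfl, rfl⟩
  | _ => cases h₂; exact ⟨rfl, rfl⟩

end LogRAM

open Classical in
/-- The input of the machine: `n` in register `0`, `ξ` in register `1`, and in the memory the table
of size `n ^ k` of the hypergraph, whose entry at `v₀ + v₁ n + ⋯ + vₖ₋₁ n ^ (k - 1)` is `1` if
`{v₀, …, vₖ₋₁}` is a hyperedge (in particular these `k` vertices are distinct) and `0` otherwise.
All other cells hold `0`. -/
noncomputable def UniformHypergraph.input {n k : ℕ} (H : UniformHypergraph n k) (ξ : ℕ) :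
    LogRAM.State where
  reg := fun i => if i = 0 then n else if i = 1 then ξ else 0
  mem := fun i =>
    if ∃ h : i < n ^ k, ∃ e ∈ H,
      e.1 = Finset.univ.image (finFunctionFinEquiv.symm (⟨i, h⟩ : Fin (n ^ k)))
    then 1 else 0

/-- A decision procedure `A`, taking a `k`-uniform hypergraph on `n` vertices and a natural number
`ξ`, is computable in polynomial time: some fixed program halts on every input with a nonzero
answer in register `0` exactly when `A` says `true`, within a time polynomial in `n` and in the
number of bits of `ξ`. -/
def ComputableInPolyTime {k : ℕ} (A : (n : ℕ) → UniformHypergraph n k → ℕ → Bool) : Prop :=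
  ∃ (P : LogRAM.Program) (q : Polynomial ℕ),
    ∀ (n : ℕ) (H : UniformHypergraph n k) (ξ : ℕ), ∃ (t : ℕ) (s : LogRAM.State),
      LogRAM.Exec P (H.input ξ) t s ∧ t ≤ q.eval (n + ξ.size) ∧
        (s.reg 0 ≠ 0 ↔ A n H ξ = true)

/-! Write `K = n ^ k`, `c = k % 2` and `l = k / 2`. A `k`-tuple is split as `(v, x, y)` into blocks
of `c`, `l` and `l` vertices, so the table has `K = nc * N * N` places with `nc = n ^ c` and `N = n
^ l`. Only increasing tuples are used, so every hyperedge is listed once and the entries are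
independent. For a guess `j / K` of the edge probability put `a = K b - j`.

Soundness. If `S` is independent and has at least `n / q` vertices, the sum of `a` over the
increasing tuples in `S` is `-j` times their number, which is at least `K / (q k) ^ k`
(`Nat.pow_le_pow_mul_choose`, `choose_le_card`). By Cauchy-Schwarz over `v`, the square of this sum
is at most `nc` times a sum over `v` of squares of sums over `(x, y)`. Expanded, these squares form
a quadratic form of the link matrix `Y`, whose entry at `(x, x')`, `(y, y')` is the sum over `v` of
`a (v, x, y) * a (v, x', y')`, together with diagonal terms (`sq_sum_le`). Hence `j² K² ≤ (q k) ^ (2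
k) * (K ‖Y‖ + nc D)`, where `D` bounds the sum of the squares of `a`. The test verifies that each of
the two terms is less than half of the left side. If it succeeds, no such `S` exists
(`not_independent`), and by pigeonhole `q` colours do not suffice (`lt_chromaticNumber`).

Computation. The norm is replaced by the integer `F`, the sum of the squared entries of `(Y Yᵀ) ^ (n
+ 1)`: `‖Y‖ ^ (4 (n + 1)) ≤ F ≤ dim * ‖Y‖ ^ (4 (n + 1))`. The dimension is at most `2 ^ n` for large
`n`, so taking roots loses less than a factor 2. As `F` is below `modulus k n`, it is found exactly
by modular arithmetic on numbers with polynomially many bits (`traceValue_eq`). All `j ≤ K` are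
tried, so `p` need not be known. The machine is handled by compiling arithmetic expressions with
bounded sums, correctness and cost being proved together (`exec_compile`, `Run.forLoop`,
`computable_of_accepts`).

Success on random input. Take `j = ⌊p K⌋`, and first let `Y` be formed from the true deviations `b -
p`. Correlations of these are at most a weight that charges `p / s` for the first occurrence of an
index and `s` for each repetition, for any `s ≥ 1` (`abs_integral_prod_le_weight`). As the weight is
multiplicative along a list, no closed walks have to be counted: in a moment of `Y Yᵀ` the factors
are peeled off one at a time, each at the price of the same constant (`abs_gram_pow_le`). With the
best `s` and about `k log n` factors this gives `‖Y‖ = O(log n * p √K)` with high probability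
(`real_lt_norm_le`). Markov's inequality controls the number of ones in the table, and rounding `p
K` changes the norm by `O(K²)` only. Both comparisons then reduce to `p √K ≥ const * q ^ (2 k) * log
n` (`accepts_of_bounds`), which follows from the lower bound on the expected number of hyperedges
since `n.choose k ≤ K = √K * √K`. -/

/-! ### Verified programming on the random access machine -/

namespace LogRAM

/-- The states agree on the memory and on the registers below `d`. -/
def Agree (d : ℕ) (s s' : State) : Prop :=
  (∀ r < d, s'.reg r = s.reg r) ∧ s'.mem = s.mem

theorem Agree.refl (d : ℕ) (s : State) : Agree d s s := ⟨fun _ _ => rfl, rfl⟩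

theorem Agree.trans {d : ℕ} {s s' s'' : State} (h : Agree d s s') (h' : Agree d s' s'') :
    Agree d s s'' :=
  ⟨fun r hr => (h'.1 r hr).trans (h.1 r hr), h'.2.trans h.2⟩

theorem Agree.mono {d d' : ℕ} {s s' : State} (h : Agree d s s') (hd : d' ≤ d) :
    Agree d' s s' := ⟨fun r hr => h.1 r (hr.trans_le hd), h.2⟩

@[simp] theorem setReg_reg (s : State) (d v r : ℕ) :
    (s.setReg d v).reg r = if r = d then v else s.reg r := by
  simp [State.setReg, Function.update_apply]

@[simp] theorem setReg_mem (s : State) (d v : ℕ) : (s.setReg d v).mem = s.mem := rfl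

@[simp] theorem setMem_reg (s : State) (a v : ℕ) : (s.setMem a v).reg = s.reg := rfl

theorem Agree.setReg {d : ℕ} {s s' : State} (h : Agree d s s') (i v : ℕ) :
    Agree d (s.setReg i v) (s'.setReg i v) :=
  ⟨fun r hr => by simp [h.1 r hr], h.2⟩

theorem agree_setReg {d r v : ℕ} (s : State) (hr : d ≤ r) : Agree d s (s.setReg r v) :=
  ⟨fun r' hr' => by rw [setReg_reg, if_neg (by omega)], rfl⟩

/-- The registers whose value, and not only its number of bits, is bounded. -/
def Small (r : ℕ) : Prop := r < 16 ∧ r ≠ 1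

instance (r : ℕ) : Decidable (Small r) := inferInstanceAs (Decidable (_ ∧ _))

/-- All small registers have value at most `B`, and all named registers and all memory cells
have at most `B` bits. -/
structure Ok (B : ℕ) (s : State) : Prop where
  small : ∀ r, Small r → s.reg r ≤ B
  reg : ∀ r < 31, (s.reg r).size ≤ B
  mem : ∀ a, (s.mem a).size ≤ B

theorem size_le_self (n : ℕ) : n.size ≤ n := Nat.size_le.2 Nat.lt_two_pow_self

theorem size_mono {m n : ℕ} (h : m ≤ n) : m.size ≤ n.size := Nat.size_le_size h

theorem size_add_le (m n : ℕ) : (m + n).size ≤ m.size + n.size + 1 := by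
  rw [Nat.size_le]
  have h1 := Nat.lt_size_self m
  have h2 := Nat.lt_size_self n
  have h3 : 2 ^ m.size ≤ 2 ^ (m.size + n.size) := Nat.pow_le_pow_right (by norm_num) (by omega)
  have h4 : 2 ^ n.size ≤ 2 ^ (m.size + n.size) := Nat.pow_le_pow_right (by norm_num) (by omega)
  rw [pow_succ]
  omega

theorem size_mul_le (m n : ℕ) : (m * n).size ≤ m.size + n.size := by
  rw [Nat.size_le, pow_add]
  exact Nat.mul_lt_mul'' (Nat.lt_size_self m) (Nat.lt_size_self n)

theorem size_sum_le {B b : ℕ} {f : ℕ → ℕ} (hf : ∀ m < b, (f m).size ≤ B) :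
    (∑ m ∈ Finset.range b, f m).size ≤ b.size + B := by
  rcases Nat.eq_zero_or_pos b with rfl | hb
  · simp
  rw [Nat.size_le, pow_add]
  calc ∑ m ∈ Finset.range b, f m ≤ ∑ m ∈ Finset.range b, 2 ^ B :=
        Finset.sum_le_sum fun m hm => (Nat.size_le.1 (hf m (Finset.mem_range.1 hm))).le
    _ = b * 2 ^ B := by simp
    _ < 2 ^ b.size * 2 ^ B := Nat.mul_lt_mul_of_pos_right (Nat.lt_size_self b) (by positivity)

theorem Ok.agree {B : ℕ} {s s' : State} (h : Ok B s) (ha : Agree 31 s s') : Ok B s' where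
  small r hr := by rw [ha.1 r (by have := hr.1; omega)]; exact h.small r hr
  reg r hr := by rw [ha.1 r hr]; exact h.reg r hr
  mem a := by rw [ha.2]; exact h.mem a

theorem Ok.setReg {B r v : ℕ} {s : State} (h : Ok B s) (hs : Small r → v ≤ B)
    (hv : v.size ≤ B) : Ok B (s.setReg r v) where
  small r' hr' := by
    rw [setReg_reg]; split_ifs with h'
    · exact hs (h' ▸ hr')
    · exact h.small r' hr'
  reg r' hr' := by
    rw [setReg_reg]; split_ifs with h'
    · exact hv
    · exact h.reg r' hr'
  mem a := h.mem a

theorem Ok.setReg_small {B r v : ℕ} {s : State} (h : Ok B s) (hv : v ≤ B) :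
    Ok B (s.setReg r v) :=
  h.setReg (fun _ => hv) ((size_le_self v).trans hv)

theorem Ok.setReg_big {B r v : ℕ} {s : State} (h : Ok B s) (hr : ¬ Small r)
    (hv : v.size ≤ B) : Ok B (s.setReg r v) :=
  h.setReg (fun h => absurd h hr) hv

/-- Arithmetic expressions in the registers and the memory; `sum i b e` is the sum of `e` over
all values of the register `i` smaller than the value of the register `b`. -/
inductive Expr : Type
  | reg (r : ℕ)
  | const (c : ℕ)
  | add (a b : Expr)
  | sub (a b : Expr)
  | mul (a b : Expr)
  | div (a b : Expr)
  | load (a : Expr)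
  | sum (i b : ℕ) (e : Expr)

namespace Expr

/-- The value of an expression. -/
def eval : Expr → State → ℕ
  | reg r, s => s.reg r
  | const c, _ => c
  | add a b, s => a.eval s + b.eval s
  | sub a b, s => a.eval s - b.eval s
  | mul a b, s => a.eval s * b.eval s
  | div a b, s => a.eval s / b.eval s
  | load a, s => s.mem (a.eval s)
  | sum i b e, s => ∑ m ∈ Finset.range (s.reg b), e.eval (s.setReg i m)

/-- Only named registers occur, and summation is over small registers. -/
def WF : Expr → Prop
  | reg r => r < 31
  | const _ => True
  | add a b => a.WF ∧ b.WF
  | sub a b => a.WF ∧ b.WF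
  | mul a b => a.WF ∧ b.WF
  | div a b => a.WF ∧ b.WF
  | load a => a.WF
  | sum i b e => Small i ∧ Small b ∧ i ≠ b ∧ e.WF

/-- A program that computes the expression into register `d`. -/
def compile : Expr → ℕ → Program
  | reg r, d => .copy d r
  | const c, d => .const d c
  | add a b, d => .seq (a.compile d) (.seq (b.compile (d + 1)) (.add d d (d + 1)))
  | sub a b, d => .seq (a.compile d) (.seq (b.compile (d + 1)) (.sub d d (d + 1)))
  | mul a b, d => .seq (a.compile d) (.seq (b.compile (d + 1)) (.mul d d (d + 1)))
  | div a b, d => .seq (a.compile d) (.seq (b.compile (d + 1)) (.div d d (d + 1)))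
  | load a, d => .seq (a.compile d) (.load d d)
  | sum i b e, d =>
    .seq (.copy (d + 1) i) <| .seq (.const d 0) <| .seq (.const i 0) <| .seq (.copy (d + 2) b) <|
    .seq (.loop (d + 2) <|
      .seq (e.compile (d + 3)) <| .seq (.add d d (d + 3)) <| .seq (.const (d + 3) 1) <|
      .seq (.add i i (d + 3)) (.sub (d + 2) b i)) <|
    .copy i (d + 1)

/-- A bound on the number of bits of the value. -/
def bits : Expr → ℕ → ℕ
  | reg _, B => B
  | const c, _ => c.size
  | add a b, B => a.bits B + b.bits B + 1
  | sub a _, B => a.bits B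
  | mul a b, B => a.bits B + b.bits B
  | div a _, B => a.bits B
  | load _, B => B
  | sum _ _ e, B => B + e.bits B

/-- A bound on the running time of the compiled program. -/
def cost : Expr → ℕ → ℕ
  | reg _, B => 1 + B
  | const c, _ => 1 + c.size
  | add a b, B => a.cost B + b.cost B + 1 + a.bits B + b.bits B
  | sub a b, B => a.cost B + b.cost B + 1 + a.bits B + b.bits B
  | mul a b, B => a.cost B + b.cost B + 1 + a.bits B + b.bits B
  | div a b, B => a.cost B + b.cost B + 1 + a.bits B + b.bits B
  | load a, B => a.cost B + 1 + a.bits B + B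
  | sum _ _ e, B => (1 + B) * (e.cost B + 2 * e.bits B + 5 * B + 20)

/-- Well-formed expressions mention only registers below 31. The registers from 31 on are scratch
space that compiled code may overwrite without changing any value. -/
theorem eval_congr {e : Expr} (he : e.WF) {s s' : State} (h : Agree 31 s s') :
    e.eval s' = e.eval s := by
  induction e generalizing s s' with
  | reg r => exact h.1 r he
  | const c => rfl
  | add a b iha ihb => simp only [eval, iha he.1 h, ihb he.2 h]
  | sub a b iha ihb => simp only [eval, iha he.1 h, ihb he.2 h]
  | mul a b iha ihb => simp only [eval, iha he.1 h, ihb he.2 h]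
  | div a b iha ihb => simp only [eval, iha he.1 h, ihb he.2 h]
  | load a ih => simp only [eval, ih he h, h.2]
  | sum i b e ih =>
    simp only [eval]
    rw [h.1 b (by have := he.2.1.1; omega)]
    exact Finset.sum_congr rfl fun m _ => ih he.2.2.2 (h.setReg i m)

theorem size_eval_le {e : Expr} (he : e.WF) {B : ℕ} {s : State} (h : Ok B s) :
    (e.eval s).size ≤ e.bits B := by
  induction e generalizing s with
  | reg r => exact h.reg r he
  | const c => exact le_rfl
  | add a b iha ihb =>
    have := size_add_le (a.eval s) (b.eval s)
    have := iha he.1 h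
    have := ihb he.2 h
    simp only [eval, bits]; omega
  | sub a b iha ihb => exact (size_mono (Nat.sub_le _ _)).trans (iha he.1 h)
  | mul a b iha ihb =>
    have := size_mul_le (a.eval s) (b.eval s)
    have := iha he.1 h
    have := ihb he.2 h
    simp only [eval, bits]; omega
  | div a b iha ihb => exact (size_mono (Nat.div_le_self _ _)).trans (iha he.1 h)
  | load a ih => exact h.mem _
  | sum i b e ih =>
    have hb := h.small b he.2.1
    refine (size_sum_le (B := e.bits B) fun m hm => ih he.2.2.2 (h.setReg_small (by omega))).trans
      (Nat.add_le_add_right ((size_le_self _).trans hb) _)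

/-- Scratch registers are used as a stack: the second operand is compiled one level higher and so
leaves the first value in `d` intact. -/
theorem exec_seq_binop {a b : Expr} {op : Program} {f : ℕ → ℕ → ℕ} {d B : ℕ} {s : State}
    (hop : ∀ s : State, Exec op s (1 + (s.reg d).size + (s.reg (d + 1)).size)
      (s.setReg d (f (s.reg d) (s.reg (d + 1)))))
    (ha : a.WF) (hb : b.WF) (hd : 31 ≤ d) (h : Ok B s)
    (iha : ∃ t s', Exec (a.compile d) s t s' ∧ Agree d s s' ∧ s'.reg d = a.eval s ∧
      t ≤ a.cost B)
    (ihb : ∀ s, Ok B s → ∃ t s', Exec (b.compile (d + 1)) s t s' ∧ Agree (d + 1) s s' ∧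
      s'.reg (d + 1) = b.eval s ∧ t ≤ b.cost B) :
    ∃ t s', Exec (.seq (a.compile d) (.seq (b.compile (d + 1)) op)) s t s' ∧ Agree d s s' ∧
      s'.reg d = f (a.eval s) (b.eval s) ∧
      t ≤ a.cost B + b.cost B + 1 + a.bits B + b.bits B := by
  obtain ⟨t₁, s₁, h₁, ha₁, hv₁, ht₁⟩ := iha
  obtain ⟨t₂, s₂, h₂, ha₂, hv₂, ht₂⟩ := ihb s₁ (h.agree (ha₁.mono hd))
  refine ⟨_, _, h₁.seq (h₂.seq (hop s₂)), ?_, ?_, ?_⟩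
  · exact (ha₁.trans (ha₂.mono (by omega))).trans (agree_setReg _ le_rfl)
  · rw [setReg_reg, if_pos rfl, ha₂.1 d (by omega), hv₁, hv₂, eval_congr hb (ha₁.mono hd)]
  · rw [ha₂.1 d (by omega), hv₁, hv₂, eval_congr hb (ha₁.mono hd)]
    have := size_eval_le ha h
    have := size_eval_le hb h
    omega

/-- The induction is on the number of remaining terms, hence the arbitrary start of both the
accumulator and `i`. The size bound is asked for all partial sums, since each addition is charged
for the bits of the current accumulator. -/
theorem exec_sum_loop {e : Expr} {i b d B : ℕ} (hi : Small i) (hb : Small b) (hib : i ≠ b)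
    (he : e.WF) (hd : 31 ≤ d)
    (ih : ∀ s, Ok B s → ∃ t s', Exec (e.compile (d + 3)) s t s' ∧ Agree (d + 3) s s' ∧
      s'.reg (d + 3) = e.eval s ∧ t ≤ e.cost B) (n : ℕ) (s : State)
    (h : Ok B s) (hn : s.reg (d + 2) = n) (hib' : s.reg i + n = s.reg b)
    (hacc : ∀ m ≤ n, (s.reg d + ∑ m ∈ Finset.range m,
      e.eval (s.setReg i (s.reg i + m))).size ≤ B + e.bits B) :
    ∃ t s', Exec (.loop (d + 2) <| .seq (e.compile (d + 3)) <| .seq (.add d d (d + 3)) <|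
        .seq (.const (d + 3) 1) <| .seq (.add i i (d + 3)) (.sub (d + 2) b i)) s t s' ∧
      (∀ r < d, r ≠ i → s'.reg r = s.reg r) ∧ s'.mem = s.mem ∧
      s'.reg (d + 1) = s.reg (d + 1) ∧
      s'.reg d = s.reg d + ∑ m ∈ Finset.range n, e.eval (s.setReg i (s.reg i + m)) ∧
      t ≤ 1 + n * (e.cost B + 2 * e.bits B + 5 * B + 8) := by
  have hi16 := hi.1
  have hb16 := hb.1
  induction n generalizing s with
  | zero =>
    refine ⟨_, s, .loop_zero hn, fun _ _ _ => rfl, rfl, rfl, by simp, ?_⟩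
    rw [hn]; simp
  | succ n IH =>
    obtain ⟨t, s₁, h₁, ha₁, hv₁, ht₁⟩ := ih s h
    have hsi : s₁.reg i = s.reg i := ha₁.1 i (by omega)
    have hsb : s₁.reg b = s.reg b := ha₁.1 b (by omega)
    have hsd : s₁.reg d = s.reg d := ha₁.1 d (by omega)
    have hbB := h.small b hb
    have heval0 : e.eval s = e.eval (s.setReg i (s.reg i + 0)) := by
      congr 1
      simp [State.setReg]
    let s₂ := s₁.setReg d (s₁.reg d + s₁.reg (d + 3))
    let s₃ := s₂.setReg (d + 3) 1
    let s₄ := s₃.setReg i (s₃.reg i + s₃.reg (d + 3))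
    let s₅ := s₄.setReg (d + 2) (s₄.reg b - s₄.reg i)
    have e₂ : Exec (.add d d (d + 3)) s₁ _ s₂ := .add _ _ _ _
    have e₃ : Exec (.const (d + 3) 1) s₂ _ s₃ := .const _ _ _
    have e₄ : Exec (.add i i (d + 3)) s₃ _ s₄ := .add _ _ _ _
    have e₅ : Exec (.sub (d + 2) b i) s₄ _ s₅ := .sub _ _ _ _
    have r3i : s₃.reg i = s.reg i := by
      simp only [s₃, s₂, setReg_reg]
      rw [if_neg (by omega), if_neg (by omega), hsi]
    have r3d : s₃.reg (d + 3) = 1 := by simp [s₃]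
    have r4i : s₄.reg i = s.reg i + 1 := by simp [s₄, r3i, r3d]
    have r4b : s₄.reg b = s.reg b := by
      simp only [s₄, s₃, s₂, setReg_reg]
      rw [if_neg (by omega), if_neg (by omega), if_neg (by omega), hsb]
    have r5i : s₅.reg i = s.reg i + 1 := by
      simp only [s₅, setReg_reg]; rw [if_neg (by omega), r4i]
    have r5b : s₅.reg b = s.reg b := by
      simp only [s₅, setReg_reg]; rw [if_neg (by omega), r4b]
    have r5d : s₅.reg d = s.reg d + e.eval s := by
      simp only [s₅, s₄, s₃, s₂, setReg_reg]
      rw [if_neg (by omega), if_neg (by omega), if_neg (by omega), if_true, hsd, hv₁]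
    have r5d1 : s₅.reg (d + 1) = s.reg (d + 1) := by
      simp only [s₅, s₄, s₃, s₂, setReg_reg]
      rw [if_neg (by omega), if_neg (by omega), if_neg (by omega), if_neg (by omega)]
      exact ha₁.1 _ (by omega)
    have r5o : ∀ r < d, r ≠ i → s₅.reg r = s.reg r := by
      intro r hr hri
      simp only [s₅, s₄, s₃, s₂, setReg_reg]
      rw [if_neg (by omega), if_neg hri, if_neg (by omega), if_neg (by omega)]
      exact ha₁.1 _ (by omega)
    have m5 : s₅.mem = s.mem := ha₁.2
    have hag : Agree 31 (s.setReg i (s.reg i + 1)) s₅ := by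
      refine ⟨fun r hr => ?_, m5⟩
      rw [setReg_reg s i]
      split_ifs with hri
      · rw [hri, r5i]
      · exact r5o r (by omega) hri
    have hok5 : Ok B s₅ := (h.setReg_small (r := i) (v := s.reg i + 1) (by omega)).agree hag
    have heval : ∀ m, e.eval (s₅.setReg i (s₅.reg i + m)) =
        e.eval (s.setReg i (s.reg i + (m + 1))) := by
      intro m
      refine eval_congr he ⟨fun r hr => ?_, m5⟩
      simp only [setReg_reg]
      split_ifs with hri
      · rw [r5i]; ring
      · exact r5o r (by omega) hri
    have hsum : ∀ m, s₅.reg d + ∑ m ∈ Finset.range m, e.eval (s₅.setReg i (s₅.reg i + m)) =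
        s.reg d + ∑ m ∈ Finset.range (m + 1), e.eval (s.setReg i (s.reg i + m)) := by
      intro m
      rw [Finset.sum_range_succ', r5d, heval0, Finset.sum_congr rfl fun m _ => heval m]
      ring
    obtain ⟨t', s', hx, ho, hm, h1, h2, ht'⟩ := IH s₅ hok5
      (by simp only [s₅, setReg_reg, if_true]; rw [r4b, r4i]; omega)
      (by rw [r5i, r5b]; omega)
      (fun m hm => by rw [hsum]; exact hacc _ (by omega))
    refine ⟨_, s', .loop_pos (by omega) (h₁.seq (e₂.seq (e₃.seq (e₄.seq e₅)))) hx,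
      fun r hr hri => (ho r hr hri).trans (r5o r hr hri), hm.trans m5, h1.trans r5d1, ?_, ?_⟩
    · rw [h2, hsum]
    · rw [r3i, r3d, r4b, r4i, hsd, hv₁]
      have := size_eval_le he h
      have h2 : (s.reg d).size ≤ B + e.bits B := by simpa using hacc 0 (Nat.zero_le _)
      have h3 : (s.reg (d + 2)).size ≤ B := (size_le_self _).trans (by omega)
      have h4 : (s.reg i).size ≤ B := (size_le_self _).trans (by omega)
      have h5 : (s.reg i + 1).size ≤ B := (size_le_self _).trans (by omega)
      have h6 : (s.reg b).size ≤ B := (size_le_self _).trans (by omega)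
      have h7 : Nat.size 1 = 1 := Nat.size_one
      rw [h7]
      calc _ ≤ (e.cost B + 2 * e.bits B + 5 * B + 8) +
            (1 + n * (e.cost B + 2 * e.bits B + 5 * B + 8)) := by omega
        _ = _ := by ring

theorem exec_compile {e : Expr} (he : e.WF) {B d : ℕ} (hd : 31 ≤ d) {s : State} (h : Ok B s) :
    ∃ t s', Exec (e.compile d) s t s' ∧ Agree d s s' ∧ s'.reg d = e.eval s ∧ t ≤ e.cost B := by
  induction e generalizing d s with
  | reg r =>
    have := h.reg r he
    exact ⟨_, _, .copy d r s, agree_setReg _ le_rfl, by simp [eval], by simp only [cost]; omega⟩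
  | const c => exact ⟨_, _, .const d c s, agree_setReg _ le_rfl, by simp [eval], le_rfl⟩
  | add a b iha ihb =>
    exact exec_seq_binop (f := (· + ·)) (fun s => .add d d (d + 1) s) he.1 he.2 hd h
      (iha he.1 hd h) fun s hs => ihb he.2 (by omega) hs
  | sub a b iha ihb =>
    exact exec_seq_binop (f := (· - ·)) (fun s => .sub d d (d + 1) s) he.1 he.2 hd h
      (iha he.1 hd h) fun s hs => ihb he.2 (by omega) hs
  | mul a b iha ihb =>
    exact exec_seq_binop (f := (· * ·)) (fun s => .mul d d (d + 1) s) he.1 he.2 hd h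
      (iha he.1 hd h) fun s hs => ihb he.2 (by omega) hs
  | div a b iha ihb =>
    exact exec_seq_binop (f := (· / ·)) (fun s => .div d d (d + 1) s) he.1 he.2 hd h
      (iha he.1 hd h) fun s hs => ihb he.2 (by omega) hs
  | load a ih =>
    obtain ⟨t, s₁, h₁, ha₁, hv₁, ht₁⟩ := ih he hd h
    refine ⟨_, _, h₁.seq (.load d d s₁), ha₁.trans (agree_setReg _ le_rfl), ?_, ?_⟩
    · simp [hv₁, eval, ha₁.2]
    · have := size_eval_le (e := a) he h
      have := h.mem (a.eval s)
      simp only [hv₁, ha₁.2, cost]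
      omega
  | sum i b e ih =>
    obtain ⟨hi, hb, hib, he⟩ := he
    have hi16 := hi.1
    have hb16 := hb.1
    have hbB := h.small b hb
    let s₁ := s.setReg (d + 1) (s.reg i)
    let s₂ := s₁.setReg d 0
    let s₃ := s₂.setReg i 0
    let s₄ := s₃.setReg (d + 2) (s₃.reg b)
    have e₁ : Exec (.copy (d + 1) i) s _ s₁ := .copy _ _ _
    have e₂ : Exec (.const d 0) s₁ _ s₂ := .const _ _ _
    have e₃ : Exec (.const i 0) s₂ _ s₃ := .const _ _ _
    have e₄ : Exec (.copy (d + 2) b) s₃ _ s₄ := .copy _ _ _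
    have r3b : s₃.reg b = s.reg b := by
      simp only [s₃, s₂, s₁, setReg_reg]
      rw [if_neg (by omega), if_neg (by omega), if_neg (by omega)]
    have r4b : s₄.reg b = s.reg b := by
      simp only [s₄, setReg_reg]
      rw [if_neg (by omega), r3b]
    have r4i : s₄.reg i = 0 := by
      simp only [s₄, s₃, setReg_reg]
      rw [if_neg (by omega), if_true]
    have r4d : s₄.reg d = 0 := by
      simp only [s₄, s₃, s₂, setReg_reg]
      rw [if_neg (by omega), if_neg (by omega), if_true]
    have r4d1 : s₄.reg (d + 1) = s.reg i := by
      simp only [s₄, s₃, s₂, s₁, setReg_reg]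
      rw [if_neg (by omega), if_neg (by omega), if_neg (by omega), if_true]
    have r4o : ∀ r < d, r ≠ i → s₄.reg r = s.reg r := by
      intro r hr hri
      simp only [s₄, s₃, s₂, s₁, setReg_reg]
      rw [if_neg (by omega), if_neg hri, if_neg (by omega), if_neg (by omega)]
    have hag : Agree 31 (s.setReg i 0) s₄ := by
      refine ⟨fun r hr => ?_, rfl⟩
      rw [setReg_reg s i]
      split_ifs with hri
      · rw [hri, r4i]
      · exact r4o r (by omega) hri
    have hok : Ok B s₄ := (h.setReg_small (Nat.zero_le _)).agree hag
    have heval : ∀ m, e.eval (s₄.setReg i (s₄.reg i + m)) = e.eval (s.setReg i m) := by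
      intro m
      refine eval_congr he ⟨fun r hr => ?_, rfl⟩
      simp only [setReg_reg]
      split_ifs with hri
      · rw [r4i, zero_add]
      · exact r4o r (by omega) hri
    obtain ⟨t, s', hx, ho, hm, h1, h2, ht⟩ := exec_sum_loop hi hb hib he hd
      (fun s hs => ih he (by omega) hs) (s.reg b) s₄ hok (by simp [s₄, r3b])
      (by rw [r4b, r4i, zero_add]) (by
        intro m hm
        rw [r4d, zero_add]
        refine (size_sum_le (B := e.bits B) fun m' hm' => ?_).trans
          (Nat.add_le_add_right ((size_le_self _).trans (hm.trans hbB)) _)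
        rw [heval]
        exact size_eval_le he (h.setReg_small (by omega)))
    -- The final copy restores the old value of the summation register from `d + 1`, so that
    -- evaluation changes nothing below `d`.
    refine ⟨_, _, e₁.seq (e₂.seq (e₃.seq (e₄.seq (hx.seq (.copy i (d + 1) s'))))),
      ⟨fun r hr => ?_, hm⟩, ?_, ?_⟩
    · rw [setReg_reg, h1, r4d1]
      split_ifs with hri
      · rw [hri]
      · rw [ho r hr hri, r4o r hr hri]
    · rw [setReg_reg, if_neg (by omega), h2, r4d, zero_add]
      exact Finset.sum_congr rfl fun m _ => heval m
    · rw [h1, r4d1, r3b]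
      have h3 : (s.reg i).size ≤ B := h.reg i (by omega)
      have h6 : (s.reg b).size ≤ B := (size_le_self _).trans (by omega)
      have h7 : Nat.size 0 = 0 := Nat.size_zero
      rw [h7]
      have h8 : s.reg b * (e.cost B + 2 * e.bits B + 5 * B + 8) ≤
        B * (e.cost B + 2 * e.bits B + 5 * B + 20) := Nat.mul_le_mul hbB (by omega)
      simp only [cost, add_mul, one_mul]
      omega

end Expr

end LogRAM

/-! ### Polynomial cost bounds, assignments, loops and tables -/

namespace LogRAM

/-- A function bounded by a polynomial. -/
def PolyBounded (f : ℕ → ℕ) : Prop := ∃ q : Polynomial ℕ, ∀ B, f B ≤ q.eval B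

namespace PolyBounded

theorem const (c : ℕ) : PolyBounded fun _ => c := ⟨.C c, fun B => by simp⟩

theorem id : PolyBounded fun B => B := ⟨.X, fun B => by simp⟩

theorem add {f g : ℕ → ℕ} (hf : PolyBounded f) (hg : PolyBounded g) :
    PolyBounded fun B => f B + g B := by
  obtain ⟨p, hp⟩ := hf
  obtain ⟨q, hq⟩ := hg
  exact ⟨p + q, fun B => by rw [Polynomial.eval_add]; exact Nat.add_le_add (hp B) (hq B)⟩

theorem mul {f g : ℕ → ℕ} (hf : PolyBounded f) (hg : PolyBounded g) :
    PolyBounded fun B => f B * g B := by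
  obtain ⟨p, hp⟩ := hf
  obtain ⟨q, hq⟩ := hg
  exact ⟨p * q, fun B => by rw [Polynomial.eval_mul]; exact Nat.mul_le_mul (hp B) (hq B)⟩

end PolyBounded

namespace Expr

theorem polyBounded_bits (e : Expr) : PolyBounded e.bits := by
  induction e with
  | reg r => exact .id
  | const c => exact .const _
  | add a b iha ihb => exact (iha.add ihb).add (.const 1)
  | sub a b iha ihb => exact iha
  | mul a b iha ihb => exact iha.add ihb
  | div a b iha ihb => exact iha
  | load a ih => exact .id
  | sum i b e ih => exact PolyBounded.id.add ih

theorem polyBounded_cost (e : Expr) : PolyBounded e.cost := by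
  induction e with
  | reg r => exact (PolyBounded.const 1).add .id
  | const c => exact .const _
  | add a b iha ihb | sub a b iha ihb | mul a b iha ihb | div a b iha ihb =>
    exact (((iha.add ihb).add (.const 1)).add a.polyBounded_bits).add b.polyBounded_bits
  | load a ih => exact ((ih.add (.const 1)).add a.polyBounded_bits).add .id
  | sum i b e ih =>
    exact ((PolyBounded.const 1).add .id).mul (((ih.add ((PolyBounded.const 2).mul
      e.polyBounded_bits)).add ((PolyBounded.const 5).mul .id)).add (.const 20))

end Expr

/-- Started in any state that agrees with `s` on the named registers and the memory, the program
halts within time `T` in a state that so agrees with `s'`. -/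
def Run (P : Program) (s : State) (T : ℕ) (s' : State) : Prop :=
  ∀ s₀, Agree 31 s s₀ → ∃ t s₁, Exec P s₀ t s₁ ∧ t ≤ T ∧ Agree 31 s' s₁

theorem Run.seq {P Q : Program} {s s₁ s₂ : State} {T₁ T₂ : ℕ} (h₁ : Run P s T₁ s₁)
    (h₂ : Run Q s₁ T₂ s₂) : Run (.seq P Q) s (T₁ + T₂) s₂ := by
  intro s₀ h₀
  obtain ⟨t, s', h, ht, ha⟩ := h₁ s₀ h₀
  obtain ⟨t', s'', h', ht', ha'⟩ := h₂ s' ha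
  exact ⟨_, _, h.seq h', by omega, ha'⟩

/-- Assign the value of an expression to a register. -/
def assign (r : ℕ) (e : Expr) : Program := .seq (e.compile 32) (.copy r 32)

theorem Run.assign {e : Expr} (he : e.WF) (r : ℕ) {B : ℕ} {s : State} (h : Ok B s) :
    Run (assign r e) s (e.cost B + 1 + e.bits B) (s.setReg r (e.eval s)) := by
  intro s₀ h₀
  have hok := h.agree h₀
  obtain ⟨t, s₁, h₁, ha, hv, ht⟩ := Expr.exec_compile he (d := 32) (by norm_num) hok
  refine ⟨_, _, h₁.seq (.copy r 32 s₁), ?_, ?_⟩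
  · rw [hv]
    have := Expr.size_eval_le he hok
    omega
  · rw [hv, Expr.eval_congr he h₀]
    exact (h₀.trans (ha.mono (by norm_num))).setReg _ _

/-- Write the value of the expression `e` into the memory cell whose address is the value of `a`. -/
def setCell (a e : Expr) : Program := .seq (a.compile 32) (.seq (e.compile 33) (.store 32 33))

theorem Run.setCell {a e : Expr} (ha : a.WF) (he : e.WF) {B : ℕ} {s : State} (h : Ok B s) :
    Run (setCell a e) s (a.cost B + e.cost B + 1 + a.bits B + e.bits B)
      (s.setMem (a.eval s) (e.eval s)) := by
  intro s₀ h₀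
  have hok := h.agree h₀
  obtain ⟨t, s₁, h₁, ha₁, hv, ht⟩ := Expr.exec_compile ha (d := 32) (by norm_num) hok
  have hag : Agree 31 s₀ s₁ := ha₁.mono (by norm_num)
  obtain ⟨t', s₂, h₂, ha₂, hv', ht'⟩ := Expr.exec_compile he (d := 33) (by norm_num) (hok.agree hag)
  have e32 : s₂.reg 32 = a.eval s₀ := (ha₂.1 32 (by norm_num)).trans hv
  have e33 : s₂.reg 33 = e.eval s₀ := hv'.trans (Expr.eval_congr he hag)
  refine ⟨_, _, h₁.seq (h₂.seq (.store 32 33 s₂)), ?_, ?_⟩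
  · rw [e32, e33]
    have := Expr.size_eval_le ha hok
    have := Expr.size_eval_le he hok
    omega
  · rw [e32, e33, Expr.eval_congr ha h₀, Expr.eval_congr he h₀]
    have := (h₀.trans hag).trans (ha₂.mono (by norm_num))
    refine ⟨this.1, ?_⟩
    simp only [State.setMem, this.2]

/-- Run `P` for all values of the register `i` smaller than the value of the register `b`. -/
def forLoop (i b : ℕ) (P : Program) : Program :=
  .seq (.const i 0) <| .seq (.sub 31 b i) <| .loop 31 <|
    .seq P <| .seq (.const 32 1) <| .seq (.add i i 32) (.sub 31 b i)

/-- After every pass the counter 31 is recomputed from `b` and `i`. The body may therefore overwrite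
it, in particular contain further loops, as long as it preserves `i` and `b`. -/
theorem Run.forLoop {i b : ℕ} {P : Program} {B T β : ℕ} (hi : i < 31) (hb : b < 31) (hib : i ≠ b)
    (hβ : β ≤ B) (Inv : ℕ → State → Prop) {s : State} (hs : s.reg b = β)
    (h0 : Inv 0 (s.setReg i 0))
    (step : ∀ m < β, ∀ s, s.reg i = m → s.reg b = β → Inv m s → ∃ s₂, Run P s T s₂ ∧
      s₂.reg i = m ∧ s₂.reg b = β ∧ Inv (m + 1) (s₂.setReg i (m + 1))) :
    ∃ s₂, Run (forLoop i b P) s ((1 + B) * (T + 5 * B + 10)) s₂ ∧ s₂.reg i = β ∧ Inv β s₂ := by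
  have key : ∀ d m, m + d = β → ∀ s, s.reg i = m → s.reg b = β → Inv m s →
      ∃ s₂, s₂.reg i = β ∧ Inv β s₂ ∧ ∀ s₀, Agree 31 s s₀ → s₀.reg 31 = d →
        ∃ t s₁, Exec (.loop 31 <| .seq P <| .seq (.const 32 1) <| .seq (.add i i 32)
          (.sub 31 b i)) s₀ t s₁ ∧ t ≤ 1 + d * (T + 5 * B + 8) ∧ Agree 31 s₂ s₁ := by
    intro d
    induction d with
    | zero =>
      intro m hm s hsi hsb hinv
      obtain rfl : m = β := by omega
      refine ⟨s, hsi, hinv, fun s₀ h₀ hd => ⟨_, s₀, .loop_zero hd, by simp [hd], h₀⟩⟩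
    | succ d ih =>
      intro m hm s hsi hsb hinv
      obtain ⟨s₂, hrun, h2i, h2b, hinv'⟩ := step m (by omega) s hsi hsb hinv
      obtain ⟨s₃, h3i, h3inv, hex⟩ := ih (m + 1) (by omega) (s₂.setReg i (m + 1)) (by simp)
        (by rw [setReg_reg, if_neg hib.symm, h2b]) hinv'
      refine ⟨s₃, h3i, h3inv, fun s₀ h₀ hd => ?_⟩
      obtain ⟨t, s₁, hP, ht, ha⟩ := hrun s₀ h₀
      let s₄ := s₁.setReg 32 1
      let s₅ := s₄.setReg i (s₄.reg i + s₄.reg 32)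
      let s₆ := s₅.setReg 31 (s₅.reg b - s₅.reg i)
      have e₄ : Exec (.const 32 1) s₁ _ s₄ := .const _ _ _
      have e₅ : Exec (.add i i 32) s₄ _ s₅ := .add _ _ _ _
      have e₆ : Exec (.sub 31 b i) s₅ _ s₆ := .sub _ _ _ _
      have r4i : s₄.reg i = m := by
        simp only [s₄, setReg_reg]; rw [if_neg (by omega), ha.1 i hi, h2i]
      have r432 : s₄.reg 32 = 1 := by simp [s₄]
      have r5i : s₅.reg i = m + 1 := by simp [s₅, r4i, r432]
      have r5b : s₅.reg b = β := by
        simp only [s₅, s₄, setReg_reg]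
        rw [if_neg hib.symm, if_neg (by omega), ha.1 b hb, h2b]
      have hag : Agree 31 (s₂.setReg i (m + 1)) s₆ := by
        refine ⟨fun r hr => ?_, ha.2⟩
        simp only [s₆, setReg_reg]
        rw [if_neg (by omega)]
        split_ifs with hri
        · rw [hri, r5i]
        · simp only [s₅, s₄, setReg_reg]
          rw [if_neg hri, if_neg (by omega), ha.1 r hr]
      obtain ⟨t', s₇, hl, ht', ha'⟩ := hex s₆ hag (by
        simp only [s₆, setReg_reg, if_true]; rw [r5b, r5i]; omega)
      refine ⟨_, s₇, .loop_pos (by omega) (hP.seq (e₄.seq (e₅.seq e₆))) hl, ?_, ha'⟩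
      rw [hd, r4i, r432, r5b, r5i, Nat.size_one]
      have h1 : (d + 1).size ≤ B := (size_le_self _).trans (by omega)
      have h2 : m.size ≤ B := (size_le_self _).trans (by omega)
      have h3 : (m + 1).size ≤ B := (size_le_self _).trans (by omega)
      have h4 : β.size ≤ B := (size_le_self _).trans (by omega)
      calc _ ≤ (T + 5 * B + 8) + (1 + d * (T + 5 * B + 8)) := by omega
        _ = _ := by ring
  obtain ⟨s₂, h2i, h2, hex⟩ := key β 0 (by omega) (s.setReg i 0) (by simp)
    (by rw [setReg_reg, if_neg hib.symm, hs]) h0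
  refine ⟨s₂, fun s₀ h₀ => ?_, h2i, h2⟩
  have h₀' := h₀.setReg i 0
  have hb0 : (s₀.setReg i 0).reg b = β := by
    rw [setReg_reg, if_neg hib.symm, h₀.1 b hb, hs]
  have hi0 : (s₀.setReg i 0).reg i = 0 := by simp
  have e₂ := Exec.sub 31 b i (s₀.setReg i 0)
  rw [hb0, hi0] at e₂
  obtain ⟨t, s₁, he, ht, ha⟩ := hex ((s₀.setReg i 0).setReg 31 (β - 0))
    (h₀'.trans (agree_setReg _ le_rfl)) (by rw [setReg_reg, if_pos rfl, Nat.sub_zero])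
  refine ⟨_, s₁, (Exec.const i 0 s₀).seq (e₂.seq he), ?_, ha⟩
  rw [Nat.size_zero]
  have h4 : β.size ≤ B := (size_le_self _).trans (by omega)
  have h5 : β * (T + 5 * B + 8) ≤ B * (T + 5 * B + 10) := Nat.mul_le_mul hβ (by omega)
  simp only [add_mul, one_mul] at h5 ⊢
  omega

/-- Overwrite the memory cells `a, …, a + m - 1` by the values `f 0, …, f (m - 1)`. -/
def State.setBlock (s : State) (a m : ℕ) (f : ℕ → ℕ) : State :=
  { s with mem := fun x => if a ≤ x ∧ x < a + m then f (x - a) else s.mem x }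

@[simp] theorem setBlock_reg (s : State) (a m : ℕ) (f : ℕ → ℕ) :
    (s.setBlock a m f).reg = s.reg := rfl

theorem setBlock_mem (s : State) (a m : ℕ) (f : ℕ → ℕ) (x : ℕ) :
    (s.setBlock a m f).mem x = if a ≤ x ∧ x < a + m then f (x - a) else s.mem x := rfl

theorem setBlock_mem_add (s : State) (a m : ℕ) (f : ℕ → ℕ) {x : ℕ} (hx : x < m) :
    (s.setBlock a m f).mem (a + x) = f x := by
  rw [setBlock_mem, if_pos (by omega), Nat.add_sub_cancel_left]

theorem setBlock_mem_of_lt (s : State) (a m : ℕ) (f : ℕ → ℕ) {x : ℕ} (hx : x < a) :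
    (s.setBlock a m f).mem x = s.mem x := by
  rw [setBlock_mem, if_neg (by omega)]

theorem Ok.setBlock {B a m : ℕ} {f : ℕ → ℕ} {s : State} (h : Ok B s)
    (hf : ∀ x < m, (f x).size ≤ B) : Ok B (s.setBlock a m f) where
  small := h.small
  reg := h.reg
  mem x := by
    rw [setBlock_mem]; split_ifs with hx
    · exact hf _ (by omega)
    · exact h.mem x

/-- Write the values of `e`, for all values of the register `i` smaller than the value of the
register `b`, into successive memory cells from the address `a` on. -/
def tabulate (i b : ℕ) (a e : Expr) : Program :=
  forLoop i b (setCell (.add a (.reg i)) e)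

/-- When entry `m` is computed, the earlier entries are already in memory. This is why the two
expressions are to be evaluated in the partly overwritten state; the loop invariant says that the
state is exactly that one. -/
theorem Run.tabulate {i b : ℕ} {a e : Expr} (hi : i < 31) (hb : b < 31) (hib : i ≠ b)
    (ha : a.WF) (he : e.WF) {B β A : ℕ} {f : ℕ → ℕ} {s : State} (hs : Ok B s) (hβ : β ≤ B)
    (hsb : s.reg b = β) (hf : ∀ m < β, (f m).size ≤ B)
    (haA : ∀ m < β, a.eval ((s.setBlock A m f).setReg i m) = A)
    (hef : ∀ m < β, e.eval ((s.setBlock A m f).setReg i m) = f m) :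
    Run (tabulate i b a e) s ((1 + B) * ((a.cost B + (1 + B) + 1 + a.bits B + B + e.cost B + 1 +
      (a.bits B + B + 1) + e.bits B) + 5 * B + 10)) ((s.setBlock A β f).setReg i β) := by
  obtain ⟨s₂, hr, -, rfl⟩ := Run.forLoop (P := LogRAM.setCell (.add a (.reg i)) e)
    (T := (a.cost B + (1 + B) + 1 + a.bits B + B + e.cost B + 1 +
      (a.bits B + B + 1) + e.bits B)) hi hb hib hβ
    (fun m s' => s' = (s.setBlock A m f).setReg i m) hsb
    (by
      simp only [State.setReg, State.setBlock]
      congr 1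
      funext x
      rw [if_neg (by omega)]) (by
      rintro m hm s' - hs'b rfl
      have hok : Ok B ((s.setBlock A m f).setReg i m) :=
        (hs.setBlock fun x hx => hf x (by omega)).setReg_small (by omega)
      refine ⟨_, Run.setCell (a := .add a (.reg i)) ⟨ha, hi⟩ he hok, by simp, ?_, ?_⟩
      · simpa using hs'b
      · rw [hef m hm]
        simp only [Expr.eval, haA m hm, setReg_reg, if_true]
        simp only [State.setReg, State.setBlock, State.setMem, Function.update_idem]
        congr 1
        funext x
        rw [Function.update_apply]
        by_cases hx : x = A + m
        · subst hx
          rw [if_pos rfl, if_pos (by omega), Nat.add_sub_cancel_left]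
        · rw [if_neg hx]
          exact if_congr (by omega) rfl rfl)
  exact hr

end LogRAM

/-! ### Powers, remainders, comparisons and digits as expressions -/

namespace LogRAM

namespace Expr

/-- The power with a constant exponent. -/
def pow (e : Expr) : ℕ → Expr
  | 0 => const 1
  | m + 1 => mul (e.pow m) e

/-- The remainder. -/
def mod (a b : Expr) : Expr := sub a (mul (div a b) b)

/-- The indicator of `a < b`. -/
def lt (a b : Expr) : Expr := sub (const 1) (sub (const 1) (sub b a))

/-- The indicator of `a ≠ b`. -/
def ne (a b : Expr) : Expr := sub (const 1) (sub (const 1) (add (sub a b) (sub b a)))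

/-- The indicator of the first `m + 1` base `n` digits of `a` being strictly increasing. -/
def incr (a n : Expr) : ℕ → Expr
  | 0 => const 1
  | m + 1 => mul (incr a n m) (lt (mod (div a (n.pow m)) n) (mod (div a (n.pow (m + 1))) n))

@[simp] theorem eval_pow (e : Expr) (m : ℕ) (s : State) : (e.pow m).eval s = e.eval s ^ m := by
  induction m with
  | zero => rfl
  | succ m ih => simp only [pow, eval, ih, pow_succ]

@[simp] theorem eval_mod (a b : Expr) (s : State) : (mod a b).eval s = a.eval s % b.eval s :=
  (Nat.mod_eq_sub_div_mul ..).symm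

@[simp] theorem eval_lt (a b : Expr) (s : State) :
    (lt a b).eval s = if a.eval s < b.eval s then 1 else 0 := by
  simp only [lt, eval]; split_ifs <;> omega

@[simp] theorem eval_ne (a b : Expr) (s : State) :
    (ne a b).eval s = if a.eval s ≠ b.eval s then 1 else 0 := by
  simp only [ne, eval]; split_ifs <;> omega

theorem WF.pow {e : Expr} (he : e.WF) (m : ℕ) : (e.pow m).WF := by
  induction m with
  | zero => trivial
  | succ m ih => exact ⟨ih, he⟩

theorem WF.mod {a b : Expr} (ha : a.WF) (hb : b.WF) : (mod a b).WF := ⟨ha, ⟨ha, hb⟩, hb⟩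

theorem WF.lt {a b : Expr} (ha : a.WF) (hb : b.WF) : (lt a b).WF := ⟨trivial, trivial, hb, ha⟩

theorem WF.ne {a b : Expr} (ha : a.WF) (hb : b.WF) : (ne a b).WF :=
  ⟨trivial, trivial, ⟨ha, hb⟩, hb, ha⟩

theorem WF.incr {a n : Expr} (ha : a.WF) (hn : n.WF) (m : ℕ) : (incr a n m).WF := by
  induction m with
  | zero => trivial
  | succ m ih => exact ⟨ih, .lt (.mod ⟨ha, hn.pow m⟩ hn) (.mod ⟨ha, hn.pow (m + 1)⟩ hn)⟩

end Expr

end LogRAM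

/-- The base `n` digits `0, …, m` of `i` are strictly increasing. -/
def DigitsIncreasing (n m i : ℕ) : Prop := ∀ j < m, i / n ^ j % n < i / n ^ (j + 1) % n

instance (n m i : ℕ) : Decidable (DigitsIncreasing n m i) :=
  inferInstanceAs (Decidable (∀ j < m, _))

theorem LogRAM.Expr.eval_incr (a n : Expr) (m : ℕ) (s : State) :
    (incr a n m).eval s = if DigitsIncreasing (n.eval s) m (a.eval s) then 1 else 0 := by
  induction m with
  | zero => simp [incr, eval, DigitsIncreasing]
  | succ m ih =>
    have h : DigitsIncreasing (n.eval s) (m + 1) (a.eval s) ↔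
        DigitsIncreasing (n.eval s) m (a.eval s) ∧
          a.eval s / n.eval s ^ m % n.eval s < a.eval s / n.eval s ^ (m + 1) % n.eval s := by
      simp only [DigitsIncreasing, Nat.lt_succ_iff_lt_or_eq, or_imp, forall_and, forall_eq]
    simp only [incr, eval, ih, eval_lt, eval_mod, eval_pow, h]
    split_ifs <;> simp_all

/-! ### The refutation program -/

namespace Refutation

open LogRAM

/-- The index in the table of the tuple composed of `v`, `x` and `y`. -/
def tupleIndex (nc N v x y : ℕ) : ℕ := v + nc * x + nc * N * y

theorem tupleIndex_lt {nc N v x y : ℕ} (hv : v < nc) (hx : x < N) (hy : y < N) :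
    tupleIndex nc N v x y < nc * (N * N) := by
  have h1 : v + nc * x + 1 ≤ nc * N := by nlinarith
  have h2 : nc * N * (y + 1) ≤ nc * N * N := Nat.mul_le_mul_left _ hy
  unfold tupleIndex
  linarith [mul_assoc nc N N]

/-- The centred entry at `i` of the table `b`, modulo `W`. -/
def centredEntry (k n W j : ℕ) (b : ℕ → ℕ) (i : ℕ) : ℕ :=
  (if DigitsIncreasing n (k - 1) i then 1 else 0) * (n ^ k * b i + W - j)

/-- The entry in row `u` and column `w` of the matrix of pairs of linked hyperedges. -/
def linkEntry (nc N : ℕ) (a : ℕ → ℕ) (u w : ℕ) : ℕ :=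
  ∑ v ∈ Finset.range nc,
    a (tupleIndex nc N v (u / N) (w / N)) * a (tupleIndex nc N v (u % N) (w % N)) *
      if tupleIndex nc N v (u / N) (w / N) ≠ tupleIndex nc N v (u % N) (w % N) then 1 else 0

/-- The entries of the Gram matrix of the rows, modulo `W`, in one list. -/
def gramEntry (nc N W : ℕ) (a : ℕ → ℕ) (x : ℕ) : ℕ :=
  (∑ w ∈ Finset.range (N * N), linkEntry nc N a (x / (N * N)) w *
    linkEntry nc N a (x % (N * N)) w) % W

/-- The entries of the power `m + 1` of the matrix with entries `g`, modulo `W`. -/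
def powEntry (d W : ℕ) (g : ℕ → ℕ) : ℕ → ℕ → ℕ
  | 0, x => g x
  | m + 1, x => (∑ t ∈ Finset.range d, powEntry d W g m (x / d * d + t) * g (t * d + x % d)) % W

theorem powEntry_lt {d W : ℕ} (hW : 0 < W) {g : ℕ → ℕ} (hg : ∀ x, g x < W) (m x : ℕ) :
    powEntry d W g m x < W := by
  cases m with
  | zero => exact hg x
  | succ m => exact Nat.mod_lt _ hW

/-- The sum of the squares of the entries of a power of the Gram matrix, modulo `W`. -/
def traceValue (k n nc N W j : ℕ) (b : ℕ → ℕ) : ℕ :=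
  (∑ x ∈ Finset.range (N * N * (N * N)),
    powEntry (N * N) W (gramEntry nc N W (centredEntry k n W j b)) n x *
    powEntry (N * N) W (gramEntry nc N W (centredEntry k n W j b)) n x) % W

/-- The factor in the comparisons below. -/
def factor (k q : ℕ) : ℕ := 2 * (q * k) ^ (2 * k)

/-- The diagonal terms do not account for the absence of hyperedges in an independent set. -/
def DiagonalSmall (k n nc q j : ℕ) (b : ℕ → ℕ) : Prop :=
  factor k q * nc * (n ^ k * n ^ k * ∑ x ∈ Finset.range (n ^ k), b x + j * j * n ^ k) <
    j * j * (n ^ k * n ^ k)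

/-- The off-diagonal terms do not account for the absence of hyperedges in an independent set. -/
def TraceSmall (k n q j F : ℕ) : Prop :=
  ((factor k q * n ^ k) ^ 4) ^ (n + 1) * F < ((j * j * (n ^ k * n ^ k)) ^ 4) ^ (n + 1)

open Classical in
/-- The outcome of the test with the guess `j / n ^ k` for the edge probability. -/
noncomputable def certificate (k n nc N W q j : ℕ) (b : ℕ → ℕ) : ℕ :=
  if DiagonalSmall k n nc q j b ∧ TraceSmall k n q j (traceValue k n nc N W j b) then 1 else 0

/-! Registers: `0` is `n`, `1` is `q`, `2` is `n ^ k`, `3` is `nc`, `4` is `N`, `5` is `N ^ 2`,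
`6` is `n ^ k + 1`, `7` is `j`, `13` is `N ^ 4`, `14` is the address of the current power, `15`
counts the successes, `16` is the modulus, `17` and `18` are the powers to be compared, `19` is the
outcome of the first comparison, `21` is the trace; `8` to `11` are loop variables. -/

/-- The expression for `centredEntry`. -/
def centredExpr (k : ℕ) : Expr :=
  .mul (.incr (.reg 8) (.reg 0) (k - 1))
    (.sub (.add (.mul (.reg 2) (.load (.reg 8))) (.reg 16)) (.reg 7))

/-- The expression for `tupleIndex`. -/
def indexExpr (x y : Expr) : Expr :=
  .add (.add (.reg 9) (.mul (.reg 3) x)) (.mul (.mul (.reg 3) (.reg 4)) y)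

/-- The expression for `linkEntry`. -/
def linkExpr (u w : Expr) : Expr :=
  .sum 9 3 (.mul (.mul
    (.load (.add (.reg 2) (indexExpr (.div u (.reg 4)) (.div w (.reg 4)))))
    (.load (.add (.reg 2) (indexExpr (.mod u (.reg 4)) (.mod w (.reg 4))))))
    (.ne (indexExpr (.div u (.reg 4)) (.div w (.reg 4)))
      (indexExpr (.mod u (.reg 4)) (.mod w (.reg 4)))))

/-- The expression for `gramEntry`. -/
def gramExpr : Expr :=
  .mod (.sum 10 5 (.mul (linkExpr (.div (.reg 8) (.reg 5)) (.reg 10))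
    (linkExpr (.mod (.reg 8) (.reg 5)) (.reg 10)))) (.reg 16)

/-- The expression for the next power. -/
def powExpr : Expr :=
  .mod (.sum 10 5 (.mul
    (.load (.add (.reg 14) (.add (.mul (.div (.reg 8) (.reg 5)) (.reg 5)) (.reg 10))))
    (.load (.add (.add (.reg 2) (.reg 2)) (.add (.mul (.reg 10) (.reg 5))
      (.mod (.reg 8) (.reg 5))))))) (.reg 16)

/-- The expression for the trace. -/
def traceExpr : Expr :=
  .mod (.sum 10 13 (.mul (.load (.add (.reg 14) (.reg 10))) (.load (.add (.reg 14) (.reg 10)))))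
    (.reg 16)

/-- The expression for `factor`. -/
def factorExpr (k : ℕ) : Expr := .mul (.const 2) (.pow (.mul (.reg 1) (.const k)) (2 * k))

/-- The expression for the square of the guess. -/
def guessExpr : Expr := .mul (.mul (.reg 7) (.reg 7)) (.mul (.reg 2) (.reg 2))

/-- The expression for the first comparison. -/
def diagonalExpr (k : ℕ) : Expr :=
  .lt (.mul (.mul (factorExpr k) (.reg 3)) (.add (.mul (.mul (.reg 2) (.reg 2))
    (.sum 9 2 (.load (.reg 9)))) (.mul (.mul (.reg 7) (.reg 7)) (.reg 2)))) guessExpr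

/-- The program that computes a power of the Gram matrix. -/
def powProgram (k : ℕ) : Program :=
  forLoop 11 0 <| .seq (tabulate 8 13 (.add (.reg 14) (.reg 13)) powExpr) <|
    .seq (assign 14 (.add (.reg 14) (.reg 13))) <|
    .seq (assign 17 (.mul (.reg 17) (.pow guessExpr 4)))
      (assign 18 (.mul (.reg 18) (.pow (.mul (factorExpr k) (.reg 2)) 4)))

/-- The program that adds `certificate` to register `15`. -/
def certificateProgram (k : ℕ) : Program :=
  .seq (tabulate 8 2 (.reg 2) (centredExpr k)) <|
  .seq (assign 19 (diagonalExpr k)) <|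
  .seq (assign 14 (.add (.reg 2) (.reg 2))) <|
  .seq (tabulate 8 13 (.reg 14) gramExpr) <|
  .seq (assign 17 (.pow guessExpr 4)) <|
  .seq (assign 18 (.pow (.mul (factorExpr k) (.reg 2)) 4)) <|
  .seq (powProgram k) <|
  .seq (assign 21 traceExpr)
    (assign 15 (.add (.reg 15) (.mul (.reg 19) (.lt (.mul (.reg 18) (.reg 21)) (.reg 17)))))

/-- The registers and the table are set up for the parameters. -/
structure Setup (k n q nc N W : ℕ) (b : ℕ → ℕ) (s : State) : Prop where
  r0 : s.reg 0 = n
  r1 : s.reg 1 = q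
  r2 : s.reg 2 = n ^ k
  r3 : s.reg 3 = nc
  r4 : s.reg 4 = N
  r5 : s.reg 5 = N * N
  r6 : s.reg 6 = n ^ k + 1
  r13 : s.reg 13 = N * N * (N * N)
  r16 : s.reg 16 = W
  mem : ∀ x < n ^ k, s.mem x = b x

/-- All numbers that occur are bounded in terms of `B`. -/
structure Bounds (k n q nc N W B : ℕ) : Prop where
  card : n ^ k = nc * (N * N)
  pos : 0 < W
  n_le : n ≤ B
  pow_le : n ^ k + 1 ≤ B
  nc_le : nc ≤ B
  N_le : N ≤ B
  dim_le : N * N ≤ B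
  addr_le : n ^ k + n ^ k + N * N * (N * N) * (n + 1) ≤ B
  size_le : (n ^ k + W).size ≤ B
  guess_le : ∀ j ≤ n ^ k, (((j * j * (n ^ k * n ^ k)) ^ 4) ^ (n + 1)).size ≤ B
  factor_le : (((factor k q * n ^ k) ^ 4) ^ (n + 1)).size ≤ B

theorem Setup.setReg {k n q nc N W r v : ℕ} {b : ℕ → ℕ} {s : State}
    (h : Setup k n q nc N W b s) (hr : r ∉ [0, 1, 2, 3, 4, 5, 6, 13, 16]) :
    Setup k n q nc N W b (s.setReg r v) := by
  simp only [List.mem_cons, List.not_mem_nil, or_false, not_or] at hr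
  constructor <;> (try rw [setReg_reg, if_neg (by omega)])
  exacts [h.r0, h.r1, h.r2, h.r3, h.r4, h.r5, h.r6, h.r13, h.r16, h.mem]

theorem Setup.setBlock {k n q nc N W A m : ℕ} {f : ℕ → ℕ} {b : ℕ → ℕ} {s : State}
    (h : Setup k n q nc N W b s) (hA : n ^ k ≤ A) :
    Setup k n q nc N W b (s.setBlock A m f) := by
  constructor
  exacts [h.r0, h.r1, h.r2, h.r3, h.r4, h.r5, h.r6, h.r13, h.r16, fun x hx => by
    rw [setBlock_mem_of_lt _ _ _ _ (hx.trans_le hA)]; exact h.mem x hx]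

section
variable {k n q nc N W B j : ℕ} {b : ℕ → ℕ} {s : State}

theorem eval_centredExpr (h : Setup k n q nc N W b s) (h7 : s.reg 7 = j) {m : ℕ}
    (h8 : s.reg 8 = m) (hm : m < n ^ k) :
    (centredExpr k).eval s = centredEntry k n W j b m := by
  simp only [centredExpr, Expr.eval, Expr.eval_incr, h.r0, h.r2, h.r16, h7, h8, h.mem m hm,
    centredEntry]

theorem eval_linkExpr {a : ℕ → ℕ} {u w : Expr} {x y : ℕ} (h : Setup k n q nc N W b s)
    (hcard : n ^ k = nc * (N * N)) (hmem : ∀ i < n ^ k, s.mem (n ^ k + i) = a i)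
    (hu : ∀ v, u.eval (s.setReg 9 v) = x) (hw : ∀ v, w.eval (s.setReg 9 v) = y)
    (hx : x < N * N) (hy : y < N * N) :
    (linkExpr u w).eval s = linkEntry nc N a x y := by
  have hN : 0 < N := Nat.pos_of_ne_zero (by rintro rfl; simp at hx)
  simp only [linkExpr, Expr.eval, h.r3, linkEntry]
  refine Finset.sum_congr rfl fun v hv => ?_
  have hv := Finset.mem_range.1 hv
  have e1 : (indexExpr (.div u (.reg 4)) (.div w (.reg 4))).eval (s.setReg 9 v) =
      tupleIndex nc N v (x / N) (y / N) := by
    simp [indexExpr, Expr.eval, hu, hw, h.r3, h.r4, tupleIndex]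
  have e2 : (indexExpr (.mod u (.reg 4)) (.mod w (.reg 4))).eval (s.setReg 9 v) =
      tupleIndex nc N v (x % N) (y % N) := by
    simp [indexExpr, Expr.eval, hu, hw, h.r3, h.r4, tupleIndex]
  have h1 : tupleIndex nc N v (x / N) (y / N) < n ^ k := hcard ▸
    tupleIndex_lt hv (Nat.div_lt_of_lt_mul hx) (Nat.div_lt_of_lt_mul hy)
  have h2 : tupleIndex nc N v (x % N) (y % N) < n ^ k := hcard ▸
    tupleIndex_lt hv (Nat.mod_lt _ hN) (Nat.mod_lt _ hN)
  have e3 : (s.setReg 9 v).reg 2 = n ^ k := by simp [h.r2]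
  rw [Expr.eval_ne, e1, e2, e3, setReg_mem, hmem _ h1, hmem _ h2]

theorem eval_gramExpr {a : ℕ → ℕ} {m : ℕ} (h : Setup k n q nc N W b s)
    (hcard : n ^ k = nc * (N * N)) (hmem : ∀ i < n ^ k, s.mem (n ^ k + i) = a i)
    (h8 : s.reg 8 = m) (hm : m < N * N * (N * N)) :
    gramExpr.eval s = gramEntry nc N W a m := by
  have hN : 0 < N * N := Nat.pos_of_ne_zero (by intro h0; simp [h0] at hm)
  rw [gramExpr, Expr.eval_mod]
  simp only [Expr.eval, h.r16, h.r5, gramEntry]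
  congr 1
  refine Finset.sum_congr rfl fun w hw => ?_
  have hw := Finset.mem_range.1 hw
  have h' : Setup k n q nc N W b (s.setReg 10 w) := h.setReg (by simp)
  rw [eval_linkExpr h' hcard hmem (x := m / (N * N)) (y := w) (by simp [Expr.eval, h8, h.r5])
      (by simp [Expr.eval]) (Nat.div_lt_of_lt_mul hm) hw,
    eval_linkExpr h' hcard hmem (x := m % (N * N)) (y := w) (by simp [Expr.eval, h8, h.r5])
      (by simp [Expr.eval]) (Nat.mod_lt _ hN) hw]

theorem eval_powExpr {g : ℕ → ℕ} {m x A : ℕ} (h : Setup k n q nc N W b s)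
    (hmem : ∀ i < N * N * (N * N), s.mem (n ^ k + n ^ k + i) = g i) (h14 : s.reg 14 = A)
    (hmem' : ∀ i < N * N * (N * N), s.mem (A + i) = powEntry (N * N) W g m i)
    (h8 : s.reg 8 = x) (hx : x < N * N * (N * N)) :
    powExpr.eval s = powEntry (N * N) W g (m + 1) x := by
  have hN : 0 < N * N := Nat.pos_of_ne_zero (by intro h0; simp [h0] at hx)
  rw [powExpr, Expr.eval_mod]
  simp only [Expr.eval, h.r16, h.r5, powEntry]
  congr 1
  refine Finset.sum_congr rfl fun t ht => ?_
  have ht := Finset.mem_range.1 ht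
  have h1 := Nat.div_lt_of_lt_mul hx
  have h2 := Nat.mod_lt x hN
  simp only [setReg_reg, setReg_mem, Expr.eval_mod, Expr.eval, h14, h8, h.r5, h.r2]
  norm_num only [if_true, if_false]
  rw [hmem' _ (by nlinarith), hmem _ (by nlinarith)]

theorem eval_factorExpr (h : Setup k n q nc N W b s) : (factorExpr k).eval s = factor k q := by
  simp [factorExpr, Expr.eval, factor, h.r1]

theorem eval_guessExpr (h : Setup k n q nc N W b s) (h7 : s.reg 7 = j) :
    guessExpr.eval s = j * j * (n ^ k * n ^ k) := by
  simp [guessExpr, Expr.eval, h7, h.r2]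

open Classical in
theorem eval_diagonalExpr (h : Setup k n q nc N W b s) (h7 : s.reg 7 = j) :
    (diagonalExpr k).eval s = if DiagonalSmall k n nc q j b then 1 else 0 := by
  have hsum : ∑ m ∈ Finset.range (n ^ k), s.mem m = ∑ m ∈ Finset.range (n ^ k), b m :=
    Finset.sum_congr rfl fun m hm => h.mem m (Finset.mem_range.1 hm)
  rw [diagonalExpr, Expr.eval_lt]
  simp [eval_factorExpr h, eval_guessExpr h h7, Expr.eval, h.r2, h.r3, h7, hsum, DiagonalSmall]
  congr

theorem wf_indexExpr {x y : Expr} (hx : x.WF) (hy : y.WF) : (indexExpr x y).WF := by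
  simp [indexExpr, Expr.WF, hx, hy]

theorem wf_linkExpr {u w : Expr} (hu : u.WF) (hw : w.WF) : (linkExpr u w).WF := by
  have h4 : (Expr.reg 4).WF := by norm_num [Expr.WF]
  have h2 : (Expr.reg 2).WF := by norm_num [Expr.WF]
  have h1 : (indexExpr (.div u (.reg 4)) (.div w (.reg 4))).WF := wf_indexExpr ⟨hu, h4⟩ ⟨hw, h4⟩
  have h3 : (indexExpr (.mod u (.reg 4)) (.mod w (.reg 4))).WF := wf_indexExpr (hu.mod h4) (hw.mod h4)
  exact ⟨by decide, by decide, by decide, ⟨⟨⟨h2, h1⟩, h2, h3⟩, h1.ne h3⟩⟩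

theorem wf_gramExpr : gramExpr.WF := by
  have h5 : (Expr.reg 5).WF := by norm_num [Expr.WF]
  have h8 : (Expr.reg 8).WF := by norm_num [Expr.WF]
  have h10 : (Expr.reg 10).WF := by norm_num [Expr.WF]
  exact .mod ⟨by decide, by decide, by decide, wf_linkExpr ⟨h8, h5⟩ h10,
    wf_linkExpr (h8.mod h5) h10⟩ (by norm_num [Expr.WF])

theorem wf_centredExpr (k : ℕ) : (centredExpr k).WF :=
  ⟨.incr (by norm_num [Expr.WF]) (by norm_num [Expr.WF]) _, by norm_num [Expr.WF]⟩

theorem wf_powExpr : powExpr.WF := by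
  refine .mod ⟨by decide, by decide, by decide, by norm_num [Expr.WF], ?_⟩ (by norm_num [Expr.WF])
  exact ⟨by norm_num [Expr.WF], by norm_num [Expr.WF],
    .mod (by norm_num [Expr.WF]) (by norm_num [Expr.WF])⟩

theorem wf_traceExpr : traceExpr.WF := by
  have h10 : LogRAM.Small 10 := by decide
  have h13 : LogRAM.Small 13 := by decide
  norm_num [traceExpr, Expr.mod, Expr.WF, h10, h13]

theorem wf_factorExpr (k : ℕ) : (factorExpr k).WF :=
  ⟨trivial, Expr.WF.pow (e := .mul (.reg 1) (.const k)) ⟨by norm_num [Expr.WF], trivial⟩ _⟩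

theorem wf_guessExpr : guessExpr.WF := by norm_num [guessExpr, Expr.WF]

theorem wf_diagonalExpr (k : ℕ) : (diagonalExpr k).WF := by
  have h9 : LogRAM.Small 9 := by decide
  have h2 : LogRAM.Small 2 := by decide
  exact .lt ⟨⟨wf_factorExpr k, by norm_num [Expr.WF]⟩, by norm_num [Expr.WF, h9, h2]⟩ wf_guessExpr

end

end Refutation

/-! ### Correctness and running time of the test for one guess -/

namespace Refutation

open LogRAM

/-- The bound on the running time of `assign`. -/
def assignCost (e : Expr) (B : ℕ) : ℕ := e.cost B + 1 + e.bits B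

/-- The bound on the running time of `tabulate`. -/
def tabulateCost (a e : Expr) (B : ℕ) : ℕ :=
  (1 + B) * ((a.cost B + (1 + B) + 1 + a.bits B + B + e.cost B + 1 +
      (a.bits B + B + 1) + e.bits B) + 5 * B + 10)

theorem polyBounded_assignCost (e : Expr) : PolyBounded (assignCost e) :=
  (e.polyBounded_cost.add (.const 1)).add e.polyBounded_bits

theorem polyBounded_loopCost {T : ℕ → ℕ} (hT : PolyBounded T) :
    PolyBounded fun B => (1 + B) * (T B + 5 * B + 10) :=
  ((PolyBounded.const 1).add .id).mul ((hT.add ((PolyBounded.const 5).mul .id)).add (.const 10))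

theorem polyBounded_tabulateCost (a e : Expr) : PolyBounded (tabulateCost a e) := by
  refine polyBounded_loopCost (T := fun B => a.cost B + (1 + B) + 1 + a.bits B + B + e.cost B + 1 +
      (a.bits B + B + 1) + e.bits B) ?_
  exact ((((((((a.polyBounded_cost.add ((PolyBounded.const 1).add .id)).add (.const 1)).add
    a.polyBounded_bits).add .id).add e.polyBounded_cost).add (.const 1)).add
    ((a.polyBounded_bits.add .id).add (.const 1))).add e.polyBounded_bits)

/-- The bound on the running time of `powProgram`. -/
def powCost (k B : ℕ) : ℕ :=
  (1 + B) * (tabulateCost (.add (.reg 14) (.reg 13)) powExpr B +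
    (assignCost (.add (.reg 14) (.reg 13)) B +
    (assignCost (.mul (.reg 17) (.pow guessExpr 4)) B +
    assignCost (.mul (.reg 18) (.pow (.mul (factorExpr k) (.reg 2)) 4)) B)) + 5 * B + 10)

theorem polyBounded_powCost (k : ℕ) : PolyBounded (powCost k) :=
  polyBounded_loopCost ((polyBounded_tabulateCost _ _).add ((polyBounded_assignCost _).add
    ((polyBounded_assignCost _).add (polyBounded_assignCost _))))

/-- The state in the course of `powProgram`. -/
structure PowInv (k n q nc N W B j o d : ℕ) (b g : ℕ → ℕ) (m : ℕ) (s : State) : Prop where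
  setup : Setup k n q nc N W b s
  ok : Ok B s
  r7 : s.reg 7 = j
  r15 : s.reg 15 = o
  r19 : s.reg 19 = d
  r14 : s.reg 14 = n ^ k + n ^ k + N * N * (N * N) * m
  r17 : s.reg 17 = ((j * j * (n ^ k * n ^ k)) ^ 4) ^ (m + 1)
  r18 : s.reg 18 = ((factor k q * n ^ k) ^ 4) ^ (m + 1)
  gram : ∀ i < N * N * (N * N), s.mem (n ^ k + n ^ k + i) = g i
  cur : ∀ i < N * N * (N * N),
    s.mem (n ^ k + n ^ k + N * N * (N * N) * m + i) = powEntry (N * N) W g m i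

section
variable {k n q nc N W B j o d : ℕ} {b g : ℕ → ℕ} {s : State}

/-- Bounds the intermediate powers by the last one. The base is zero for the guess `j = 0`, where
exponent zero would be an exception. -/
theorem size_pow_le_of_le {a m m' B : ℕ} (h : (a ^ m').size ≤ B) (hm : m ≤ m') (hm0 : m ≠ 0) :
    (a ^ m).size ≤ B := by
  rcases Nat.eq_zero_or_pos a with rfl | ha
  · simp [zero_pow hm0]
  · exact (size_mono (Nat.pow_le_pow_right ha hm)).trans h

/-- Each power gets a fresh block of memory behind the previous ones, so the Gram matrix in the
first block stays available as right factor. The two numbers to be compared are raised to powers in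
the same loop and end with the same exponent `n + 1`. -/
theorem run_powProgram (hB : Bounds k n q nc N W B) (hj : j ≤ n ^ k) (hg : ∀ x, g x < W)
    (hs : PowInv k n q nc N W B j o d b g 0 s) :
    ∃ s', Run (powProgram k) s (powCost k B) s' ∧ PowInv k n q nc N W B j o d b g n s' := by
  have hWB : W.size ≤ B := (size_mono (Nat.le_add_left _ _)).trans hB.size_le
  refine (Run.forLoop (i := 11) (b := 0) (B := B) (β := n)
    (P := .seq (tabulate 8 13 (.add (.reg 14) (.reg 13)) powExpr) <|
    .seq (assign 14 (.add (.reg 14) (.reg 13))) <|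
    .seq (assign 17 (.mul (.reg 17) (.pow guessExpr 4)))
      (assign 18 (.mul (.reg 18) (.pow (.mul (factorExpr k) (.reg 2)) 4))))
    (T := (tabulateCost (.add (.reg 14) (.reg 13)) powExpr B +
    (assignCost (.add (.reg 14) (.reg 13)) B +
    (assignCost (.mul (.reg 17) (.pow guessExpr 4)) B +
    assignCost (.mul (.reg 18) (.pow (.mul (factorExpr k) (.reg 2)) 4)) B)))) (by norm_num)
    (by norm_num) (by norm_num) hB.n_le
    (fun m s => PowInv k n q nc N W B j o d b g m s) hs.setup.r0 (s := s) ?_ ?_).imp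
    fun s' h => ⟨h.1, h.2.2⟩
  · exact ⟨hs.setup.setReg (by simp), hs.ok.setReg_small (Nat.zero_le _), by simp [hs.r7],
      by simp [hs.r15], by simp [hs.r19], by simp [hs.r14], by simp [hs.r17], by simp [hs.r18],
      hs.gram, hs.cur⟩
  · intro m hm s h11 h0 hs
    have hdB : N * N * (N * N) ≤ B := by
      have := hB.addr_le
      have : N * N * (N * N) * 1 ≤ N * N * (N * N) * (n + 1) := Nat.mul_le_mul_left _ (by omega)
      omega
    have hAB : n ^ k + n ^ k + N * N * (N * N) * (m + 1) ≤ B := by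
      have := hB.addr_le
      have : N * N * (N * N) * (m + 1) ≤ N * N * (N * N) * (n + 1) :=
        Nat.mul_le_mul_left _ (by omega)
      omega
    set A := n ^ k + n ^ k + N * N * (N * N) * (m + 1) with hA
    have hAm : n ^ k + n ^ k + N * N * (N * N) * m + N * N * (N * N) = A := by rw [hA]; ring
    set f := powEntry (N * N) W g (m + 1) with hf
    have hfs : ∀ x, (f x).size ≤ B := fun x =>
      (size_mono (powEntry_lt hB.pos hg (m + 1) x).le).trans hWB
    have key : ∀ m', Setup k n q nc N W b (s.setBlock A m' f) := fun m' =>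
      hs.setup.setBlock (by omega)
    have hgram : ∀ m', ∀ i < N * N * (N * N),
        (s.setBlock A m' f).mem (n ^ k + n ^ k + i) = g i := fun m' i hi => by
      rw [setBlock_mem_of_lt _ _ _ _ (by omega), hs.gram i hi]
    have r1 := Run.tabulate (i := 8) (b := 13) (a := .add (.reg 14) (.reg 13)) (e := powExpr)
      (by norm_num) (by norm_num) (by norm_num) (by norm_num [Expr.WF]) wf_powExpr hs.ok hdB
      hs.setup.r13 (A := A) (f := f) (fun x _ => hfs x)
      (by intro m' _; simp [Expr.eval, hs.r14, hs.setup.r13, hAm])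
      (by
        intro m' hm'
        refine eval_powExpr ((key m').setReg (by simp)) (A := n ^ k + n ^ k + N * N * (N * N) * m)
          (hgram m') (by simp [hs.r14]) (fun i hi => ?_) (by simp) hm'
        rw [setReg_mem, setBlock_mem_of_lt _ _ _ _ (by omega), hs.cur i hi])
    set s₁ := (s.setBlock A (N * N * (N * N)) f).setReg 8 (N * N * (N * N)) with hs₁
    have hset₁ : Setup k n q nc N W b s₁ := (key _).setReg (by simp)
    have hok₁ : Ok B s₁ := (hs.ok.setBlock fun x _ => hfs x).setReg_small hdB
    have r2 := Run.assign (e := .add (.reg 14) (.reg 13)) (by norm_num [Expr.WF]) 14 hok₁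
    have v2 : Expr.eval (.add (.reg 14) (.reg 13)) s₁ = A := by
      simp [Expr.eval, hs₁, hs.r14, hs.setup.r13, hAm]
    rw [v2] at r2
    set s₂ := s₁.setReg 14 A with hs₂
    have hset₂ : Setup k n q nc N W b s₂ := hset₁.setReg (by simp)
    have hok₂ : Ok B s₂ := hok₁.setReg_small hAB
    have r3 := Run.assign (e := .mul (.reg 17) (.pow guessExpr 4))
      ⟨by norm_num [Expr.WF], wf_guessExpr.pow 4⟩ 17 hok₂
    have v3 : Expr.eval (.mul (.reg 17) (.pow guessExpr 4)) s₂ =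
        ((j * j * (n ^ k * n ^ k)) ^ 4) ^ (m + 1 + 1) := by
      rw [Expr.eval, Expr.eval_pow, eval_guessExpr hset₂ (j := j) (by simp [hs₂, hs₁, hs.r7]),
        pow_succ _ (m + 1)]
      simp [Expr.eval, hs₂, hs₁, hs.r17]
    rw [v3] at r3
    set s₃ := s₂.setReg 17 (((j * j * (n ^ k * n ^ k)) ^ 4) ^ (m + 1 + 1)) with hs₃
    have hset₃ : Setup k n q nc N W b s₃ := hset₂.setReg (by simp)
    have hok₃ : Ok B s₃ := hok₂.setReg_big (by decide)
      (size_pow_le_of_le (hB.guess_le j hj) (by omega) (by omega))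
    have r4 := Run.assign (e := .mul (.reg 18) (.pow (.mul (factorExpr k) (.reg 2)) 4))
      ⟨by norm_num [Expr.WF], Expr.WF.pow (e := .mul (factorExpr k) (.reg 2))
        ⟨wf_factorExpr k, by norm_num [Expr.WF]⟩ 4⟩ 18 hok₃
    have v4 : Expr.eval (.mul (.reg 18) (.pow (.mul (factorExpr k) (.reg 2)) 4)) s₃ =
        ((factor k q * n ^ k) ^ 4) ^ (m + 1 + 1) := by
      have h18 : s₃.reg 18 = ((factor k q * n ^ k) ^ 4) ^ (m + 1) := by
        simp [hs₃, hs₂, hs₁, hs.r18]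
      simp only [Expr.eval, Expr.eval_pow, eval_factorExpr hset₃, pow_succ _ (m + 1), hset₃.r2, h18]
    rw [v4] at r4
    have hset₄ : Setup k n q nc N W b (s₃.setReg 18 (((factor k q * n ^ k) ^ 4) ^ (m + 1 + 1))) :=
      hset₃.setReg (by simp)
    have hok₄ : Ok B (s₃.setReg 18 (((factor k q * n ^ k) ^ 4) ^ (m + 1 + 1))) :=
      hok₃.setReg_big (by decide) (size_pow_le_of_le hB.factor_le (by omega) (by omega))
    refine ⟨_, r1.seq (r2.seq (r3.seq r4)), by simp [hs₃, hs₂, hs₁, h11], by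
      simp [hs₃, hs₂, hs₁, h0], ?_⟩
    refine ⟨hset₄.setReg (by simp), hok₄.setReg_small (by have := hB.n_le; omega),
      by simp [hs₃, hs₂, hs₁, hs.r7], by simp [hs₃, hs₂, hs₁, hs.r15],
      by simp [hs₃, hs₂, hs₁, hs.r19], by simp [hs₃, hs₂, hA],
      by simp [hs₃], by simp, ?_, ?_⟩
    · intro i hi
      exact hgram _ i hi
    · intro i hi
      exact setBlock_mem_add _ _ _ _ hi

/-- The bound on the running time of `certificateProgram`. -/
def certificateCost (k B : ℕ) : ℕ :=
  tabulateCost (.reg 2) (centredExpr k) B +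
  (assignCost (diagonalExpr k) B +
  (assignCost (.add (.reg 2) (.reg 2)) B +
  (tabulateCost (.reg 14) gramExpr B +
  (assignCost (.pow guessExpr 4) B +
  (assignCost (.pow (.mul (factorExpr k) (.reg 2)) 4) B +
  (powCost k B +
  (assignCost traceExpr B +
  assignCost (.add (.reg 15) (.mul (.reg 19) (.lt (.mul (.reg 18) (.reg 21)) (.reg 17)))) B)))))))

theorem polyBounded_certificateCost (k : ℕ) : PolyBounded (certificateCost k) :=
  (polyBounded_tabulateCost _ _).add <| (polyBounded_assignCost _).add <|
  (polyBounded_assignCost _).add <| (polyBounded_tabulateCost _ _).add <|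
  (polyBounded_assignCost _).add <| (polyBounded_assignCost _).add <|
  (polyBounded_powCost k).add <| (polyBounded_assignCost _).add (polyBounded_assignCost _)

theorem centredEntry_le (hb : ∀ x, b x ≤ 1) (x : ℕ) : centredEntry k n W j b x ≤ n ^ k + W := by
  have h1 : n ^ k * b x ≤ n ^ k := by simpa using Nat.mul_le_mul_left (n ^ k) (hb x)
  unfold centredEntry
  split_ifs <;> omega

open Classical in
-- Register 15 is among those with bounded value. The hypothesis `s.reg 15 ≤ j` provides this:
-- before guess `j`, at most `j` guesses have succeeded.
theorem run_certificateProgram (hB : Bounds k n q nc N W B) (hj : j ≤ n ^ k)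
    (hb : ∀ x, b x ≤ 1) (hset : Setup k n q nc N W b s) (hok : Ok B s) (h7 : s.reg 7 = j)
    (h15 : s.reg 15 ≤ j) :
    ∃ s', Run (certificateProgram k) s (certificateCost k B) s' ∧ Setup k n q nc N W b s' ∧
      Ok B s' ∧ s'.reg 7 = j ∧
      s'.reg 15 = s.reg 15 + certificate k n nc N W q j b := by
  have hWB : W.size ≤ B := (size_mono (Nat.le_add_left _ _)).trans hB.size_le
  have hKB := hB.pow_le
  have haddr := hB.addr_le
  have hdB : N * N * (N * N) ≤ B := by
    have : N * N * (N * N) * 1 ≤ N * N * (N * N) * (n + 1) := Nat.mul_le_mul_left _ (by omega)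
    omega
  set a := centredEntry k n W j b with ha
  have has : ∀ x, (a x).size ≤ B := fun x => (size_mono (centredEntry_le hb x)).trans hB.size_le
  set g := gramEntry nc N W a with hg
  have hgW : ∀ x, g x < W := fun x => Nat.mod_lt _ hB.pos
  have hgs : ∀ x, (g x).size ≤ B := fun x => (size_mono (hgW x).le).trans hWB
  have r1 := Run.tabulate (i := 8) (b := 2) (a := .reg 2) (e := centredExpr k)
    (by norm_num) (by norm_num) (by norm_num) (by norm_num [Expr.WF]) (wf_centredExpr k) hok
    (β := n ^ k) (A := n ^ k) (f := a) (by omega) hset.r2 (fun x _ => has x)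
    (by intro m _; simp [Expr.eval, hset.r2])
    (fun m hm => eval_centredExpr ((hset.setBlock le_rfl).setReg (by simp)) (by simp [h7])
      (by simp) hm)
  set s₁ := (s.setBlock (n ^ k) (n ^ k) a).setReg 8 (n ^ k) with hs₁
  have hset₁ : Setup k n q nc N W b s₁ := (hset.setBlock le_rfl).setReg (by simp)
  have hok₁ : Ok B s₁ := (hok.setBlock fun x _ => has x).setReg_small (by omega)
  have hmem₁ : ∀ i < n ^ k, s₁.mem (n ^ k + i) = a i := fun i hi => setBlock_mem_add _ _ _ _ hi
  set δ := if DiagonalSmall k n nc q j b then 1 else 0 with hδ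
  have r2 := Run.assign (wf_diagonalExpr k) 19 hok₁
  rw [eval_diagonalExpr hset₁ (j := j) (by simp [hs₁, h7]), ← hδ] at r2
  set s₂ := s₁.setReg 19 δ with hs₂
  have hδ1 : δ ≤ 1 := by rw [hδ]; split_ifs <;> omega
  have hset₂ : Setup k n q nc N W b s₂ := hset₁.setReg (by simp)
  have hok₂ : Ok B s₂ := hok₁.setReg_small (by omega)
  have r3 := Run.assign (e := .add (.reg 2) (.reg 2)) (by norm_num [Expr.WF]) 14 hok₂
  have v3 : Expr.eval (.add (.reg 2) (.reg 2)) s₂ = n ^ k + n ^ k := by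
    simp [Expr.eval, hset₂.r2]
  rw [v3] at r3
  set s₃ := s₂.setReg 14 (n ^ k + n ^ k) with hs₃
  have hset₃ : Setup k n q nc N W b s₃ := hset₂.setReg (by simp)
  have hok₃ : Ok B s₃ := hok₂.setReg_small (by omega)
  have r4 := Run.tabulate (i := 8) (b := 13) (a := .reg 14) (e := gramExpr)
    (by norm_num) (by norm_num) (by norm_num) (by norm_num [Expr.WF]) wf_gramExpr hok₃
    (A := n ^ k + n ^ k) (f := g) hdB hset₃.r13 (fun x _ => hgs x)
    (by intro m _; simp [Expr.eval, hs₃])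
    (fun m hm => eval_gramExpr ((hset₃.setBlock (by omega)).setReg (by simp)) hB.card
      (fun i hi => by
        rw [setReg_mem, setBlock_mem_of_lt _ _ _ _ (by omega)]; exact hmem₁ i hi) (by simp) hm)
  set s₄ := (s₃.setBlock (n ^ k + n ^ k) (N * N * (N * N)) g).setReg 8 (N * N * (N * N)) with hs₄
  have hset₄ : Setup k n q nc N W b s₄ := (hset₃.setBlock (by omega)).setReg (by simp)
  have hok₄ : Ok B s₄ := (hok₃.setBlock fun x _ => hgs x).setReg_small hdB
  have hmem₄ : ∀ i < N * N * (N * N), s₄.mem (n ^ k + n ^ k + i) = g i :=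
    fun i hi => setBlock_mem_add _ _ _ _ hi
  have r5 := Run.assign (wf_guessExpr.pow 4) 17 hok₄
  have v5 : Expr.eval (guessExpr.pow 4) s₄ = (j * j * (n ^ k * n ^ k)) ^ 4 := by
    rw [Expr.eval_pow, eval_guessExpr hset₄ (j := j) (by simp [hs₄, hs₃, hs₂, hs₁, h7])]
  rw [v5] at r5
  set s₅ := s₄.setReg 17 ((j * j * (n ^ k * n ^ k)) ^ 4) with hs₅
  have hset₅ : Setup k n q nc N W b s₅ := hset₄.setReg (by simp)
  have hok₅ : Ok B s₅ := hok₄.setReg_big (by decide) (by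
    simpa using size_pow_le_of_le (m := 1) (hB.guess_le j hj) (by omega) (by omega))
  have r6 := Run.assign (Expr.WF.pow (e := .mul (factorExpr k) (.reg 2))
        ⟨wf_factorExpr k, by norm_num [Expr.WF]⟩ 4) 18 hok₅
  have v6 : Expr.eval (.pow (.mul (factorExpr k) (.reg 2)) 4) s₅ =
      (factor k q * n ^ k) ^ 4 := by
    rw [Expr.eval_pow, Expr.eval, eval_factorExpr hset₅, Expr.eval, hset₅.r2]
  rw [v6] at r6
  set s₆ := s₅.setReg 18 ((factor k q * n ^ k) ^ 4) with hs₆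
  have hset₆ : Setup k n q nc N W b s₆ := hset₅.setReg (by simp)
  have hok₆ : Ok B s₆ := hok₅.setReg_big (by decide) (by
    simpa using size_pow_le_of_le (m := 1) hB.factor_le (by omega) (by omega))
  obtain ⟨s₇, r7, hI⟩ := run_powProgram (g := g) (o := s.reg 15) (d := δ) hB hj hgW
    (s := s₆) (b := b) ⟨hset₆, hok₆, by simp [hs₆, hs₅, hs₄, hs₃, hs₂, hs₁, h7],
      by simp [hs₆, hs₅, hs₄, hs₃, hs₂, hs₁], by simp [hs₆, hs₅, hs₄, hs₃, hs₂],
      by simp [hs₆, hs₅, hs₄, hs₃], by simp [hs₆, hs₅], by simp [hs₆], hmem₄, hmem₄⟩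
  have r8 := Run.assign wf_traceExpr 21 hI.ok
  have v8 : traceExpr.eval s₇ = traceValue k n nc N W j b := by
    rw [traceExpr, Expr.eval_mod]
    simp only [Expr.eval, hI.setup.r16, hI.setup.r13, traceValue]
    congr 1
    refine Finset.sum_congr rfl fun x hx => ?_
    simp only [setReg_reg, setReg_mem, if_true]
    norm_num only [if_false]
    rw [hI.r14, hI.cur x (Finset.mem_range.1 hx)]
  rw [v8] at r8
  set F := traceValue k n nc N W j b with hF
  have hFB : F.size ≤ B := (size_mono (Nat.mod_lt _ hB.pos).le).trans hWB
  have hset₈ : Setup k n q nc N W b (s₇.setReg 21 F) := hI.setup.setReg (by simp)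
  have hok₈ : Ok B (s₇.setReg 21 F) := hI.ok.setReg_big (by decide) hFB
  have r9 := Run.assign (e := .add (.reg 15) (.mul (.reg 19) (.lt (.mul (.reg 18) (.reg 21))
    (.reg 17)))) (by norm_num [Expr.WF, Expr.lt]) 15 hok₈
  have v9 : Expr.eval (.add (.reg 15) (.mul (.reg 19) (.lt (.mul (.reg 18) (.reg 21))
      (.reg 17)))) (s₇.setReg 21 F) = s.reg 15 + certificate k n nc N W q j b := by
    simp only [Expr.eval, Expr.eval_lt, setReg_reg]
    norm_num only [if_false, if_true]
    rw [hI.r15, hI.r17, hI.r18, hI.r19]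
    congr 1
    rw [hδ, certificate, ite_and]
    simp only [TraceSmall, ← hF]
    split_ifs <;> simp_all
  rw [v9] at r9
  have hc1 : certificate k n nc N W q j b ≤ 1 := by unfold certificate; split_ifs <;> omega
  exact ⟨_, r1.seq <| r2.seq <| r3.seq <| r4.seq <| r5.seq <| r6.seq <| r7.seq <| r8.seq r9,
    hset₈.setReg (by simp), hok₈.setReg_small (by omega), by simp [hI.r7], by simp⟩

end

end Refutation

/-! ### The search over all guesses and the complete program -/

namespace LogRAM

theorem Run.cond_pos {a B T : ℕ} {P Q : Program} {s s' : State} (ha : a < 31) (h0 : s.reg a ≠ 0)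
    (hs : Ok B s) (h : Run P s T s') : Run (.cond a P Q) s (1 + B + T) s' := by
  intro s₀ h₀
  obtain ⟨t, s₁, he, ht, hag⟩ := h s₀ h₀
  have := (hs.agree h₀).reg a ha
  exact ⟨_, s₁, .cond_pos (by rwa [h₀.1 a ha]) he, by omega, hag⟩

theorem Run.cond_zero {a B T : ℕ} {P Q : Program} {s s' : State} (ha : a < 31) (h0 : s.reg a = 0)
    (hs : Ok B s) (h : Run Q s T s') : Run (.cond a P Q) s (1 + B + T) s' := by
  intro s₀ h₀
  obtain ⟨t, s₁, he, ht, hag⟩ := h s₀ h₀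
  have := (hs.agree h₀).reg a ha
  exact ⟨_, s₁, .cond_zero (by rwa [h₀.1 a ha]) he, by omega, hag⟩

theorem size_pow_le (n m : ℕ) : (n ^ m).size ≤ m * n + 1 := by
  rw [Nat.size_le, pow_succ]
  have h : n ^ m ≤ 2 ^ (m * n) := by
    rw [mul_comm, pow_mul]
    exact Nat.pow_le_pow_left Nat.lt_two_pow_self.le m
  have := Nat.pos_of_ne_zero (pow_ne_zero (m * n) (two_ne_zero (α := ℕ)))
  omega

end LogRAM

namespace Refutation

open LogRAM

/-- The modulus of the computation. -/
def modulus (k n : ℕ) : ℕ := (n ^ (12 * k + 1)) ^ (n + 1)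

/-- The number of successful guesses. -/
noncomputable def successes (k c l n q : ℕ) (b : ℕ → ℕ) : ℕ :=
  ∑ j ∈ Finset.range (n ^ k + 1), certificate k n (n ^ c) (n ^ l) (modulus k n) q j b

/-- The program that computes the number of successful guesses. -/
def searchProgram (k c l : ℕ) : Program :=
  .seq (assign 2 (.pow (.reg 0) k)) <|
  .seq (assign 3 (.pow (.reg 0) c)) <|
  .seq (assign 4 (.pow (.reg 0) l)) <|
  .seq (assign 5 (.mul (.reg 4) (.reg 4))) <|
  .seq (assign 6 (.add (.reg 2) (.const 1))) <|
  .seq (assign 13 (.mul (.reg 5) (.reg 5))) <|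
  .seq (assign 16 (.pow (.reg 0) (12 * k + 1))) <|
  .seq (forLoop 11 0 (assign 16 (.mul (.reg 16) (.pow (.reg 0) (12 * k + 1))))) <|
  .seq (forLoop 7 6 (certificateProgram k))
    (assign 0 (.reg 15))

/-- The bound on the running time of `searchProgram`. -/
def searchCost (k c l B : ℕ) : ℕ :=
  assignCost (.pow (.reg 0) k) B +
  (assignCost (.pow (.reg 0) c) B +
  (assignCost (.pow (.reg 0) l) B +
  (assignCost (.mul (.reg 4) (.reg 4)) B +
  (assignCost (.add (.reg 2) (.const 1)) B +
  (assignCost (.mul (.reg 5) (.reg 5)) B +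
  (assignCost (.pow (.reg 0) (12 * k + 1)) B +
  ((1 + B) * (assignCost (.mul (.reg 16) (.pow (.reg 0) (12 * k + 1))) B + 5 * B + 10) +
  ((1 + B) * (certificateCost k B + 5 * B + 10) +
  assignCost (.reg 15) B))))))))

theorem polyBounded_searchCost (k c l : ℕ) : PolyBounded (searchCost k c l) :=
  (polyBounded_assignCost _).add <| (polyBounded_assignCost _).add <|
  (polyBounded_assignCost _).add <| (polyBounded_assignCost _).add <|
  (polyBounded_assignCost _).add <| (polyBounded_assignCost _).add <|
  (polyBounded_assignCost _).add <| (polyBounded_loopCost (polyBounded_assignCost _)).add <|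
  (polyBounded_loopCost (polyBounded_certificateCost k)).add (polyBounded_assignCost _)

theorem run_searchProgram {k c l n q B : ℕ} {b : ℕ → ℕ} {s : State}
    (hB : Bounds k n q (n ^ c) (n ^ l) (modulus k n) B) (hb : ∀ x, b x ≤ 1) (hok : Ok B s)
    (h0 : s.reg 0 = n) (h1 : s.reg 1 = q) (h15 : s.reg 15 = 0) (hmem : s.mem = b) :
    ∃ s', Run (searchProgram k c l) s (searchCost k c l B) s' ∧
      s'.reg 0 = successes k c l n q b := by
  have hWB : (modulus k n).size ≤ B := (size_mono (Nat.le_add_left _ _)).trans hB.size_le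
  have hKB := hB.pow_le
  have haddr := hB.addr_le
  have hdB : n ^ l * n ^ l * (n ^ l * n ^ l) ≤ B := by
    have : n ^ l * n ^ l * (n ^ l * n ^ l) * 1 ≤ n ^ l * n ^ l * (n ^ l * n ^ l) * (n + 1) :=
      Nat.mul_le_mul_left _ (by omega)
    omega
  have wf0 : ∀ m, (Expr.pow (.reg 0) m).WF := fun m => Expr.WF.pow (by norm_num [Expr.WF]) m
  have r1 := Run.assign (wf0 k) 2 hok
  rw [Expr.eval_pow, Expr.eval, h0] at r1
  set s₁ := s.setReg 2 (n ^ k) with hs₁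
  have hok₁ : Ok B s₁ := hok.setReg_small (by omega)
  have r2 := Run.assign (wf0 c) 3 hok₁
  rw [Expr.eval_pow, Expr.eval, show s₁.reg 0 = n by simp [hs₁, h0]] at r2
  set s₂ := s₁.setReg 3 (n ^ c) with hs₂
  have hok₂ : Ok B s₂ := hok₁.setReg_small hB.nc_le
  have r3 := Run.assign (wf0 l) 4 hok₂
  rw [Expr.eval_pow, Expr.eval, show s₂.reg 0 = n by simp [hs₂, hs₁, h0]] at r3
  set s₃ := s₂.setReg 4 (n ^ l) with hs₃
  have hok₃ : Ok B s₃ := hok₂.setReg_small hB.N_le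
  have r4 := Run.assign (e := .mul (.reg 4) (.reg 4)) (by norm_num [Expr.WF]) 5 hok₃
  rw [show Expr.eval (.mul (.reg 4) (.reg 4)) s₃ = n ^ l * n ^ l by simp [Expr.eval, hs₃]] at r4
  set s₄ := s₃.setReg 5 (n ^ l * n ^ l) with hs₄
  have hok₄ : Ok B s₄ := hok₃.setReg_small hB.dim_le
  have r5 := Run.assign (e := .add (.reg 2) (.const 1)) (by norm_num [Expr.WF]) 6 hok₄
  rw [show Expr.eval (.add (.reg 2) (.const 1)) s₄ = n ^ k + 1 by
    simp [Expr.eval, hs₄, hs₃, hs₂, hs₁]] at r5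
  set s₅ := s₄.setReg 6 (n ^ k + 1) with hs₅
  have hok₅ : Ok B s₅ := hok₄.setReg_small hB.pow_le
  have r6 := Run.assign (e := .mul (.reg 5) (.reg 5)) (by norm_num [Expr.WF]) 13 hok₅
  rw [show Expr.eval (.mul (.reg 5) (.reg 5)) s₅ = n ^ l * n ^ l * (n ^ l * n ^ l) by
    simp [Expr.eval, hs₅, hs₄]] at r6
  set s₆ := s₅.setReg 13 (n ^ l * n ^ l * (n ^ l * n ^ l)) with hs₆
  have hok₆ : Ok B s₆ := hok₅.setReg_small hdB
  have r7 := Run.assign (wf0 (12 * k + 1)) 16 hok₆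
  rw [Expr.eval_pow, Expr.eval, show s₆.reg 0 = n by
    simp [hs₆, hs₅, hs₄, hs₃, hs₂, hs₁, h0]] at r7
  set s₇ := s₆.setReg 16 (n ^ (12 * k + 1)) with hs₇
  have hWs : ∀ m ≤ n, ((n ^ (12 * k + 1)) ^ (m + 1)).size ≤ B := fun m hm =>
    size_pow_le_of_le hWB (by omega) (by omega)
  have hok₇ : Ok B s₇ := hok₆.setReg_big (by decide) (by simpa using hWs 0 (by omega))
  obtain ⟨s₈, r8, -, hI⟩ := Run.forLoop (i := 11) (b := 0) (B := B) (β := n)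
    (P := assign 16 (.mul (.reg 16) (.pow (.reg 0) (12 * k + 1))))
    (T := assignCost (.mul (.reg 16) (.pow (.reg 0) (12 * k + 1))) B) (by norm_num)
    (by norm_num) (by norm_num) hB.n_le
    (fun m s => ∃ v, s = (s₇.setReg 16 ((n ^ (12 * k + 1)) ^ (m + 1))).setReg 11 v ∧ v ≤ B)
    (s := s₇) (by simp [hs₇, hs₆, hs₅, hs₄, hs₃, hs₂, hs₁, h0])
    ⟨0, by simp [hs₇, State.setReg], by omega⟩ (by
      rintro m hm s' h11 h0' ⟨v, rfl, hv⟩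
      have hok' : Ok B ((s₇.setReg 16 ((n ^ (12 * k + 1)) ^ (m + 1))).setReg 11 v) :=
        (hok₇.setReg_big (by decide) (hWs m hm.le)).setReg_small hv
      refine ⟨_, Run.assign (e := .mul (.reg 16) (.pow (.reg 0) (12 * k + 1)))
        ⟨by norm_num [Expr.WF], wf0 _⟩ 16 hok', by simpa using h11, by simpa using h0', m + 1, ?_,
        by have := hB.n_le; omega⟩
      rw [Expr.eval, Expr.eval_pow]
      simp only [Expr.eval, h0']
      simp only [State.setReg]
      congr 1
      funext r
      simp only [Function.update_apply, pow_succ _ (m + 1)]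
      split_ifs <;> simp_all)
  obtain ⟨v, hs₈, hv⟩ := hI
  have hW : (n ^ (12 * k + 1)) ^ (n + 1) = modulus k n := rfl
  rw [hW] at hs₈
  have hset₈ : Setup k n q (n ^ c) (n ^ l) (modulus k n) b s₈ := by
    constructor <;> simp [hs₈, hs₇, hs₆, hs₅, hs₄, hs₃, hs₂, hs₁, h0, h1, hmem]
  have hok₈ : Ok B s₈ := by
    rw [hs₈]; exact (hok₇.setReg_big (by decide) hWB).setReg_small hv
  have h15₈ : s₈.reg 15 = 0 := by simp [hs₈, hs₇, hs₆, hs₅, hs₄, hs₃, hs₂, hs₁, h15]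
  have hcert : ∀ j, certificate k n (n ^ c) (n ^ l) (modulus k n) q j b ≤ 1 := fun j => by
    unfold certificate; split_ifs <;> omega
  have hsucc : ∀ m, ∑ j ∈ Finset.range m,
      certificate k n (n ^ c) (n ^ l) (modulus k n) q j b ≤ m := fun m => by
    simpa using Finset.sum_le_card_nsmul (Finset.range m) _ 1 fun j _ => hcert j
  obtain ⟨s₉, r9, -, hset₉, hok₉, h15₉⟩ := Run.forLoop (i := 7) (b := 6) (B := B) (β := n ^ k + 1)
    (P := certificateProgram k) (T := certificateCost k B) (by norm_num) (by norm_num)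
    (by norm_num) hB.pow_le
    (fun m s => Setup k n q (n ^ c) (n ^ l) (modulus k n) b s ∧ Ok B s ∧ s.reg 15 =
      ∑ j ∈ Finset.range m, certificate k n (n ^ c) (n ^ l) (modulus k n) q j b)
    (s := s₈) hset₈.r6 ⟨hset₈.setReg (by simp), hok₈.setReg_small (by omega), by simp [h15₈]⟩ (by
      rintro m hm s' h7 h6 ⟨hset, hok, h15⟩
      obtain ⟨s₂, hr, hset', hok', h7', h15'⟩ := run_certificateProgram hB (by omega : m ≤ n ^ k)
        hb hset hok h7 (h15 ▸ hsucc m)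
      refine ⟨s₂, hr, h7', hset'.r6, hset'.setReg (by simp), hok'.setReg_small (by omega), ?_⟩
      rw [setReg_reg, if_neg (by norm_num), h15', h15, Finset.sum_range_succ])
  have r10 := Run.assign (e := .reg 15) (by norm_num [Expr.WF]) 0 hok₉
  refine ⟨_, r1.seq <| r2.seq <| r3.seq <| r4.seq <| r5.seq <| r6.seq <| r7.seq <| r8.seq <|
    r9.seq r10, ?_⟩
  rw [setReg_reg, if_pos rfl, Expr.eval, h15₉, successes]

/-- The test of the algorithm. -/
def Accepts (k c l n q : ℕ) (b : ℕ → ℕ) : Prop :=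
  (q = 0 ∧ n ≠ 0) ∨ (q ≠ 0 ∧ q * k ≤ n ∧ successes k c l n q b ≠ 0)

/-- The program of the algorithm. -/
def mainProgram (k c l : ℕ) : Program :=
  .cond 1 (.seq (assign 22 (.sub (.add (.reg 0) (.const 1)) (.mul (.reg 1) (.const k))))
    (.cond 22 (searchProgram k c l) (assign 0 (.const 0)))) (assign 22 (.const 0))

/-- The bound on the running time of `mainProgram`. -/
def mainCost (k c l B : ℕ) : ℕ :=
  1 + B + (assignCost (.sub (.add (.reg 0) (.const 1)) (.mul (.reg 1) (.const k))) B +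
    (1 + (B + k + B + 2) + (searchCost k c l B + assignCost (.const 0) B)))

theorem polyBounded_mainCost (k c l : ℕ) : PolyBounded (mainCost k c l) :=
  ((PolyBounded.const 1).add .id).add <| (polyBounded_assignCost _).add <|
    ((PolyBounded.const 1).add (((PolyBounded.id.add (.const k)).add .id).add (.const 2))).add <|
      (polyBounded_searchCost k c l).add (polyBounded_assignCost _)

theorem run_mainProgram {k c l n q B : ℕ} {b : ℕ → ℕ} {s : State}
    (hB : q ≠ 0 → q * k ≤ n → Bounds k n q (n ^ c) (n ^ l) (modulus k n) B)
    (hb : ∀ x, b x ≤ 1) (hok : Ok B s) (hnB : (n + 1).size ≤ B)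
    (h0 : s.reg 0 = n) (h1 : s.reg 1 = q) (h15 : s.reg 15 = 0) (hmem : s.mem = b) :
    ∃ s', Run (mainProgram k c l) s (mainCost k c l B) s' ∧
      (s'.reg 0 ≠ 0 ↔ Accepts k c l n q b) := by
  rcases eq_or_ne q 0 with rfl | hq
  -- For `q = 0` the branch only writes to an irrelevant register. Register 0 still holds `n`, which
  -- is nonzero exactly when the answer has to be positive.
  · refine ⟨s.setReg 22 0, fun s₀ hs₀ => ?_, ?_⟩
    · obtain ⟨t, s₁, he, ht, ha⟩ := Run.cond_zero (a := 1) (by norm_num) h1 hok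
        (Run.assign (e := .const 0) trivial 22 hok) s₀ hs₀
      refine ⟨t, s₁, he, ht.trans ?_, ha⟩
      rw [mainCost]
      simp only [assignCost]
      omega
    · rw [setReg_reg, if_neg (by norm_num), h0]
      simp [Accepts]
  · have r1 := Run.assign (e := .sub (.add (.reg 0) (.const 1)) (.mul (.reg 1) (.const k)))
      (by norm_num [Expr.WF]) 22 hok
    have v1 : Expr.eval (.sub (.add (.reg 0) (.const 1)) (.mul (.reg 1) (.const k))) s =
        n + 1 - q * k := by simp [Expr.eval, h0, h1]
    rw [v1] at r1
    set s₁ := s.setReg 22 (n + 1 - q * k) with hs₁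
    have hok₁ : Ok B s₁ := hok.setReg_big (by decide) ((size_mono (Nat.sub_le _ _)).trans hnB)
    -- With truncated subtraction, `n + 1 - q * k` is nonzero exactly in the first case.
    by_cases hqn : q * k ≤ n
    · obtain ⟨s₂, r2, h2⟩ := run_searchProgram (k := k) (c := c) (l := l) (q := q) (b := b)
        (hB hq hqn) hb hok₁ (by simp [hs₁, h0]) (by simp [hs₁, h1]) (by simp [hs₁, h15])
        (by simp [hs₁, hmem])
      refine ⟨s₂, fun s₀ hs₀ => ?_, by simp [h2, Accepts, hq, hqn]⟩
      obtain ⟨t, s₃, he, ht, ha⟩ := Run.cond_pos (a := 1) (by norm_num) (by rwa [h1]) hok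
        (r1.seq (Run.cond_pos (a := 22) (by norm_num) (by simp [hs₁]; omega) hok₁ r2)) s₀ hs₀
      refine ⟨t, s₃, he, ht.trans ?_, ha⟩
      rw [mainCost]
      simp only [assignCost]
      omega
    · refine ⟨s₁.setReg 0 0, fun s₀ hs₀ => ?_, ?_⟩
      · obtain ⟨t, s₃, he, ht, ha⟩ := Run.cond_pos (a := 1) (by norm_num) (by rwa [h1]) hok
          (r1.seq (Run.cond_zero (a := 22) (by norm_num) (by simp [hs₁]; omega) hok₁
            (Run.assign (e := .const 0) trivial 0 hok₁))) s₀ hs₀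
        refine ⟨t, s₃, he, ht.trans ?_, ha⟩
        rw [mainCost]
        simp only [assignCost]
        omega
      · rw [setReg_reg, if_pos rfl]
        simp [Accepts, hq, hqn]

/-- A polynomial bound on all numbers that occur. -/
noncomputable def boundPolynomial (k c l : ℕ) : Polynomial ℕ :=
  .X + .X ^ k + .X ^ k + .X ^ c + .X ^ l + .X ^ l * .X ^ l +
    .X ^ l * .X ^ l * (.X ^ l * .X ^ l) * (.X + 1) + .C (40 * k + 40) * (.X + 1) * (.X + 1)

theorem eval_boundPolynomial (k c l M : ℕ) : (boundPolynomial k c l).eval M =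
    M + M ^ k + M ^ k + M ^ c + M ^ l + M ^ l * M ^ l +
    M ^ l * M ^ l * (M ^ l * M ^ l) * (M + 1) + (40 * k + 40) * (M + 1) * (M + 1) := by
  simp [boundPolynomial]

/-- The value of `q` may be exponential in the length of the input. The condition `q * k ≤ n` makes
`factor k q` at most `n ^ (2 * k + 1)`, so all numbers to be compared are powers of `n` with
exponent linear in `n`, and have polynomially many bits. -/
theorem bounds {k c l n q M : ℕ} (hk : 2 ≤ k) (hkc : k = c + 2 * l) (hq : q ≠ 0) (hqn : q * k ≤ n)
    (hM : n ≤ M) :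
    Bounds k n q (n ^ c) (n ^ l) (modulus k n) ((boundPolynomial k c l).eval M) := by
  have hn : 2 ≤ n := by
    have : 1 * 2 ≤ q * k := Nat.mul_le_mul (by omega) hk
    omega
  have hp : ∀ m, n ^ m ≤ M ^ m := fun m => Nat.pow_le_pow_left hM m
  have hk1 := hp k
  have hc1 := hp c
  have hl1 := hp l
  have hll : n ^ l * n ^ l ≤ M ^ l * M ^ l := Nat.mul_le_mul hl1 hl1
  have h4 : n ^ l * n ^ l * (n ^ l * n ^ l) * (n + 1) ≤
      M ^ l * M ^ l * (M ^ l * M ^ l) * (M + 1) :=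
    Nat.mul_le_mul (Nat.mul_le_mul hll hll) (by omega)
  have hL : (40 * k + 40) * (n + 1) * (n + 1) ≤ (40 * k + 40) * (M + 1) * (M + 1) :=
    Nat.mul_le_mul (Nat.mul_le_mul_left _ (by omega)) (by omega)
  have hL' : 40 ≤ (40 * k + 40) * (n + 1) * (n + 1) := by
    have : (40 * k + 40) * 1 * 1 ≤ (40 * k + 40) * (n + 1) * (n + 1) :=
      Nat.mul_le_mul (Nat.mul_le_mul_left _ (by omega)) (by omega)
    omega
  have hsize : ∀ a m, a ≤ n ^ m → ∀ e, ((a ^ e) ^ (n + 1)).size ≤ m * e * (n + 1) * n + 1 := by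
    intro a m ha e
    refine (size_mono (Nat.pow_le_pow_left (Nat.pow_le_pow_left ha e) (n + 1))).trans ?_
    rw [← pow_mul, ← pow_mul]
    exact (size_pow_le _ _).trans (le_of_eq (by ring))
  rw [eval_boundPolynomial]
  refine ⟨by rw [← pow_add, ← pow_add]; congr 1; omega, ?_, by omega, by omega, by omega, by omega,
    by omega, by omega, ?_, ?_, ?_⟩
  · unfold modulus; positivity
  · have h1 := size_add_le (n ^ k) (modulus k n)
    have h2 := size_pow_le n k
    have h3 := size_pow_le n ((12 * k + 1) * (n + 1))
    rw [pow_mul, ← modulus] at h3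
    have h5 : (12 * k + 1) * (n + 1) * n + k * n + 3 ≤ (40 * k + 40) * (n + 1) * (n + 1) := by
      nlinarith
    omega
  · intro j hj
    have h1 : j * j * (n ^ k * n ^ k) ≤ n ^ (4 * k) := by
      calc j * j * (n ^ k * n ^ k) ≤ n ^ k * n ^ k * (n ^ k * n ^ k) :=
            Nat.mul_le_mul_right _ (Nat.mul_le_mul hj hj)
        _ = n ^ (4 * k) := by ring
    have h2 := hsize _ _ h1 4
    have h5 : 4 * k * 4 * (n + 1) * n + 1 ≤ (40 * k + 40) * (n + 1) * (n + 1) := by nlinarith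
    omega
  · have h1 : factor k q * n ^ k ≤ n ^ (3 * k + 1) := by
      calc factor k q * n ^ k ≤ n * n ^ (2 * k) * n ^ k :=
            Nat.mul_le_mul_right _ (Nat.mul_le_mul hn (Nat.pow_le_pow_left hqn _))
        _ = n ^ (3 * k + 1) := by ring
    have h2 := hsize _ _ h1 4
    have h5 : (3 * k + 1) * 4 * (n + 1) * n + 1 ≤ (40 * k + 40) * (n + 1) * (n + 1) := by nlinarith
    omega

theorem input_mem_le {n k : ℕ} (H : UniformHypergraph n k) (ξ x : ℕ) : (H.input ξ).mem x ≤ 1 := by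
  classical
  simp only [UniformHypergraph.input]
  split_ifs <;> omega

theorem computable_of_accepts {k c l : ℕ} (hk : 2 ≤ k) (hkc : k = c + 2 * l)
    {A : (n : ℕ) → UniformHypergraph n k → ℕ → Bool}
    (hA : ∀ n H ξ, A n H ξ = true ↔ Accepts k c l n ξ (H.input ξ).mem) :
    ComputableInPolyTime A := by
  obtain ⟨T, hT⟩ := polyBounded_mainCost k c l
  refine ⟨mainProgram k c l, T.comp (boundPolynomial k c l), fun n H ξ => ?_⟩
  have hPB := eval_boundPolynomial k c l (n + ξ.size)
  set B := (boundPolynomial k c l).eval (n + ξ.size) with hB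
  have hBn : n + ξ.size + 40 ≤ B := by
    have : (40 * k + 40) * 1 * 1 ≤ (40 * k + 40) * (n + ξ.size + 1) * (n + ξ.size + 1) :=
      Nat.mul_le_mul (Nat.mul_le_mul_left _ (by omega)) (by omega)
    omega
  have hreg : ∀ r, (H.input ξ).reg r = if r = 0 then n else if r = 1 then ξ else 0 := fun _ => rfl
  have hok : Ok B (H.input ξ) := by
    refine ⟨fun r hr => ?_, fun r _ => ?_, fun a => ?_⟩
    -- Register 1 is exempt from the bound on values because it holds `ξ`, of which only the number
    -- of bits is bounded.
    · rw [hreg, if_neg hr.2]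
      split_ifs <;> omega
    · rw [hreg]
      have := size_le_self n
      split_ifs
      · omega
      · omega
      · simp
    · have := size_mono (input_mem_le H ξ a)
      rw [Nat.size_one] at this
      omega
  obtain ⟨s', hr, hs'⟩ := run_mainProgram (k := k) (c := c) (l := l) (n := n) (q := ξ) (B := B)
    (b := (H.input ξ).mem)
    (fun hq hqn => bounds hk hkc hq hqn (Nat.le_add_right _ _)) (input_mem_le H ξ) hok
    ((size_le_self _).trans (by omega)) (by simp [hreg]) (by simp [hreg]) (by simp [hreg]) rfl
  obtain ⟨t, s, he, ht, ha⟩ := hr _ (Agree.refl 31 _)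
  refine ⟨t, s, he, ?_, ?_⟩
  · rw [Polynomial.eval_comp]
    exact ht.trans (hT B)
  · rw [ha.1 0 (by norm_num), hs', hA]

end Refutation

/-! ### Operator norm and entries of real matrices -/

namespace Matrix

open scoped Matrix.Norms.L2Operator

variable {ι : Type*} [Fintype ι]

/-- The sum of the squares of the entries. -/
def sumSq {R : Type*} [CommRing R] (M : Matrix ι ι R) : R := ∑ u, ∑ w, M u w ^ 2

theorem sumSq_nonneg (M : Matrix ι ι ℝ) : 0 ≤ M.sumSq :=
  Finset.sum_nonneg fun _ _ => Finset.sum_nonneg fun _ _ => sq_nonneg _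

theorem sumSq_transpose (M : Matrix ι ι ℝ) : Mᵀ.sumSq = M.sumSq := Finset.sum_comm

theorem sumSq_mul_le (M M' : Matrix ι ι ℝ) : (M * M').sumSq ≤ M.sumSq * M'.sumSq := by
  calc (M * M').sumSq ≤ ∑ u, ∑ w, (∑ t, M u t ^ 2) * ∑ t, M' t w ^ 2 :=
        Finset.sum_le_sum fun u _ => Finset.sum_le_sum fun w _ => by
          rw [mul_apply]; exact Finset.sum_mul_sq_le_sq_mul_sq _ _ _
    _ = (∑ u, ∑ t, M u t ^ 2) * ∑ w, ∑ t, M' t w ^ 2 := by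
        rw [Finset.sum_mul_sum]
    _ = M.sumSq * M'.sumSq := by
        rw [sumSq, sumSq]
        congr 1
        exact Finset.sum_comm

theorem sumSq_eq_trace (M : Matrix ι ι ℝ) : M.sumSq = (M * Mᵀ).trace := by
  simp only [sumSq, trace, diag_apply, mul_apply, transpose_apply, sq]

variable [DecidableEq ι]

theorem sumSq_pow_le (M : Matrix ι ι ℝ) (m : ℕ) : (M ^ (m + 1)).sumSq ≤ M.sumSq ^ (m + 1) := by
  induction m with
  | zero => simp
  | succ m ih =>
    rw [pow_succ, pow_succ _ (m + 1)]
    exact (sumSq_mul_le _ _).trans (mul_le_mul_of_nonneg_right ih M.sumSq_nonneg)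

/-- Cauchy-Schwarz in each row: the operator norm is at most the Frobenius norm. -/
theorem opNorm_sq_le_sumSq (M : Matrix ι ι ℝ) : ‖M‖ ^ 2 ≤ M.sumSq := by
  have h : ‖M‖ ≤ √M.sumSq := by
    rw [cstar_norm_def]
    refine ContinuousLinearMap.opNorm_le_bound _ (Real.sqrt_nonneg _) fun x => ?_
    rw [EuclideanSpace.norm_eq, EuclideanSpace.norm_eq, ← Real.sqrt_mul M.sumSq_nonneg]
    refine Real.sqrt_le_sqrt ?_
    rw [sumSq, Finset.sum_mul]
    refine Finset.sum_le_sum fun u _ => ?_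
    simp only [ofLp_toEuclideanCLM, Real.norm_eq_abs, sq_abs]
    exact Finset.sum_mul_sq_le_sq_mul_sq _ _ _
  calc ‖M‖ ^ 2 ≤ √M.sumSq ^ 2 := pow_le_pow_left₀ (norm_nonneg _) h 2
    _ = M.sumSq := Real.sq_sqrt M.sumSq_nonneg

/-- Every column is the image of a unit vector and so has length at most the operator norm. -/
theorem sumSq_le_card_mul (M : Matrix ι ι ℝ) : M.sumSq ≤ Fintype.card ι * ‖M‖ ^ 2 := by
  rw [← sumSq_transpose]
  have h : ∀ w, ∑ u, M u w ^ 2 ≤ ‖M‖ ^ 2 := fun w => by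
    have h1 := l2_opNorm_mulVec M (EuclideanSpace.single w (1 : ℝ))
    rw [show ‖EuclideanSpace.single w (1 : ℝ)‖ = 1 by simp, mul_one] at h1
    have h2 := pow_le_pow_left₀ (norm_nonneg _) h1 2
    rw [EuclideanSpace.norm_eq, Real.sq_sqrt (by positivity)] at h2
    refine le_trans (le_of_eq ?_) h2
    refine Finset.sum_congr rfl fun u _ => ?_
    simp [EuclideanSpace.single]
  calc ∑ w, ∑ u, Mᵀ w u ^ 2 ≤ ∑ _w : ι, ‖M‖ ^ 2 := Finset.sum_le_sum fun w _ => h w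
    _ = _ := by simp

theorem dotProduct_mulVec_le (M : Matrix ι ι ℝ) (x : ι → ℝ) :
    ∑ u, ∑ w, x u * M u w * x w ≤ ‖M‖ * ∑ u, x u ^ 2 := by
  have h := real_inner_le_norm (WithLp.toLp 2 x) (toEuclideanCLM (n := ι) (𝕜 := ℝ) M (WithLp.toLp 2 x))
  have h1 := l2_opNorm_mulVec M (WithLp.toLp 2 x)
  have h2 : ‖WithLp.toLp 2 x‖ ^ 2 = ∑ u, x u ^ 2 := by
    rw [EuclideanSpace.norm_eq, Real.sq_sqrt (by positivity)]
    simp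
  rw [← h2]
  refine le_trans (le_of_eq ?_) (h.trans ((mul_le_mul_of_nonneg_left h1 (norm_nonneg _)).trans
    (le_of_eq (by ring))))
  rw [inner_toEuclideanCLM]
  simp only [dotProduct, mulVec, Finset.mul_sum]
  exact Finset.sum_congr rfl fun u _ => Finset.sum_congr rfl fun w _ => mul_assoc _ _ _

theorem opNorm_transpose (M : Matrix ι ι ℝ) : ‖Mᵀ‖ = ‖M‖ := by
  rw [← conjTranspose_eq_transpose_of_trivial, l2_opNorm_conjTranspose]

theorem opNorm_mul_transpose (M : Matrix ι ι ℝ) : ‖M * Mᵀ‖ = ‖M‖ ^ 2 := by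
  have h := l2_opNorm_conjTranspose_mul_self Mᵀ
  rw [conjTranspose_eq_transpose_of_trivial, transpose_transpose, opNorm_transpose] at h
  rw [h, sq]

/-- The C*-identity gives equality for the exponents `2 ^ t`. For general `m`, submultiplicativity
applied to `M ^ m * M ^ (2 ^ m - m)` allows the excess factor to be cancelled. -/
theorem opNorm_pow_le_of_isSymm {M : Matrix ι ι ℝ} (hM : Mᵀ = M) {m : ℕ} (hm : m ≠ 0) :
    ‖M‖ ^ m ≤ ‖M ^ m‖ := by
  rcases eq_or_ne ‖M‖ 0 with h0 | h0
  · rw [h0, zero_pow hm]; exact norm_nonneg _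
  · have hpow : ∀ t : ℕ, ‖M ^ 2 ^ t‖ = ‖M‖ ^ 2 ^ t := by
      intro t
      induction t with
      | zero => simp
      | succ t ih =>
        have hs : (M ^ 2 ^ t)ᵀ = M ^ 2 ^ t := by rw [transpose_pow, hM]
        have := opNorm_mul_transpose (M ^ 2 ^ t)
        rw [hs] at this
        rw [pow_succ 2 t, pow_mul M, pow_two (M ^ 2 ^ t), this, ih, ← pow_mul]
    have hlt : m < 2 ^ m := Nat.lt_two_pow_self
    have hpos : 0 < ‖M‖ := lt_of_le_of_ne (norm_nonneg _) h0.symm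
    have h1 : ‖M‖ ^ m * ‖M‖ ^ (2 ^ m - m) ≤ ‖M ^ m‖ * ‖M‖ ^ (2 ^ m - m) := by
      rw [← pow_add, Nat.add_sub_cancel' hlt.le, ← hpow m]
      calc ‖M ^ 2 ^ m‖ = ‖M ^ m * M ^ (2 ^ m - m)‖ := by
            rw [← pow_add, Nat.add_sub_cancel' hlt.le]
        _ ≤ ‖M ^ m‖ * ‖M ^ (2 ^ m - m)‖ := norm_mul_le _ _
        _ ≤ _ := mul_le_mul_of_nonneg_left (norm_pow_le' _ (by omega)) (norm_nonneg _)
    exact le_of_mul_le_mul_right h1 (by positivity)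

/-- This lower bound for the Frobenius quantity makes the test sound; the upper bound
`sumSq_le_card_mul_opNorm_pow` makes it succeed. -/
theorem opNorm_pow_le_sumSq (M : Matrix ι ι ℝ) (m : ℕ) :
    ‖M‖ ^ (4 * (m + 1)) ≤ ((M * Mᵀ) ^ (m + 1)).sumSq := by
  have hs : (M * Mᵀ)ᵀ = M * Mᵀ := by rw [transpose_mul, transpose_transpose]
  refine le_trans (le_of_eq ?_) ((pow_le_pow_left₀ (by positivity)
    (opNorm_pow_le_of_isSymm hs (m := m + 1) (by omega)) 2).trans (opNorm_sq_le_sumSq _))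
  rw [opNorm_mul_transpose]
  ring

theorem sumSq_le_card_mul_opNorm_pow (M : Matrix ι ι ℝ) (m : ℕ) :
    ((M * Mᵀ) ^ (m + 1)).sumSq ≤ Fintype.card ι * ‖M‖ ^ (4 * (m + 1)) := by
  refine (sumSq_le_card_mul _).trans (mul_le_mul_of_nonneg_left ?_ (by positivity))
  calc ‖(M * Mᵀ) ^ (m + 1)‖ ^ 2 ≤ (‖M * Mᵀ‖ ^ (m + 1)) ^ 2 :=
        pow_le_pow_left₀ (norm_nonneg _) (norm_pow_le' _ (by omega)) 2
    _ = _ := by rw [opNorm_mul_transpose]; ring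

end Matrix

/-! ### The matrix of pairs of linked hyperedges -/

namespace Refutation

open Matrix

/-- The matrix of pairs of linked hyperedges. -/
def linkMatrix {R : Type*} [CommRing R] (nc N : ℕ) (a : ℕ → R) :
    Matrix (Fin (N * N)) (Fin (N * N)) R :=
  .of fun u w => ∑ v ∈ Finset.range nc,
    a (tupleIndex nc N v (u / N) (w / N)) * a (tupleIndex nc N v (u % N) (w % N)) *
      if tupleIndex nc N v (u / N) (w / N) ≠ tupleIndex nc N v (u % N) (w % N) then 1 else 0

/-- The table entries centred by the guess `j / n ^ k` and scaled by `n ^ k`. -/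
def centred (k n j : ℕ) (b : ℕ → ℕ) (i : ℕ) : ℤ :=
  if DigitsIncreasing n (k - 1) i then n ^ k * b i - j else 0

section
variable {R S : Type*} [CommRing R] [CommRing S] {nc N : ℕ}

theorem linkMatrix_map (f : R →+* S) (a : ℕ → R) :
    (linkMatrix nc N a).map f = linkMatrix nc N fun i => f (a i) := by
  ext u w
  simp [linkMatrix, map_sum, apply_ite f]

theorem sumSq_map {ι : Type*} [Fintype ι] (f : R →+* S) (M : Matrix ι ι R) :
    (M.map f).sumSq = f M.sumSq := by
  simp [sumSq, map_sum]

/-- The same polynomial in the entries occurs over three rings: integers for the exact value,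
residues for the computation, reals for the norm estimates. -/
theorem sumSq_gram_pow_map (f : R →+* S) (a : ℕ → R) (m : ℕ) :
    f ((linkMatrix nc N a * (linkMatrix nc N a)ᵀ) ^ m).sumSq =
      ((linkMatrix nc N (fun i => f (a i)) * (linkMatrix nc N fun i => f (a i))ᵀ) ^ m).sumSq := by
  rw [← sumSq_map, ← linkMatrix_map]
  congr 1
  have h := map_pow f.mapMatrix (linkMatrix nc N a * (linkMatrix nc N a)ᵀ) m
  rw [RingHom.mapMatrix_apply] at h
  rw [h, map_mul, RingHom.mapMatrix_apply, RingHom.mapMatrix_apply, transpose_map]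

theorem cast_linkEntry (a : ℕ → ℕ) (u w : Fin (N * N)) :
    (linkEntry nc N a u w : R) = linkMatrix nc N (fun i => (a i : R)) u w := by
  simp [linkEntry, linkMatrix]

theorem cast_gramEntry {W : ℕ} (a : ℕ → ℕ) (u w : Fin (N * N)) :
    (gramEntry nc N W a (u * (N * N) + w) : ZMod W) =
      (linkMatrix nc N (fun i => (a i : ZMod W)) *
        (linkMatrix nc N fun i => (a i : ZMod W))ᵀ) u w := by
  have hd : 0 < N * N := (Nat.zero_le _).trans_lt u.2
  have h1 : ((u : ℕ) * (N * N) + w) / (N * N) = u := by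
    rw [add_comm, Nat.add_mul_div_right _ _ hd, Nat.div_eq_of_lt w.2, zero_add]
  have h2 : ((u : ℕ) * (N * N) + w) % (N * N) = w := by
    rw [add_comm, Nat.add_mul_mod_self_right, Nat.mod_eq_of_lt w.2]
  rw [gramEntry, ZMod.natCast_mod, h1, h2, Nat.cast_sum, mul_apply, Finset.sum_range]
  refine Finset.sum_congr rfl fun t _ => ?_
  rw [Nat.cast_mul, cast_linkEntry, cast_linkEntry, transpose_apply]

theorem cast_powEntry {W d : ℕ} (g : ℕ → ℕ) (Z : Matrix (Fin d) (Fin d) (ZMod W))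
    (hg : ∀ u w : Fin d, (g (u * d + w) : ZMod W) = Z u w) (m : ℕ) (u w : Fin d) :
    (powEntry d W g m (u * d + w) : ZMod W) = (Z ^ (m + 1)) u w := by
  have hd : 0 < d := (Nat.zero_le _).trans_lt u.2
  induction m generalizing u w with
  | zero => simpa [powEntry] using hg u w
  | succ m ih =>
    have h1 : ((u : ℕ) * d + w) / d = u := by
      rw [add_comm, Nat.add_mul_div_right _ _ hd, Nat.div_eq_of_lt w.2, zero_add]
    have h2 : ((u : ℕ) * d + w) % d = w := by
      rw [add_comm, Nat.add_mul_mod_self_right, Nat.mod_eq_of_lt w.2]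
    rw [powEntry, ZMod.natCast_mod, h1, h2, Nat.cast_sum, pow_succ, mul_apply, Finset.sum_range]
    refine Finset.sum_congr rfl fun t _ => ?_
    rw [Nat.cast_mul, ih u t, hg t w]

theorem sum_range_mul {d : ℕ} (f : ℕ → R) :
    ∑ x ∈ Finset.range (d * d), f x = ∑ u : Fin d, ∑ w : Fin d, f (u * d + w) := by
  rw [Finset.sum_range, ← finProdFinEquiv.sum_comp, Fintype.sum_prod_type]
  refine Finset.sum_congr rfl fun u _ => Finset.sum_congr rfl fun w _ => ?_
  congr 1
  simp [finProdFinEquiv]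
  ring

theorem abs_linkMatrix_le {a : ℕ → ℝ} {A : ℝ} (ha : ∀ i, |a i| ≤ A) (u w : Fin (N * N)) :
    |linkMatrix nc N a u w| ≤ nc * A ^ 2 := by
  have hA : 0 ≤ A := (abs_nonneg _).trans (ha 0)
  calc |linkMatrix nc N a u w| ≤ ∑ v ∈ Finset.range nc, A ^ 2 := by
        rw [linkMatrix, of_apply]
        refine le_trans (Finset.abs_sum_le_sum_abs _ _) (Finset.sum_le_sum fun v _ => ?_)
        rw [abs_mul, abs_mul, sq]
        refine (mul_le_of_le_one_right (by positivity) ?_).trans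
          (mul_le_mul (ha _) (ha _) (abs_nonneg _) hA)
        split_ifs <;> simp
    _ = nc * A ^ 2 := by simp

theorem sumSq_le_of_abs_le {d : ℕ} {M : Matrix (Fin d) (Fin d) ℝ} {A : ℝ}
    (h : ∀ u w, |M u w| ≤ A) : M.sumSq ≤ (d * A) ^ 2 := by
  calc M.sumSq ≤ ∑ _u : Fin d, ∑ _w : Fin d, A ^ 2 :=
        Finset.sum_le_sum fun u _ => Finset.sum_le_sum fun w _ => sq_le_sq' (abs_le.1 (h u w)).1
          (abs_le.1 (h u w)).2
    _ = (d * A) ^ 2 := by simp; ring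

end

section
variable {k n nc N j : ℕ} {b : ℕ → ℕ}

/-- Adding `W` keeps the truncated subtraction exact and is invisible modulo `W`. -/
theorem cast_centredEntry {W : ℕ} (hj : j ≤ W) (i : ℕ) :
    (centredEntry k n W j b i : ZMod W) = (centred k n j b i : ZMod W) := by
  unfold centredEntry centred
  split_ifs
  · rw [one_mul, Nat.cast_sub (by omega)]
    push_cast
    simp
  · simp

theorem abs_centred_le (hb : ∀ x, b x ≤ 1) (hj : j ≤ n ^ k) (i : ℕ) :
    |(centred k n j b i : ℝ)| ≤ (n : ℝ) ^ k := by
  have h1 : (j : ℝ) ≤ (n : ℝ) ^ k := by exact_mod_cast hj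
  have h2 : (b i : ℝ) ≤ 1 := by exact_mod_cast hb i
  have h3 : (n : ℝ) ^ k * b i ≤ (n : ℝ) ^ k := mul_le_of_le_one_right (by positivity) h2
  have h4 : 0 ≤ (n : ℝ) ^ k * b i := by positivity
  have h5 : (0 : ℝ) ≤ j := by positivity
  unfold centred
  split_ifs
  · push_cast
    rw [abs_le]
    constructor <;> linarith
  · simp

/-- The machine finds the residue of a sum of integer squares. As this sum is non-negative and
smaller than the modulus, the residue is the sum itself. -/
theorem traceValue_eq (hn : 2 ≤ n) (hcard : n ^ k = nc * (N * N)) (hj : j ≤ n ^ k)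
    (hb : ∀ x, b x ≤ 1) :
    (traceValue k n nc N (modulus k n) j b : ℝ) =
      ((linkMatrix nc N (fun i => (centred k n j b i : ℝ)) *
        (linkMatrix nc N fun i => (centred k n j b i : ℝ))ᵀ) ^ (n + 1)).sumSq := by
  have hWpos : 0 < modulus k n := by unfold modulus; positivity
  have hnW : n ^ k ≤ modulus k n := by
    unfold modulus
    rw [← pow_mul]
    exact Nat.pow_le_pow_right (by omega) (by nlinarith)
  set W := modulus k n with hW
  set F : ℤ := ((linkMatrix nc N (centred k n j b) *
        (linkMatrix nc N (centred k n j b))ᵀ) ^ (n + 1)).sumSq with hF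
  have hFR : (F : ℝ) = ((linkMatrix nc N (fun i => (centred k n j b i : ℝ)) *
        (linkMatrix nc N fun i => (centred k n j b i : ℝ))ᵀ) ^ (n + 1)).sumSq :=
    sumSq_gram_pow_map (Int.castRingHom ℝ) (centred k n j b) (n + 1)
  have hF0 : 0 ≤ F := Finset.sum_nonneg fun _ _ => Finset.sum_nonneg fun _ _ => sq_nonneg _
  have hFW : F < W := by
    have h1 : (F : ℝ) < W := by
      rw [hFR]
      set Y := linkMatrix nc N fun i => (centred k n j b i : ℝ)
      -- With `K = n ^ k = nc * (N * N)`, entries of `Y` are at most `nc * K ^ 2`, so the Frobenius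
      -- norm is at most `N * N * nc * K ^ 2 = K ^ 3`. The surplus 1 in the exponent `12 * k + 1` of
      -- the modulus makes the final inequality strict.
      have h2 : Y.sumSq ≤ (n : ℝ) ^ (6 * k) := by
        refine (sumSq_le_of_abs_le (abs_linkMatrix_le (abs_centred_le hb hj))).trans (le_of_eq ?_)
        have : (n : ℝ) ^ k = nc * (N * N) := by exact_mod_cast hcard
        push_cast
        calc ((N : ℝ) * N * (nc * ((n : ℝ) ^ k) ^ 2)) ^ 2 =
            (nc * (N * N)) ^ 2 * ((n : ℝ) ^ k) ^ 4 := by ring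
          _ = _ := by rw [← this]; ring
      have h3 : (Y * Yᵀ).sumSq ≤ (n : ℝ) ^ (12 * k) := by
        refine (sumSq_mul_le _ _).trans ?_
        rw [sumSq_transpose, show 12 * k = 6 * k + 6 * k by ring, pow_add]
        exact mul_le_mul h2 h2 (sumSq_nonneg _) (by positivity)
      refine (sumSq_pow_le _ _).trans_lt ((pow_le_pow_left₀ (sumSq_nonneg _) h3 _).trans_lt ?_)
      rw [hW, modulus]
      push_cast
      refine pow_lt_pow_left₀ ?_ (by positivity) (by omega)
      exact pow_lt_pow_right₀ (by exact_mod_cast hn) (by omega)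
    exact_mod_cast h1
  have hcast : ((traceValue k n nc N W j b : ℤ) : ZMod W) = (F : ZMod W) := by
    have h1 := sumSq_gram_pow_map (nc := nc) (N := N) (Int.castRingHom (ZMod W))
      (centred k n j b) (n + 1)
    simp only [Int.coe_castRingHom] at h1
    rw [hF, h1, Int.cast_natCast, traceValue, ZMod.natCast_mod, Nat.cast_sum, sum_range_mul, sumSq]
    refine Finset.sum_congr rfl fun u _ => Finset.sum_congr rfl fun w _ => ?_
    rw [Nat.cast_mul, cast_powEntry _ _ (cast_gramEntry _), sq]
    simp only [cast_centredEntry (hj.trans hnW)]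
  rw [← hFR]
  have h3 := (ZMod.intCast_eq_intCast_iff' _ _ _).1 hcast
  have h4 : (traceValue k n nc N W j b : ℤ) < W := by
    exact_mod_cast Nat.mod_lt _ hWpos
  rw [Int.emod_eq_of_lt (by positivity) h4, Int.emod_eq_of_lt hF0 hFW] at h3
  exact_mod_cast h3

end

end Refutation

/-! ### The certificates are correct -/

/-- Induction through `(s + 1) * s.choose k = (s + 1).choose (k + 1) * (k + 1)`, using that `k * (s
+ 1) ≤ (k + 1) * s` for `k ≤ s`. -/
theorem Nat.pow_le_pow_mul_choose {k s : ℕ} (h : k ≤ s) : s ^ k ≤ k ^ k * s.choose k := by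
  induction k generalizing s with
  | zero => simp
  | succ k ih =>
    obtain ⟨s, rfl⟩ : ∃ t, s = t + 1 := ⟨s - 1, by omega⟩
    have hks : k ≤ s := by omega
    have h1 : (s + 1) ^ k ≤ (k + 1) ^ k * s.choose k := by
      rcases Nat.eq_zero_or_pos k with rfl | hk
      · simp
      · refine Nat.le_of_mul_le_mul_left ?_ (pow_pos hk k)
        calc k ^ k * (s + 1) ^ k = (k * (s + 1)) ^ k := (mul_pow _ _ _).symm
          _ ≤ ((k + 1) * s) ^ k := Nat.pow_le_pow_left (by nlinarith) k
          _ = (k + 1) ^ k * s ^ k := mul_pow _ _ _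
          _ ≤ (k + 1) ^ k * (k ^ k * s.choose k) := Nat.mul_le_mul_left _ (ih hks)
          _ = k ^ k * ((k + 1) ^ k * s.choose k) := by ring
    calc (s + 1) ^ (k + 1) = (s + 1) ^ k * (s + 1) := pow_succ _ _
      _ ≤ (k + 1) ^ k * s.choose k * (s + 1) := Nat.mul_le_mul_right _ h1
      _ = (k + 1) ^ k * ((s + 1) * s.choose k) := by ring
      _ = (k + 1) ^ (k + 1) * (s + 1).choose (k + 1) := by
        rw [Nat.add_one_mul_choose_eq]; ring

theorem Finset.sum_range_mul_eq {M : Type*} [AddCommMonoid M] (a b : ℕ) (f : ℕ → M) :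
    ∑ i ∈ range (a * b), f i = ∑ y ∈ range b, ∑ z ∈ range a, f (z + a * y) := by
  induction b with
  | zero => simp
  | succ b ih =>
    rw [mul_add_one, sum_range_add, ih, sum_range_succ]
    exact congrArg _ (sum_congr rfl fun z _ => by rw [add_comm])

namespace Refutation

open Matrix

/-- The first `m` digits of `x` belong to `S`. -/
def DigitsIn (n : ℕ) (S : Finset ℕ) (m x : ℕ) : Prop := ∀ t < m, x / n ^ t % n ∈ S

instance (n : ℕ) (S : Finset ℕ) (m x : ℕ) : Decidable (DigitsIn n S m x) :=
  inferInstanceAs (Decidable (∀ t < m, _))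

theorem digitsIn_add_mul {n m m' a z : ℕ} {S : Finset ℕ} (hn : 0 < n) (ha : a < n ^ m) :
    DigitsIn n S (m + m') (a + n ^ m * z) ↔ DigitsIn n S m a ∧ DigitsIn n S m' z := by
  have h1 : ∀ t < m, (a + n ^ m * z) / n ^ t % n = a / n ^ t % n := by
    intro t ht
    obtain ⟨e, rfl⟩ : ∃ e, m = t + (e + 1) := ⟨m - t - 1, by omega⟩
    rw [pow_add, mul_assoc, Nat.add_mul_div_left _ _ (by positivity), pow_succ, mul_comm (n ^ e) n,
      mul_assoc, Nat.add_mul_mod_self_left]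
  have h2 : ∀ t, (a + n ^ m * z) / n ^ (m + t) % n = z / n ^ t % n := by
    intro t
    rw [pow_add, ← Nat.div_div_eq_div_mul, Nat.add_mul_div_left _ _ (by positivity),
      Nat.div_eq_of_lt ha, zero_add]
  constructor
  · intro h
    exact ⟨fun t ht => h1 t ht ▸ h t (by omega), fun t ht => h2 t ▸ h (m + t) (by omega)⟩
  · rintro ⟨ha', hz⟩ t ht
    rcases lt_or_ge t m with htm | htm
    · rw [h1 t htm]; exact ha' t htm
    · obtain ⟨e, rfl⟩ := Nat.exists_eq_add_of_le htm
      rw [h2]; exact hz e (by omega)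

theorem digitsIn_tupleIndex {n c l v x y : ℕ} {S : Finset ℕ} (hn : 0 < n) (hv : v < n ^ c)
    (hx : x < n ^ l) : DigitsIn n S (c + 2 * l) (tupleIndex (n ^ c) (n ^ l) v x y) ↔
      DigitsIn n S c v ∧ DigitsIn n S l x ∧ DigitsIn n S l y := by
  have h1 : tupleIndex (n ^ c) (n ^ l) v x y = v + n ^ c * (x + n ^ l * y) := by
    unfold tupleIndex; ring
  rw [h1, two_mul, digitsIn_add_mul hn hv, digitsIn_add_mul hn hx]

theorem sum_tupleIndex {M : Type*} [AddCommMonoid M] (nc N : ℕ) (f : ℕ → M) :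
    ∑ i ∈ Finset.range (nc * (N * N)), f i = ∑ v ∈ Finset.range nc, ∑ x ∈ Finset.range N,
      ∑ y ∈ Finset.range N, f (tupleIndex nc N v x y) := by
  rw [Finset.sum_range_mul_eq, Finset.sum_comm]
  refine Finset.sum_congr rfl fun v _ => ?_
  rw [Finset.sum_range_mul_eq N N (fun y => f (v + nc * y)), Finset.sum_comm]
  refine Finset.sum_congr rfl fun x _ => Finset.sum_congr rfl fun y _ => ?_
  congr 1
  unfold tupleIndex
  ring

theorem sum_divMod {M : Type*} [AddCommMonoid M] (N : ℕ) (f : ℕ → ℕ → M) :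
    ∑ u : Fin (N * N), f (u / N) (u % N) =
      ∑ x ∈ Finset.range N, ∑ x' ∈ Finset.range N, f x x' := by
  rw [Fin.sum_univ_eq_sum_range (fun u => f (u / N) (u % N)), Finset.sum_range_mul_eq]
  refine Finset.sum_congr rfl fun x hx => Finset.sum_congr rfl fun x' hx' => ?_
  have hN : 0 < N := (Nat.zero_le _).trans_lt (Finset.mem_range.1 hx)
  rw [Nat.add_mul_div_left _ _ hN, Nat.add_mul_mod_self_left,
    Nat.div_eq_of_lt (Finset.mem_range.1 hx'), Nat.mod_eq_of_lt (Finset.mem_range.1 hx'), zero_add]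

/-- The pair `(x, x')` is coded by `u = x * N + x'`. Grouping both row indices in `u` and both
column indices in `w` turns the square into a bilinear form. -/
theorem sq_sum_sum_eq {N : ℕ} (g : ℕ → ℕ → ℝ) :
    (∑ x ∈ Finset.range N, ∑ y ∈ Finset.range N, g x y) ^ 2 =
      ∑ u : Fin (N * N), ∑ w : Fin (N * N), g (u / N) (w / N) * g (u % N) (w % N) := by
  have h1 : ∀ u : Fin (N * N),
      ∑ w : Fin (N * N), g (u / N) (w / N) * g (u % N) (w % N) =
        (∑ y ∈ Finset.range N, g (u / N) y) * ∑ y ∈ Finset.range N, g (u % N) y := fun u => by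
    rw [sum_divMod N fun y y' => g (u / N) y * g (u % N) y', Finset.sum_mul_sum]
  rw [Finset.sum_congr rfl fun u _ => h1 u, sum_divMod N fun x x' =>
    (∑ y ∈ Finset.range N, g x y) * ∑ y ∈ Finset.range N, g x' y, ← Finset.sum_mul_sum, sq]

open scoped Matrix.Norms.L2Operator in
-- Cauchy-Schwarz removes `σ` and leaves squares of sums over `(x, y)`. Summed over `v`, their
-- off-diagonal terms are the quadratic form of the link matrix at the vector `τ x * τ x'`, whose
-- squared length is at most `N * N`; the diagonal terms are at most `a i ^ 2`.
theorem sq_sum_le {nc N : ℕ} (a : ℕ → ℝ) (σ τ : ℕ → ℝ) (hσ : ∀ v, σ v ^ 2 ≤ 1)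
    (hτ : ∀ x, τ x ^ 2 ≤ 1) :
    (∑ v ∈ Finset.range nc, ∑ x ∈ Finset.range N, ∑ y ∈ Finset.range N,
      σ v * (τ x * τ y * a (tupleIndex nc N v x y))) ^ 2 ≤
      nc * (‖linkMatrix nc N a‖ * (N * N) + ∑ i ∈ Finset.range (nc * (N * N)), a i ^ 2) := by
  set z : ℕ → ℝ := fun v => ∑ x ∈ Finset.range N, ∑ y ∈ Finset.range N,
    τ x * τ y * a (tupleIndex nc N v x y) with hz
  set ξ : Fin (N * N) → ℝ := fun u => τ (u / N) * τ (u % N) with hξ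
  have hξ1 : ∀ u, ξ u ^ 2 ≤ 1 := fun u => by
    rw [hξ]; simp only [mul_pow]
    exact mul_le_one₀ (hτ _) (sq_nonneg _) (hτ _)
  have h1 : (∑ v ∈ Finset.range nc, ∑ x ∈ Finset.range N, ∑ y ∈ Finset.range N,
      σ v * (τ x * τ y * a (tupleIndex nc N v x y))) = ∑ v ∈ Finset.range nc, σ v * z v := by
    simp only [hz, Finset.mul_sum]
  have h2 : ∑ v ∈ Finset.range nc, z v ^ 2 ≤ (∑ u, ∑ w, ξ u * linkMatrix nc N a u w * ξ w) +
      ∑ i ∈ Finset.range (nc * (N * N)), a i ^ 2 := by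
    have h3 : ∀ v ∈ Finset.range nc, z v ^ 2 ≤
        (∑ u : Fin (N * N), ∑ w : Fin (N * N), ξ u * (a (tupleIndex nc N v (u / N) (w / N)) *
          a (tupleIndex nc N v (u % N) (w % N)) * if tupleIndex nc N v (u / N) (w / N) ≠
            tupleIndex nc N v (u % N) (w % N) then 1 else 0) * ξ w) +
        ∑ x ∈ Finset.range N, ∑ y ∈ Finset.range N, a (tupleIndex nc N v x y) ^ 2 := by
      intro v hv
      have hnc : 0 < nc := (Nat.zero_le _).trans_lt (Finset.mem_range.1 hv)
      have e1 : ∑ x ∈ Finset.range N, ∑ y ∈ Finset.range N, a (tupleIndex nc N v x y) ^ 2 =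
          ∑ u : Fin (N * N), ∑ w : Fin (N * N),
            if u / N = (u % N : ℕ) ∧ w / N = (w % N : ℕ) then
              a (tupleIndex nc N v (u / N) (w / N)) ^ 2 else 0 := by
        have e2 : ∀ u : Fin (N * N), (∑ w : Fin (N * N),
            if u / N = (u % N : ℕ) ∧ w / N = (w % N : ℕ) then
              a (tupleIndex nc N v (u / N) (w / N)) ^ 2 else 0) =
            if u / N = (u % N : ℕ) then ∑ y ∈ Finset.range N,
              a (tupleIndex nc N v (u / N) y) ^ 2 else 0 := by
          intro u
          rw [sum_divMod N fun y y' => if u / N = (u % N : ℕ) ∧ y = y' then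
            a (tupleIndex nc N v (u / N) y) ^ 2 else 0]
          split_ifs with h
          · refine Finset.sum_congr rfl fun y hy => ?_
            simp only [h, true_and]
            rw [Finset.sum_ite_eq, if_pos hy]
          · simp [h]
        rw [Finset.sum_congr rfl fun u _ => e2 u, sum_divMod N fun x x' => if x = x' then
          ∑ y ∈ Finset.range N, a (tupleIndex nc N v x y) ^ 2 else 0]
        refine Finset.sum_congr rfl fun x hx => ?_
        rw [Finset.sum_ite_eq, if_pos hx]
      rw [e1, hz]
      simp only []
      rw [sq_sum_sum_eq, ← Finset.sum_add_distrib]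
      refine Finset.sum_le_sum fun u _ => ?_
      rw [← Finset.sum_add_distrib]
      refine Finset.sum_le_sum fun w _ => ?_
      have hN : 0 < N := Nat.pos_of_ne_zero (by
        rintro rfl; exact absurd u.2 (by simp))
      -- Equal indices force `x = x'` and `y = y'`: these are precisely the terms that the link
      -- matrix omits.
      by_cases heq : tupleIndex nc N v (u / N) (w / N) = tupleIndex nc N v (u % N) (w % N)
      · have h6 : (u / N : ℕ) + N * (w / N) = u % N + N * (w % N) := by
          unfold tupleIndex at heq
          refine Nat.eq_of_mul_eq_mul_left hnc ?_
          linarith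
        have h7 : (u / N : ℕ) < N := Nat.div_lt_of_lt_mul u.2
        have h8 : (u % N : ℕ) < N := Nat.mod_lt _ hN
        have h9 : (u / N : ℕ) = u % N := by
          have := congrArg (· % N) h6
          simpa only [Nat.add_mul_mod_self_left, Nat.mod_eq_of_lt h7, Nat.mod_eq_of_lt h8] using this
        have h10 : (w / N : ℕ) = w % N := by
          rw [h9] at h6
          exact Nat.eq_of_mul_eq_mul_left hN (by omega)
        rw [if_neg (not_not.2 heq), if_pos ⟨h9, h10⟩, ← h9, ← h10]
        have h11 : (τ (u / N) ^ 2) * (τ (w / N) ^ 2) ≤ 1 :=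
          mul_le_one₀ (hτ _) (sq_nonneg _) (hτ _)
        nlinarith [mul_le_mul_of_nonneg_right h11 (sq_nonneg (a (tupleIndex nc N v (u / N) (w / N))))]
      · have h9 : ¬((u / N : ℕ) = u % N ∧ (w / N : ℕ) = w % N) := fun h => heq (by
          rw [← h.1, ← h.2])
        rw [if_pos heq, if_neg h9, hξ]
        simp only []
        linarith
    refine (Finset.sum_le_sum h3).trans (le_of_eq ?_)
    rw [Finset.sum_add_distrib, sum_tupleIndex]
    congr 1
    rw [Finset.sum_comm]
    refine Finset.sum_congr rfl fun u _ => ?_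
    rw [Finset.sum_comm]
    refine Finset.sum_congr rfl fun w _ => ?_
    rw [linkMatrix, of_apply, Finset.mul_sum, Finset.sum_mul]
  have h4 : ∑ u, ξ u ^ 2 ≤ N * N := by
    refine (Finset.sum_le_sum fun u _ => hξ1 u).trans (le_of_eq ?_)
    simp
  rw [h1]
  calc (∑ v ∈ Finset.range nc, σ v * z v) ^ 2 ≤
        (∑ v ∈ Finset.range nc, σ v ^ 2) * ∑ v ∈ Finset.range nc, z v ^ 2 :=
        Finset.sum_mul_sq_le_sq_mul_sq _ _ _
    _ ≤ nc * ∑ v ∈ Finset.range nc, z v ^ 2 := by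
        refine mul_le_mul_of_nonneg_right ?_ (Finset.sum_nonneg fun _ _ => sq_nonneg _)
        refine (Finset.sum_le_sum fun v _ => hσ v).trans (le_of_eq ?_)
        simp
    _ ≤ _ := by
        refine mul_le_mul_of_nonneg_left (h2.trans (add_le_add_left ?_ _)) (by positivity)
        exact (dotProduct_mulVec_le _ _).trans (mul_le_mul_of_nonneg_left h4 (norm_nonneg _))

end Refutation

/-! ### Independent sets, colour classes and soundness -/

namespace Refutation

open Matrix

theorem digit_eq {n k i : ℕ} (hi : i < n ^ k) (t : Fin k) :
    ((finFunctionFinEquiv.symm (⟨i, hi⟩ : Fin (n ^ k)) t : Fin n) : ℕ) = i / n ^ (t : ℕ) % n := rfl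

theorem input_mem_eq_one_iff {n k : ℕ} (H : UniformHypergraph n k) (ξ i : ℕ) :
    (H.input ξ).mem i = 1 ↔ ∃ h : i < n ^ k, ∃ e ∈ H,
      e.1 = Finset.univ.image (finFunctionFinEquiv.symm (⟨i, h⟩ : Fin (n ^ k))) := by
  simp only [UniformHypergraph.input]
  split_ifs with h
  · exact iff_of_true rfl h
  · exact iff_of_false (by norm_num) h

theorem input_mem_eq_zero {n k : ℕ} {H : UniformHypergraph n k} {S : Finset (Fin n)}
    (hS : ∀ e ∈ H, ¬ e.1 ⊆ S) (ξ : ℕ) {i : ℕ} (hi : DigitsIn n (S.map Fin.valEmbedding) k i) :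
    (H.input ξ).mem i = 0 := by
  by_contra h
  have h1 : (H.input ξ).mem i = 1 := by have := input_mem_le H ξ i; omega
  obtain ⟨hi', e, he, hei⟩ := (input_mem_eq_one_iff H ξ i).1 h1
  refine hS e he ?_
  rw [hei]
  intro v hv
  obtain ⟨t, -, rfl⟩ := Finset.mem_image.1 hv
  have := hi t t.2
  rw [← digit_eq hi' t, Finset.mem_map] at this
  obtain ⟨w, hw, hwt⟩ := this
  rwa [← Fin.ext hwt]

/-- The index of a set of vertices listed in increasing order. -/
def indexOf {n k : ℕ} (e : Finset (Fin n)) (he : e.card = k) : Fin (n ^ k) :=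
  finFunctionFinEquiv (e.orderEmbOfFin he)

theorem symm_indexOf {n k : ℕ} (e : Finset (Fin n)) (he : e.card = k) :
    finFunctionFinEquiv.symm (indexOf e he) = e.orderEmbOfFin he :=
  Equiv.symm_apply_apply _ _

theorem image_symm_indexOf {n k : ℕ} (e : Finset (Fin n)) (he : e.card = k) :
    Finset.univ.image (finFunctionFinEquiv.symm (indexOf e he)) = e := by
  rw [symm_indexOf]
  exact Finset.image_orderEmbOfFin_univ e he

theorem digitsIncreasing_indexOf {n k : ℕ} (e : Finset (Fin n)) (he : e.card = k) :
    DigitsIncreasing n (k - 1) (indexOf e he) := by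
  intro j hj
  have h1 := digit_eq (indexOf e he).2 (⟨j, by omega⟩ : Fin k)
  have h2 := digit_eq (indexOf e he).2 (⟨j + 1, by omega⟩ : Fin k)
  rw [Fin.eta, symm_indexOf] at h1 h2
  rw [← h1, ← h2, Fin.val_fin_lt]
  exact (e.orderEmbOfFin he).strictMono (by simp)

/-- Listing a `k`-subset of `S` in increasing order gives an admissible index from which the subset
can be recovered. -/
theorem choose_le_card {n k : ℕ} (S : Finset (Fin n)) :
    S.card.choose k ≤ ((Finset.range (n ^ k)).filter fun i => DigitsIncreasing n (k - 1) i ∧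
      DigitsIn n (S.map Fin.valEmbedding) k i).card := by
  rw [← Finset.card_powersetCard]
  have hc : ∀ e ∈ Finset.powersetCard k S, e.card = k := fun e he =>
    (Finset.mem_powersetCard.1 he).2
  refine Finset.card_le_card_of_injOn
    (fun e => if h : e.card = k then (indexOf e h : ℕ) else 0) ?_ ?_
  · intro e he
    have hek := hc e he
    simp only [dif_pos hek, Finset.coe_filter, Finset.mem_range, Set.mem_ofPred_eq]
    refine ⟨(indexOf e hek).2, digitsIncreasing_indexOf e hek, fun t ht => ?_⟩
    have h1 := digit_eq (indexOf e hek).2 (⟨t, ht⟩ : Fin k)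
    rw [Fin.eta, symm_indexOf] at h1
    rw [← h1]
    exact Finset.mem_map_of_mem _ ((Finset.mem_powersetCard.1 he).1 (e.orderEmbOfFin_mem hek _))
  · intro e he e' he' hee
    have hek := hc e he
    have hek' := hc e' he'
    simp only [dif_pos hek, dif_pos hek'] at hee
    rw [← image_symm_indexOf e hek, ← image_symm_indexOf e' hek', Fin.ext hee]

/-- A bound for the diagonal terms. -/
def diagonalSum (k n j : ℕ) (b : ℕ → ℕ) : ℕ :=
  n ^ k * n ^ k * ∑ x ∈ Finset.range (n ^ k), b x + j * j * n ^ k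

/-- As `b i` is 0 or 1, the mixed term of `(n ^ k * b i - j) ^ 2` is non-positive and `b i ^ 2 = b
i`. -/
theorem sum_centred_sq_le {n k j : ℕ} {b : ℕ → ℕ} (hb : ∀ x, b x ≤ 1) :
    ∑ i ∈ Finset.range (n ^ k), (centred k n j b i : ℝ) ^ 2 ≤ diagonalSum k n j b := by
  have h : ∀ i, (centred k n j b i : ℝ) ^ 2 ≤ (n : ℝ) ^ k * n ^ k * b i + j * j := by
    intro i
    have h3 : b i = 0 ∨ b i = 1 := by have := hb i; omega
    have h4 : (0 : ℝ) ≤ (n : ℝ) ^ k * j := by positivity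
    have h5 : (0 : ℝ) ≤ (n : ℝ) ^ k * n ^ k * b i + j * j := by positivity
    unfold centred
    split_ifs
    · push_cast
      rcases h3 with h3 | h3 <;> rw [h3] <;> push_cast <;> nlinarith
    · simpa using h5
  refine (Finset.sum_le_sum fun i _ => h i).trans (le_of_eq ?_)
  rw [Finset.sum_add_distrib, ← Finset.mul_sum, diagonalSum]
  push_cast
  simp
  ring

open scoped Matrix.Norms.L2Operator in
-- `sq_sum_le` with the indicators of blocks inside `S`. The product of the three indicators is that
-- of tuples inside `S`, where independence makes every table entry vanish and so every centred
-- entry equal to `-j`, if increasing.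
theorem sq_mul_card_le {n k c l q j : ℕ} (hkc : k = c + 2 * l) (hn : 0 < n)
    (H : UniformHypergraph n k) {S : Finset (Fin n)} (hind : ∀ e ∈ H, ¬ e.1 ⊆ S) :
    ((j : ℝ) * ((Finset.range (n ^ k)).filter fun i => DigitsIncreasing n (k - 1) i ∧
        DigitsIn n (S.map Fin.valEmbedding) k i).card) ^ 2 ≤
      (n : ℝ) ^ k * ‖linkMatrix (n ^ c) (n ^ l) fun i => (centred k n j (H.input q).mem i : ℝ)‖ +
        (n : ℝ) ^ c * diagonalSum k n j (H.input q).mem := by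
  have hcard : n ^ k = n ^ c * (n ^ l * n ^ l) := by
    rw [← pow_add, ← pow_add]; congr 1; omega
  set b := (H.input q).mem with hb
  have hb1 : ∀ x, b x ≤ 1 := input_mem_le H q
  set a : ℕ → ℝ := fun i => (centred k n j b i : ℝ) with ha
  set S' := S.map Fin.valEmbedding with hS'
  set σ : ℕ → ℝ := fun v => if DigitsIn n S' c v then 1 else 0 with hσ
  set τ : ℕ → ℝ := fun x => if DigitsIn n S' l x then 1 else 0 with hτ
  have hineq := sq_sum_le (nc := n ^ c) (N := n ^ l) a σ τ
    (fun v => by simp only [hσ]; split_ifs <;> simp) (fun v => by simp only [hτ]; split_ifs <;> simp)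
  have hT : (∑ v ∈ Finset.range (n ^ c), ∑ x ∈ Finset.range (n ^ l), ∑ y ∈ Finset.range (n ^ l),
      σ v * (τ x * τ y * a (tupleIndex (n ^ c) (n ^ l) v x y))) =
      -(j : ℝ) * ((Finset.range (n ^ k)).filter fun i => DigitsIncreasing n (k - 1) i ∧
        DigitsIn n S' k i).card := by
    have h1 : (∑ v ∈ Finset.range (n ^ c), ∑ x ∈ Finset.range (n ^ l), ∑ y ∈ Finset.range (n ^ l),
      σ v * (τ x * τ y * a (tupleIndex (n ^ c) (n ^ l) v x y))) = ∑ i ∈ Finset.range (n ^ k),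
        (if DigitsIn n S' k i then 1 else 0) * a i := by
      rw [hcard, sum_tupleIndex]
      refine Finset.sum_congr rfl fun v hv => Finset.sum_congr rfl fun x hx =>
        Finset.sum_congr rfl fun y _ => ?_
      have := digitsIn_tupleIndex (y := y) (S := S') (by omega : 0 < n) (Finset.mem_range.1 hv)
        (Finset.mem_range.1 hx)
      rw [← hkc] at this
      simp only [this, hσ, hτ]
      split_ifs <;> simp_all
    rw [h1, Finset.card_filter, Nat.cast_sum, Finset.mul_sum]
    refine Finset.sum_congr rfl fun i _ => ?_
    by_cases h2 : DigitsIn n S' k i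
    · have h3 := input_mem_eq_zero hind q h2
      rw [← hb] at h3
      by_cases h4 : DigitsIncreasing n (k - 1) i <;> simp [ha, centred, h2, h3, h4]
    · simp [h2]
  have hD : ∑ i ∈ Finset.range (n ^ c * (n ^ l * n ^ l)), a i ^ 2 ≤ diagonalSum k n j b := by
    rw [← hcard]; exact sum_centred_sq_le hb1
  have hcardR : (n : ℝ) ^ k = (n : ℝ) ^ c * ((n : ℝ) ^ l * (n : ℝ) ^ l) := by exact_mod_cast hcard
  rw [hT] at hineq
  push_cast at hineq
  rw [neg_mul, neg_sq] at hineq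
  refine hineq.trans ?_
  rw [hcardR]
  calc (n : ℝ) ^ c * (‖linkMatrix (n ^ c) (n ^ l) a‖ * ((n : ℝ) ^ l * (n : ℝ) ^ l) +
        ∑ i ∈ Finset.range (n ^ c * (n ^ l * n ^ l)), a i ^ 2) ≤
        (n : ℝ) ^ c * (‖linkMatrix (n ^ c) (n ^ l) a‖ * ((n : ℝ) ^ l * (n : ℝ) ^ l) +
          diagonalSum k n j b) :=
        mul_le_mul_of_nonneg_left (add_le_add_right hD _) (by positivity)
    _ = _ := by ring

open scoped Matrix.Norms.L2Operator in
-- The inequality for independent sets bounds `j² K²`, where `K = n ^ k`, by a sum of two terms. The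
-- two comparisons say that twice each term is smaller than `j² K²`.
theorem not_independent {n k c l q j : ℕ} (hk : 2 ≤ k) (hkc : k = c + 2 * l)
    (H : UniformHypergraph n k) (hq : q ≠ 0) (hqn : q * k ≤ n) (hj : j ≤ n ^ k)
    (hd : DiagonalSmall k n (n ^ c) q j (H.input q).mem)
    (ht : TraceSmall k n q j (traceValue k n (n ^ c) (n ^ l) (modulus k n) j (H.input q).mem))
    {S : Finset (Fin n)} (hS : n ≤ q * S.card) : ∃ e ∈ H, e.1 ⊆ S := by
  by_contra! hind
  have hn : 2 ≤ n := by
    have : 1 * 2 ≤ q * k := Nat.mul_le_mul (by omega) hk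
    omega
  have hcard : n ^ k = n ^ c * (n ^ l * n ^ l) := by
    rw [← pow_add, ← pow_add]; congr 1; omega
  set b := (H.input q).mem with hb
  have hb1 : ∀ x, b x ≤ 1 := input_mem_le H q
  have h1 := sq_mul_card_le (q := q) (j := j) hkc (by omega) H hind
  rw [← hb] at h1
  have htrace := traceValue_eq (k := k) (j := j) hn hcard hj hb1
  have hyF := opNorm_pow_le_sumSq (linkMatrix (n ^ c) (n ^ l) fun i => (centred k n j b i : ℝ)) n
  rw [← htrace] at hyF
  set F := traceValue k n (n ^ c) (n ^ l) (modulus k n) j b with hF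
  have hy0 := norm_nonneg (linkMatrix (n ^ c) (n ^ l) fun i => (centred k n j b i : ℝ))
  generalize ‖linkMatrix (n ^ c) (n ^ l) fun i => (centred k n j b i : ℝ)‖ = y at h1 hyF hy0
  set S' := S.map Fin.valEmbedding with hS'
  set m := ((Finset.range (n ^ k)).filter fun i => DigitsIncreasing n (k - 1) i ∧
        DigitsIn n S' k i).card with hm
  have hd' : factor k q * n ^ c * diagonalSum k n j b < j * j * (n ^ k * n ^ k) := hd
  generalize diagonalSum k n j b = D at h1 hd'
  have hsk : k ≤ S.card := by
    have : q * k ≤ q * S.card := hqn.trans hS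
    exact Nat.le_of_mul_le_mul_left this (by omega)
  have hKm : (n : ℝ) ^ k ≤ ((q : ℝ) * k) ^ k * m := by
    have h2 : n ^ k ≤ (q * k) ^ k * m := by
      calc n ^ k ≤ (q * S.card) ^ k := Nat.pow_le_pow_left hS k
        _ = q ^ k * S.card ^ k := mul_pow _ _ _
        _ ≤ q ^ k * (k ^ k * S.card.choose k) :=
            Nat.mul_le_mul_left _ (Nat.pow_le_pow_mul_choose hsk)
        _ = (q * k) ^ k * S.card.choose k := by ring
        _ ≤ _ := Nat.mul_le_mul_left _ (choose_le_card S)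
    exact_mod_cast h2
  have h2 : (j : ℝ) * j * (n ^ k * n ^ k) ≤
      ((q : ℝ) * k) ^ (2 * k) * ((n : ℝ) ^ k * y + (n : ℝ) ^ c * D) := by
    calc (j : ℝ) * j * (n ^ k * n ^ k) = (j * (n : ℝ) ^ k) ^ 2 := by ring
      _ ≤ (j * (((q : ℝ) * k) ^ k * m)) ^ 2 := by gcongr
      _ = ((q : ℝ) * k) ^ (2 * k) * ((j : ℝ) * m) ^ 2 := by ring
      _ ≤ _ := by gcongr
  have h3 : 2 * ((q : ℝ) * k) ^ (2 * k) * n ^ c * D < (j : ℝ) * j * (n ^ k * n ^ k) := by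
    have : ((factor k q * n ^ c * D : ℕ) : ℝ) < ((j * j * (n ^ k * n ^ k) : ℕ) : ℝ) := by
      exact_mod_cast hd'
    rw [factor] at this
    push_cast at this
    exact this
  have h4 : 2 * ((q : ℝ) * k) ^ (2 * k) * n ^ k * y < (j : ℝ) * j * (n ^ k * n ^ k) := by
    have h5 : ((((factor k q * n ^ k) ^ 4) ^ (n + 1) * F : ℕ) : ℝ) <
        ((((j * j * (n ^ k * n ^ k)) ^ 4) ^ (n + 1) : ℕ) : ℝ) := by exact_mod_cast ht
    rw [factor] at h5
    push_cast at h5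
    -- The comparison is between powers with exponent `4 * (n + 1)`, so that the norm enters only
    -- through its upper bound `F`.
    refine lt_of_pow_lt_pow_left₀ (4 * (n + 1)) (by positivity) ?_
    rw [pow_mul ((j : ℝ) * j * (n ^ k * n ^ k)), mul_pow, pow_mul (2 * ((q : ℝ) * k) ^ (2 * k) * n ^ k)]
    exact lt_of_le_of_lt (by gcongr) h5
  nlinarith

/-- Pigeonhole without division: otherwise each class satisfies `q * card ≤ n - 1`, and summing over
the `r ≤ q` classes gives `q * n ≤ q * (n - 1)`. -/
theorem exists_large_class {n q r : ℕ} (hr : r ≤ q) (hn : 0 < n) (f : Fin n → Fin r) :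
    ∃ i, n ≤ q * (Finset.univ.filter fun v => f v = i).card := by
  by_contra! h
  have h1 : ∑ i : Fin r, (Finset.univ.filter fun v => f v = i).card = n := by
    rw [← Finset.card_eq_sum_card_fiberwise (fun _ _ => Finset.mem_coe.2 (Finset.mem_univ _))]
    simp
  have h2 : q * n ≤ r * (n - 1) := by
    calc q * n = ∑ i : Fin r, q * (Finset.univ.filter fun v => f v = i).card := by
          rw [← Finset.mul_sum, h1]
      _ ≤ ∑ _i : Fin r, (n - 1) := Finset.sum_le_sum fun i _ => by have := h i; omega
      _ = r * (n - 1) := by simp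
  have h3 : r * (n - 1) ≤ q * (n - 1) := Nat.mul_le_mul_right _ hr
  have hq : 0 < q := by
    rcases Nat.eq_zero_or_pos q with rfl | hq
    · have := f ⟨0, hn⟩
      exact absurd this.2 (by omega)
    · exact hq
  have h4 : q * (n - 1) < q * n := Nat.mul_lt_mul_of_pos_left (by omega) hq
  omega

theorem lt_chromaticNumber {n k q : ℕ} (hk : 2 ≤ k) (hn : 0 < n) (H : UniformHypergraph n k)
    (h : ∀ S : Finset (Fin n), n ≤ q * S.card → ∃ e ∈ H, e.1 ⊆ S) : q < H.chromaticNumber := by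
  by_contra! hle
  obtain ⟨f, hf⟩ : ∃ f : H.toHypergraph.vertexSet → Fin H.chromaticNumber,
      H.toHypergraph.IsColoring f := Nat.sInf_mem (s := {q | ∃ f : H.toHypergraph.vertexSet → Fin q,
        H.toHypergraph.IsColoring f}) ⟨n, UniformHypergraph.exists_isColoring hk H⟩
  obtain ⟨i, hi⟩ := exists_large_class hle hn fun v => f ⟨v, trivial⟩
  obtain ⟨e, he, hes⟩ := h _ hi
  refine (hf i).2 e.1 ⟨e, he, rfl⟩ fun v hv => ?_
  exact ⟨⟨v, trivial⟩, by simpa using hes hv, rfl⟩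

theorem lt_chromaticNumber_of_accepts {n k c l q : ℕ} (hk : 2 ≤ k) (hkc : k = c + 2 * l)
    (H : UniformHypergraph n k) (h : Accepts k c l n q (H.input q).mem) :
    q < H.chromaticNumber := by
  rcases h with ⟨rfl, hn⟩ | ⟨hq, hqn, hs⟩
  · refine lt_chromaticNumber hk (by omega) H fun S hS => ?_
    omega
  · have hn : 0 < n := by
      have : 1 * 2 ≤ q * k := Nat.mul_le_mul (by omega) hk
      omega
    refine lt_chromaticNumber hk hn H fun S hS => ?_
    obtain ⟨j, hj, hc⟩ := Finset.exists_ne_zero_of_sum_ne_zero hs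
    rw [certificate] at hc
    split_ifs at hc with h
    · exact not_independent hk hkc H hq hqn (by have := Finset.mem_range.1 hj; omega) h.1 h.2 hS
    · exact absurd rfl hc

end Refutation

/-! ### Moments of the link matrix -/

section
open MeasureTheory

variable {α : Type*} [Fintype α] [DecidableEq α]

open Classical in
-- Independence in product form: expanding the right side over subsets gives the probability of each
-- subset times the value there.
theorem integral_prod_setBernoulli (p : unitInterval) (f g : α → ℝ) :
    ∫ s, ∏ e, (if e ∈ s then f e else g e) ∂setBernoulli (Set.univ : Set α) p =
      ∏ e, (p * f e + (1 - p) * g e) := by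
  rw [integral_fintype .of_finite, Fintype.prod_add,
    ← (Fintype.finsetEquivSet (α := α)).sum_comp]
  refine Finset.sum_congr rfl fun t _ => ?_
  rw [Finset.prod_mul_distrib, Finset.prod_mul_distrib, Finset.prod_const, Finset.prod_const,
    Fintype.coe_finsetEquivSet, setBernoulli_real_singleton p (Set.subset_univ _) Set.finite_univ,
    ← Set.compl_eq_univ_sdiff, ← Finset.coe_compl, Set.ncard_coe_finset, Set.ncard_coe_finset,
    ← Finset.prod_mul_prod_compl t, smul_eq_mul]
  rw [mul_mul_mul_comm]
  refine congrArg₂ (· * ·) (congrArg _ (Finset.prod_congr rfl fun e he => ?_))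
    (congrArg _ (Finset.prod_congr rfl fun e he => ?_))
  · exact if_pos (by simpa using he)
  · exact if_neg (by simpa using he)

/-- Powers of numbers in the unit interval decrease, so the bound reduces to the variance `p * (1 -
p) ≤ p`. -/
theorem abs_bernoulli_moment_le {p : ℝ} (h0 : 0 ≤ p) (h1 : p ≤ 1) {m : ℕ} (hm : 2 ≤ m) :
    |p * (1 - p) ^ m + (1 - p) * (-p) ^ m| ≤ p := by
  have h2 : 0 ≤ 1 - p := by linarith
  have h3 : (1 - p) ^ m ≤ (1 - p) ^ 2 := pow_le_pow_of_le_one h2 (by linarith) hm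
  have h4 : p ^ m ≤ p ^ 2 := pow_le_pow_of_le_one h0 h1 hm
  calc _ ≤ |p * (1 - p) ^ m| + |(1 - p) * (-p) ^ m| := abs_add_le _ _
    _ = p * (1 - p) ^ m + (1 - p) * p ^ m := by
      rw [abs_mul, abs_mul, abs_pow, abs_pow, abs_neg, abs_of_nonneg h0, abs_of_nonneg h2]
    _ ≤ p * (1 - p) ^ 2 + (1 - p) * p ^ 2 :=
      add_le_add (mul_le_mul_of_nonneg_left h3 h0) (mul_le_mul_of_nonneg_left h4 h2)
    _ ≤ p := by nlinarith

/-- A bound for the correlations of centred Bernoulli variables: `p / s` for the first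
occurrence of an index and `s` for every further one. -/
noncomputable def weight {ι : Type*} [DecidableEq ι] (p s : ℝ) : List ι → ℝ
  | [] => 1
  | i :: l => (if i ∈ l then s else p / s) * weight p s l

theorem weight_nonneg {ι : Type*} [DecidableEq ι] {p s : ℝ} (hp : 0 ≤ p) (hs : 0 < s)
    (l : List ι) : 0 ≤ weight p s l := by
  induction l with
  | nil => simp [weight]
  | cons i l ih =>
    rw [weight]
    refine mul_nonneg ?_ ih
    split_ifs <;> positivity

/-- The weight is `p ^ d * s ^ (length - 2 * d)` for `d` distinct indices, stated without negative
exponents. -/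
theorem weight_eq {ι : Type*} [DecidableEq ι] {p s : ℝ} (hs : 0 < s) (l : List ι) :
    weight p s l * (s ^ 2) ^ l.toFinset.card = p ^ l.toFinset.card * s ^ l.length := by
  induction l with
  | nil => simp [weight]
  | cons i l ih =>
    rw [weight, List.toFinset_cons, List.length_cons]
    split_ifs with h
    · rw [Finset.insert_eq_of_mem (List.mem_toFinset.2 h), mul_assoc, ih]
      ring
    · rw [Finset.card_insert_of_notMem (by simpa using h), pow_succ p, pow_succ (s ^ 2),
        pow_succ s l.length,
        show p / s * weight p s l * ((s ^ 2) ^ l.toFinset.card * s ^ 2) =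
          p * s * (weight p s l * (s ^ 2) ^ l.toFinset.card) by field_simp, ih]
      ring

/-- If every index is repeated, the length is at least twice the number of distinct indices, so the
remaining power of `s ≥ 1` is harmless. -/
theorem pow_card_le_weight {ι : Type*} [DecidableEq ι] {p s : ℝ} (hp : 0 ≤ p) (hs : 1 ≤ s)
    {l : List ι} (h : ∀ i ∈ l, 2 ≤ l.count i) : p ^ l.toFinset.card ≤ weight p s l := by
  have h1 : 2 * l.toFinset.card ≤ l.length := by
    rw [← List.sum_toFinset_count_eq_length, mul_comm, ← smul_eq_mul, ← Finset.sum_const]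
    exact Finset.sum_le_sum fun i hi => h i (List.mem_toFinset.1 hi)
  refine le_of_mul_le_mul_right ?_ (show 0 < (s ^ 2) ^ l.toFinset.card by positivity)
  rw [weight_eq (by linarith), ← pow_mul]
  exact mul_le_mul_of_nonneg_left (pow_le_pow_right₀ hs h1) (by positivity)

theorem weight_map {ι κ : Type*} [DecidableEq ι] [DecidableEq κ] {p s : ℝ} {f : ι → κ}
    {l : List ι} (hf : Set.InjOn f {i | i ∈ l}) : weight p s (l.map f) = weight p s l := by
  induction l with
  | nil => rfl
  | cons i l ih =>
    rw [List.map_cons, weight, weight, ih (hf.mono fun j hj => List.mem_cons_of_mem _ hj)]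
    congr 2
    rw [List.mem_map, eq_iff_iff]
    constructor
    · rintro ⟨j, hj, hji⟩
      rwa [← hf (List.mem_cons_of_mem _ hj) List.mem_cons_self hji]
    · exact fun h => ⟨i, h, rfl⟩

open Classical in
-- Unless every index of the list is repeated, the correlation vanishes. Otherwise each distinct
-- index contributes at most `p`, which the weight dominates. Unlike the true correlation, the
-- weight can be built up one index at a time.
theorem abs_integral_prod_le_weight (p : unitInterval) {s : ℝ} (hs : 1 ≤ s) (l : List α) :
    |∫ H, (l.map fun e => (if e ∈ H then 1 else 0) - (p : ℝ)).prod
      ∂setBernoulli (Set.univ : Set α) p| ≤ weight p s l := by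
  have hp := p.2.1
  have h1 : ∀ H : Set α, (l.map fun e => (if e ∈ H then 1 else 0) - (p : ℝ)).prod =
      ∏ e, if e ∈ H then (1 - (p : ℝ)) ^ l.count e else (-(p : ℝ)) ^ l.count e := by
    intro H
    rw [Finset.prod_list_map_count]
    refine (Finset.prod_subset (Finset.subset_univ _) fun e _ he => ?_).trans
      (Finset.prod_congr rfl fun e _ => ?_)
    · rw [List.count_eq_zero_of_not_mem (by simpa using he), pow_zero]
    · split_ifs <;> simp
  simp_rw [h1]
  rw [integral_prod_setBernoulli]
  by_cases h : ∀ e ∈ l, 2 ≤ l.count e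
  · refine le_trans ?_ (pow_card_le_weight hp hs h)
    rw [Finset.abs_prod, ← Finset.prod_const, ← Finset.prod_subset (Finset.subset_univ l.toFinset)]
    · exact Finset.prod_le_prod (fun _ _ => abs_nonneg _) fun e he =>
        abs_bernoulli_moment_le hp p.2.2 (h e (List.mem_toFinset.1 he))
    · intro e _ he
      rw [List.count_eq_zero_of_not_mem (by simpa using he)]
      simp
  · push Not at h
    obtain ⟨e, he, hc⟩ := h
    -- An index that occurs once contributes the mean of a centred variable, which is zero.
    have hc1 : l.count e = 1 := by have := List.count_pos_iff.2 he; omega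
    rw [Finset.prod_eq_zero (Finset.mem_univ e) (by rw [hc1]; ring), abs_zero]
    exact weight_nonneg hp (by linarith) l

end

/-! ### Correlation bounds for powers of the Gram matrix -/

namespace Refutation

open Matrix

section
variable {p s : ℝ} {nc N : ℕ}

theorem sum_card_filter_mem_le (h : List ℕ) {φ : ℕ → ℕ → ℕ}
    (hφ : Set.InjOn φ.uncurry (Finset.range nc ×ˢ Finset.range N : Finset (ℕ × ℕ))) :
    ∑ v ∈ Finset.range nc, ((Finset.range N).filter fun y => φ v y ∈ h).card ≤ h.length := by
  refine le_trans ?_ h.toFinset_card_le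
  calc _ = ((Finset.range nc ×ˢ Finset.range N).filter fun z => φ.uncurry z ∈ h).card := by
        rw [Finset.card_filter, Finset.sum_product]
        simp only [Finset.card_filter, Function.uncurry]
        rfl
    _ ≤ _ := Finset.card_le_card_of_injOn φ.uncurry
        (fun z hz => by simpa using (Finset.mem_filter.1 hz).2)
        (hφ.mono (Finset.coe_subset.2 (Finset.filter_subset _ _)))

/-- By injectivity at most `L` pairs `(v, y)`, and at most `L` pairs `(v, y')`, give an index that
is already in `h`. The three summands account for both indices old, exactly one old, and both new.
-/
theorem sum_weight_factor_le (hp : 0 ≤ p) (hs : 0 < s) {h : List ℕ} {L : ℕ} (hL : h.length ≤ L)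
    {φ ψ : ℕ → ℕ → ℕ}
    (hφ : Set.InjOn φ.uncurry (Finset.range nc ×ˢ Finset.range N : Finset (ℕ × ℕ)))
    (hψ : Set.InjOn ψ.uncurry (Finset.range nc ×ˢ Finset.range N : Finset (ℕ × ℕ))) :
    ∑ v ∈ Finset.range nc, ∑ y ∈ Finset.range N, ∑ y' ∈ Finset.range N,
      (if φ v y ∈ h then s else p / s) * (if ψ v y' ∈ h then s else p / s) ≤
      s ^ 2 * L ^ 2 + 2 * (p * N * L) + nc * (N * p / s) ^ 2 := by
  have key : ∀ {φ : ℕ → ℕ → ℕ} (v : ℕ), ∑ y ∈ Finset.range N, (if φ v y ∈ h then s else p / s) ≤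
      s * ((Finset.range N).filter fun y => φ v y ∈ h).card + N * p / s := by
    intro φ v
    calc _ ≤ ∑ y ∈ Finset.range N, ((if φ v y ∈ h then s else 0) + p / s) :=
          Finset.sum_le_sum fun y _ => by
            have : 0 ≤ p / s := by positivity
            split_ifs <;> linarith
      _ = _ := by
        rw [Finset.sum_add_distrib, ← Finset.sum_filter]
        simp
        ring
  set c : ℕ → ℝ := fun v => ((Finset.range N).filter fun y => φ v y ∈ h).card
  set d : ℕ → ℝ := fun v => ((Finset.range N).filter fun y => ψ v y ∈ h).card
  have hc0 : ∀ v, 0 ≤ c v := fun v => Nat.cast_nonneg _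
  have hd0 : ∀ v, 0 ≤ d v := fun v => Nat.cast_nonneg _
  have hc : ∑ v ∈ Finset.range nc, c v ≤ L := by
    rw [← Nat.cast_sum]; exact_mod_cast (sum_card_filter_mem_le h hφ).trans hL
  have hd : ∑ v ∈ Finset.range nc, d v ≤ L := by
    rw [← Nat.cast_sum]; exact_mod_cast (sum_card_filter_mem_le h hψ).trans hL
  have hcd : ∑ v ∈ Finset.range nc, c v * d v ≤ L * L := by
    calc _ ≤ ∑ v ∈ Finset.range nc, c v * L := Finset.sum_le_sum fun v hv =>
          mul_le_mul_of_nonneg_left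
            ((Finset.single_le_sum (fun i _ => hd0 i) hv).trans hd) (hc0 v)
      _ = (∑ v ∈ Finset.range nc, c v) * L := by rw [Finset.sum_mul]
      _ ≤ _ := mul_le_mul_of_nonneg_right hc (by positivity)
  calc _ ≤ ∑ v ∈ Finset.range nc, (s * c v + N * p / s) * (s * d v + N * p / s) :=
        Finset.sum_le_sum fun v _ => by
          rw [← Finset.sum_mul_sum]
          refine mul_le_mul (key v) (key v) (Finset.sum_nonneg fun y _ => ?_) ?_
          · split_ifs <;> positivity
          · have := hc0 v
            positivity
    _ = s ^ 2 * ∑ v ∈ Finset.range nc, c v * d v + p * N * ∑ v ∈ Finset.range nc, c v +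
          p * N * ∑ v ∈ Finset.range nc, d v + nc * (N * p / s) ^ 2 := by
        have e : ∀ v, (s * c v + N * p / s) * (s * d v + N * p / s) =
            s ^ 2 * (c v * d v) + p * N * c v + p * N * d v + (N * p / s) ^ 2 := fun v => by
          field_simp; ring
        simp only [e, Finset.sum_add_distrib, Finset.mul_sum]
        simp
    _ ≤ s ^ 2 * (L * L) + p * N * L + p * N * L + nc * (N * p / s) ^ 2 := by gcongr
    _ = _ := by ring

theorem injOn_tupleIndex_left (x : ℕ) (hx : x < N) :
    Set.InjOn (Function.uncurry fun v y => tupleIndex nc N v x y)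
      (Finset.range nc ×ˢ Finset.range N : Finset (ℕ × ℕ)) := by
  rintro ⟨v, y⟩ h ⟨v', y'⟩ h' heq
  simp only [Finset.coe_product, Finset.coe_range, Set.mem_prod, Set.mem_Iio] at h h'
  simp only [Function.uncurry, tupleIndex] at heq
  have e : v + nc * (x + N * y) = v' + nc * (x + N * y') := by linarith
  have h1 : v = v' := by
    have := congrArg (· % nc) e
    simpa only [Nat.add_mul_mod_self_left, Nat.mod_eq_of_lt h.1, Nat.mod_eq_of_lt h'.1] using this
  subst h1
  have h2 := Nat.eq_of_mul_eq_mul_left ((Nat.zero_le _).trans_lt h.1) (Nat.add_left_cancel e)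
  rw [Nat.eq_of_mul_eq_mul_left ((Nat.zero_le _).trans_lt hx) (Nat.add_left_cancel h2)]

theorem injOn_tupleIndex_right (y : ℕ) :
    Set.InjOn (Function.uncurry fun v x => tupleIndex nc N v x y)
      (Finset.range nc ×ˢ Finset.range N : Finset (ℕ × ℕ)) := by
  rintro ⟨v, x⟩ h ⟨v', x'⟩ h' heq
  simp only [Finset.coe_product, Finset.coe_range, Set.mem_prod, Set.mem_Iio] at h h'
  simp only [Function.uncurry, tupleIndex] at heq
  have e : v + nc * (x + N * y) = v' + nc * (x' + N * y) := by linarith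
  have h1 : v = v' := by
    have := congrArg (· % nc) e
    simpa only [Nat.add_mul_mod_self_left, Nat.mod_eq_of_lt h.1, Nat.mod_eq_of_lt h'.1] using this
  subst h1
  have h2 := Nat.eq_of_mul_eq_mul_left ((Nat.zero_le _).trans_lt h.1) (Nat.add_left_cancel e)
  rw [Nat.add_right_cancel h2]

end

section
variable {Ω : Type*} {E : (Ω → ℝ) →ₗ[ℝ] ℝ} {a : ℕ → Ω → ℝ} {p s : ℝ} {nc N L : ℕ} {B : ℝ}

/-- If correlations of `x` with products of length at most `M + 2` are bounded, then so are those
of the image of `x` under a matrix of sums of products of two variables with products of length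
at most `M`. -/
theorem abs_sum_mul_le {d M : ℕ} (hp : 0 ≤ p) (hs : 0 < s) {x : Fin d → Ω → ℝ} {c : ℝ}
    (hc : 0 ≤ c)
    (hx : ∀ h : List ℕ, h.length ≤ M + 2 → ∀ w,
      |E fun ω => (h.map (a · ω)).prod * x w ω| ≤ weight p s h * c)
    {e e' : ℕ → Fin d → ℕ} {h : List ℕ} (hh : h.length ≤ M)
    (hB : ∑ w, ∑ v ∈ Finset.range nc, (if e v w ∈ h then s else p / s) *
      (if e' v w ∈ h then s else p / s) ≤ B) :
    |E fun ω => (h.map (a · ω)).prod * ∑ w, (∑ v ∈ Finset.range nc,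
      a (e v w) ω * a (e' v w) ω * if e v w ≠ e' v w then 1 else 0) * x w ω| ≤
      weight p s h * (B * c) := by
  have e1 : (fun ω => (h.map (a · ω)).prod * ∑ w, (∑ v ∈ Finset.range nc,
      a (e v w) ω * a (e' v w) ω * if e v w ≠ e' v w then 1 else 0) * x w ω) =
      ∑ w, ∑ v ∈ Finset.range nc, (if e v w ≠ e' v w then (1 : ℝ) else 0) •
        fun ω => ((e v w :: e' v w :: h).map (a · ω)).prod * x w ω := by
    funext ω
    simp only [Finset.sum_apply, Pi.smul_apply, smul_eq_mul, List.map_cons, List.prod_cons,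
      Finset.mul_sum, Finset.sum_mul]
    exact Finset.sum_congr rfl fun w _ => Finset.sum_congr rfl fun v _ => by ring
  rw [e1, map_sum]
  calc _ ≤ ∑ w, ∑ v ∈ Finset.range nc, (if e v w ∈ h then s else p / s) *
        (if e' v w ∈ h then s else p / s) * (weight p s h * c) := by
        refine (Finset.abs_sum_le_sum_abs _ _).trans (Finset.sum_le_sum fun w _ => ?_)
        rw [map_sum]
        refine (Finset.abs_sum_le_sum_abs _ _).trans (Finset.sum_le_sum fun v _ => ?_)
        have hw := weight_nonneg hp hs h
        rw [map_smul, smul_eq_mul]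
        by_cases h1 : e v w = e' v w
        · rw [if_neg (not_not.2 h1), zero_mul, abs_zero]
          have hf : ∀ i, 0 ≤ if i ∈ h then s else p / s := fun i => by split_ifs <;> positivity
          exact mul_nonneg (mul_nonneg (hf _) (hf _)) (mul_nonneg hw hc)
        · rw [if_pos h1, one_mul]
          refine (hx _ (by simpa using hh) w).trans (le_of_eq ?_)
          -- As the two new indices differ, whether either counts as a repetition depends on `h`
          -- alone and the weight factorises. The link matrix omits equal indices for this reason.
          simp only [weight, List.mem_cons, h1, false_or]
          ring
    _ = (∑ w, ∑ v ∈ Finset.range nc, (if e v w ∈ h then s else p / s) *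
        (if e' v w ∈ h then s else p / s)) * (weight p s h * c) := by
        simp only [Finset.sum_mul]
    _ ≤ B * (weight p s h * c) :=
        mul_le_mul_of_nonneg_right hB (mul_nonneg (weight_nonneg hp hs h) hc)
    _ = _ := by ring

/-- Carrying a prefix `h` in the statement makes induction on the power possible. Each factor `Y` or
`Yᵀ` moves two variables into the prefix and costs a factor `B`, so one factor `Y Yᵀ` uses up four
places of the length bound `L`. -/
theorem abs_gram_pow_le (hp : 0 ≤ p) (hs : 0 < s)
    (hE : ∀ l : List ℕ, |E fun ω => (l.map (a · ω)).prod| ≤ weight p s l)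
    (hB : s ^ 2 * L ^ 2 + 2 * (p * N * L) + nc * (N * p / s) ^ 2 ≤ B) (m : ℕ) (h : List ℕ)
    (hh : h.length + 4 * m ≤ L) (u w : Fin (N * N)) :
    |E fun ω => (h.map (a · ω)).prod * ((linkMatrix nc N (a · ω) *
      (linkMatrix nc N (a · ω))ᵀ) ^ m) u w| ≤ weight p s h * B ^ (2 * m) := by
  have hB0 : 0 ≤ B := le_trans (by positivity) hB
  induction m generalizing h u with
  | zero =>
    rcases eq_or_ne u w with rfl | huw
    · simpa using hE h
    · simpa [one_apply_ne huw, show (fun _ : Ω => (0 : ℝ)) = 0 from rfl] using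
        weight_nonneg hp hs h
  | succ m ih =>
    have hN : 0 < N := Nat.pos_of_ne_zero (by rintro rfl; exact absurd u.2 (by simp))
    have hmod : ∀ t : ℕ, t % N < N := fun t => Nat.mod_lt _ hN
    have hdiv : ∀ t : Fin (N * N), (t / N : ℕ) < N := fun t => Nat.div_lt_of_lt_mul t.2
    -- The factor `Yᵀ` alone, with rows and columns exchanged. Prefixes must be allowed two entries
    -- more than afterwards, since `Y` is still to be applied; none of the subtractions truncates,
    -- as `4 * (m + 1) ≤ L`.
    have hT : ∀ g : List ℕ, g.length ≤ L - 4 * m - 2 → ∀ t : Fin (N * N),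
        |E fun ω => (g.map (a · ω)).prod * ((linkMatrix nc N (a · ω))ᵀ *
          (linkMatrix nc N (a · ω) * (linkMatrix nc N (a · ω))ᵀ) ^ m) t w| ≤
          weight p s g * (B * B ^ (2 * m)) := by
      intro g hg t
      refine abs_sum_mul_le (M := L - 4 * m - 2) hp hs (by positivity)
        (x := fun t ω => ((linkMatrix nc N (a · ω) * (linkMatrix nc N (a · ω))ᵀ) ^ m) t w)
        (fun g' hg' w' => ih g' (by omega) w')
        (e := fun v r => tupleIndex nc N v (r / N) (t / N))
        (e' := fun v r => tupleIndex nc N v (r % N) (t % N)) hg ?_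
      refine le_trans (le_of_eq ?_) ((sum_weight_factor_le hp hs (show g.length ≤ L by omega)
        (injOn_tupleIndex_right (t / N)) (injOn_tupleIndex_right (t % N))).trans hB)
      rw [Finset.sum_comm]
      exact Finset.sum_congr rfl fun v _ => sum_divMod N fun x x' =>
        (if tupleIndex nc N v x (t / N) ∈ g then s else p / s) *
        (if tupleIndex nc N v x' (t % N) ∈ g then s else p / s)
    have hstep := abs_sum_mul_le (M := L - 4 * m - 4) hp hs (show 0 ≤ B * B ^ (2 * m) by positivity)
        (fun g hg t => hT g (by omega) t)
        (e := fun v r => tupleIndex nc N v (u / N) (r / N))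
        (e' := fun v r => tupleIndex nc N v (u % N) (r % N)) (h := h) (B := B) (nc := nc)
        (by omega) (by
      refine le_trans (le_of_eq ?_) ((sum_weight_factor_le hp hs (show h.length ≤ L by omega)
        (injOn_tupleIndex_left (u / N) (hdiv u)) (injOn_tupleIndex_left (u % N) (hmod u))).trans hB)
      rw [Finset.sum_comm]
      exact Finset.sum_congr rfl fun v _ => sum_divMod N fun x x' =>
        (if tupleIndex nc N v (u / N) x ∈ h then s else p / s) *
        (if tupleIndex nc N v (u % N) x' ∈ h then s else p / s))
    simp only [pow_succ', mul_assoc]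
    rw [show B ^ (2 * (m + 1)) = B * (B * B ^ (2 * m)) by ring]
    exact hstep

end

end Refutation

/-! ### Moments of the norm for the random hypergraph -/

namespace Refutation

open Matrix

/-- The sum of squares is the trace of the power `2 * (m + 1)` of the Gram matrix. Each diagonal
entry is bounded with empty prefix, and four variables per factor give the length `8 * (m + 1)`. -/
theorem sumSq_gram_pow_le {Ω : Type*} {E : (Ω → ℝ) →ₗ[ℝ] ℝ} {a : ℕ → Ω → ℝ} {p s : ℝ}
    {nc N m : ℕ} {B : ℝ} (hp : 0 ≤ p) (hs : 0 < s)
    (hE : ∀ l : List ℕ, |E fun ω => (l.map (a · ω)).prod| ≤ weight p s l)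
    (hB : s ^ 2 * (8 * (m + 1)) ^ 2 + 2 * (p * N * (8 * (m + 1))) + nc * (N * p / s) ^ 2 ≤ B) :
    E (fun ω => ((linkMatrix nc N (a · ω) * (linkMatrix nc N (a · ω))ᵀ) ^ (m + 1)).sumSq) ≤
      N * N * B ^ (4 * (m + 1)) := by
  have e1 : (fun ω => ((linkMatrix nc N (a · ω) * (linkMatrix nc N (a · ω))ᵀ) ^ (m + 1)).sumSq) =
      ∑ u, fun ω => (([] : List ℕ).map (a · ω)).prod *
        ((linkMatrix nc N (a · ω) * (linkMatrix nc N (a · ω))ᵀ) ^ (2 * (m + 1))) u u := by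
    funext ω
    rw [sumSq_eq_trace, transpose_pow, transpose_mul, transpose_transpose, ← pow_add, ← two_mul]
    simp [trace]
  rw [e1, map_sum]
  calc _ ≤ ∑ _u : Fin (N * N), B ^ (4 * (m + 1)) := Finset.sum_le_sum fun u _ => by
        refine (le_abs_self _).trans ((abs_gram_pow_le (L := 8 * (m + 1)) hp hs hE (by
          push_cast; exact hB) (2 * (m + 1)) [] (by simp; omega) u u).trans (le_of_eq ?_))
        rw [weight, one_mul]
        congr 1
        ring
    _ = _ := by simp

/-- The table entries of hyperedges listed in increasing order, centred by their mean. -/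
def deviation (k n : ℕ) (p : ℝ) (b : ℕ → ℕ) (i : ℕ) : ℝ :=
  if i < n ^ k ∧ DigitsIncreasing n (k - 1) i then b i - p else 0

section
variable {k n : ℕ}

theorem strictMono_digits (i : Fin (n ^ k)) (hi : DigitsIncreasing n (k - 1) i) :
    StrictMono (finFunctionFinEquiv.symm i) := by
  rcases k with _ | k
  · exact Subsingleton.strictMono _
  · exact Fin.strictMono_iff_lt_succ.2 fun t => hi t t.2

/-- The set of vertices listed by an index. -/
def edgeOf (i : {i : Fin (n ^ k) // DigitsIncreasing n (k - 1) i}) :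
    {e : Finset (Fin n) // e.card = k} :=
  ⟨Finset.univ.image (finFunctionFinEquiv.symm i.1), by
    rw [Finset.card_image_of_injective _ (strictMono_digits i.1 i.2).injective, Finset.card_fin]⟩

theorem indexOf_edgeOf (i : {i : Fin (n ^ k) // DigitsIncreasing n (k - 1) i}) :
    indexOf (edgeOf i).1 (edgeOf i).2 = i.1 := by
  rw [indexOf, ← Equiv.eq_symm_apply]
  refine (Finset.orderEmbOfFin_unique (edgeOf i).2 (fun t => ?_) (strictMono_digits i.1 i.2)).symm
  exact Finset.mem_image_of_mem _ (Finset.mem_univ t)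

theorem edgeOf_injective : Function.Injective (edgeOf (k := k) (n := n)) := fun i i' h => by
  refine Subtype.ext ?_
  rw [← indexOf_edgeOf i, ← indexOf_edgeOf i', h]

open Classical in
theorem input_mem_edgeOf (H : UniformHypergraph n k) (ξ : ℕ)
    (i : {i : Fin (n ^ k) // DigitsIncreasing n (k - 1) i}) :
    (H.input ξ).mem i.1 = if edgeOf i ∈ H then 1 else 0 := by
  have h1 : (H.input ξ).mem i.1 = 1 ↔ edgeOf i ∈ H := by
    rw [input_mem_eq_one_iff]
    constructor
    · rintro ⟨h, e, he, hei⟩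
      rwa [show edgeOf i = e from Subtype.ext hei.symm]
    · exact fun h => ⟨i.1.2, edgeOf i, h, rfl⟩
  have h2 := input_mem_le H ξ i.1
  split_ifs with h
  · exact h1.2 h
  · have := mt h1.1 h
    omega

/-- Distinct increasing indices stand for distinct hyperedges, so that the correlation bound for
independent variables carries over with the same weight. -/
theorem integral_prod_deviation_le (p : unitInterval) {s : ℝ} (hs : 1 ≤ s) (ξ : ℕ) (l : List ℕ) :
    |∫ H, (l.map fun i => deviation k n p (H.input ξ).mem i).prod
      ∂UniformHypergraph.random n k p| ≤ weight (p : ℝ) s l := by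
  classical
  -- Indices outside the table or not increasing have deviation zero; a single one annihilates the
  -- product.
  by_cases h : ∀ i ∈ l, i < n ^ k ∧ DigitsIncreasing n (k - 1) i
  · obtain ⟨l, rfl⟩ : ∃ l' : List {i : Fin (n ^ k) // DigitsIncreasing n (k - 1) i},
        l'.map (fun i => (i.1 : ℕ)) = l :=
      ⟨l.pmap (fun i hi => ⟨⟨i, hi.1⟩, hi.2⟩) h, by simp [List.map_pmap]⟩
    rw [weight_map (fun i _ i' _ hii => Subtype.ext (Fin.ext hii)),
      ← weight_map (edgeOf_injective.injOn)]
    refine le_trans (le_of_eq ?_) (abs_integral_prod_le_weight p hs _)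
    congr 2
    funext H
    rw [List.map_map, List.map_map]
    congr 2
    funext i
    simp only [Function.comp, deviation, if_pos (And.intro i.1.2 i.2), input_mem_edgeOf]
    push_cast
    rfl
  · push Not at h
    obtain ⟨i, hi, hi'⟩ := h
    have h0 : ∀ H : UniformHypergraph n k,
        (l.map fun i => deviation k n p (H.input ξ).mem i).prod = 0 := fun H =>
      List.prod_eq_zero (List.mem_map.2 ⟨i, hi, if_neg fun h => hi' h.1 h.2⟩)
    simp only [h0, MeasureTheory.integral_zero, abs_zero]
    exact weight_nonneg p.2.1 (by linarith) l

open MeasureTheory in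
/-- The expectation over the random hypergraph, as a linear functional. -/
noncomputable def expectation (n k : ℕ) (p : unitInterval) :
    (UniformHypergraph n k → ℝ) →ₗ[ℝ] ℝ where
  toFun f := ∫ H, f H ∂setBernoulli Set.univ p
  map_add' _ _ := integral_add .of_finite .of_finite
  map_smul' r f := integral_const_mul r f

open scoped Matrix.Norms.L2Operator in
/-- A moment bound for the operator norm of the link matrix of a random hypergraph. -/
theorem integral_norm_pow_le {nc N m : ℕ} (p : unitInterval) (ξ : ℕ) (hnc : 1 ≤ nc)
    (hm : 8 * (m + 1) ≤ (p : ℝ) * N * √nc) :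
    ∫ H, ‖linkMatrix nc N (deviation k n p (H.input ξ).mem)‖ ^ (4 * (m + 1))
      ∂UniformHypergraph.random n k p ≤
      N * N * (32 * (m + 1) * (p * N * √nc)) ^ (4 * (m + 1)) := by
  have hp := p.2.1
  set P := (p : ℝ) * N * √nc with hP
  set M : ℝ := 8 * (m + 1) with hM
  have hM0 : 0 < M := by positivity
  -- The free parameter is `s = √(P / M)`. It balances the extreme terms: `s² M²` and `nc * (N p /
  -- s)²` both become `M P`, and the middle term is at most `2 M P`.
  have hs : 1 ≤ P / M := (one_le_div hM0).2 hm
  have hs0 : 0 < P / M := by linarith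
  have hnc1 : 1 ≤ √(nc : ℝ) := Real.one_le_sqrt.2 (by exact_mod_cast hnc)
  have hsq : √(P / M) ^ 2 = P / M := Real.sq_sqrt hs0.le
  have hB : √(P / M) ^ 2 * M ^ 2 + 2 * (p * N * M) + nc * (N * p / √(P / M)) ^ 2 ≤
      32 * (m + 1) * P := by
    have h1 : (nc : ℝ) * (N * p) ^ 2 = P ^ 2 := by
      rw [hP, mul_pow (_ * _), Real.sq_sqrt (by positivity)]; ring
    have hP0 : 0 < P := by linarith
    have h2 : (nc : ℝ) * (N * p / √(P / M)) ^ 2 = M * P := by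
      rw [div_pow, hsq, ← mul_div_assoc, h1]; field_simp
    have h3 : (p : ℝ) * N * M ≤ P * M :=
      mul_le_mul_of_nonneg_right (le_mul_of_one_le_right (by positivity) hnc1) hM0.le
    have h4 : P / M * M ^ 2 = M * P := by field_simp
    rw [h2, hsq, h4, show 32 * ((m : ℝ) + 1) * P = 4 * (M * P) by rw [hM]; ring]
    linarith
  refine le_trans ?_ (sumSq_gram_pow_le (E := expectation n k p)
    (a := fun i H => deviation k n p (H.input ξ).mem i) hp (by positivity)
    (fun l => integral_prod_deviation_le p (Real.one_le_sqrt.2 hs) ξ l) hB)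
  exact MeasureTheory.integral_mono (MeasureTheory.Integrable.of_finite (μ := setBernoulli _ p))
    (MeasureTheory.Integrable.of_finite (μ := setBernoulli _ p)) fun H => opNorm_pow_le_sumSq _ m

end

end Refutation

/-! ### Deterministic conditions for acceptance -/

namespace Refutation

open Matrix

open scoped Matrix.Norms.L2Operator

theorem abs_centred_sub_deviation_le {k n : ℕ} {p : ℝ} (hp : 0 ≤ p) (b : ℕ → ℕ) {i : ℕ}
    (hi : i < n ^ k) :
    |(centred k n ⌊p * (n : ℝ) ^ k⌋₊ b i : ℝ) - (n : ℝ) ^ k * deviation k n p b i| ≤ 1 := by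
  have h0 : 0 ≤ p * (n : ℝ) ^ k := by positivity
  have h1 := Nat.floor_le h0
  have h2 := Nat.lt_floor_add_one (p * (n : ℝ) ^ k)
  unfold centred deviation
  by_cases h : DigitsIncreasing n (k - 1) i
  · rw [if_pos h, if_pos ⟨hi, h⟩]
    push_cast
    rw [abs_le]
    constructor <;> linarith
  · rw [if_neg h, if_neg fun h' => h h'.2]
    simp

theorem abs_deviation_le {k n : ℕ} {p : ℝ} (h0 : 0 ≤ p) (h1 : p ≤ 1) {b : ℕ → ℕ}
    (hb : ∀ x, b x ≤ 1) (i : ℕ) : |deviation k n p b i| ≤ 1 := by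
  have h2 : (b i : ℝ) ≤ 1 := by exact_mod_cast hb i
  have h3 : (0 : ℝ) ≤ b i := Nat.cast_nonneg _
  unfold deviation
  split_ifs
  · rw [abs_le]
    constructor <;> linarith
  · simp

/-- Replacing the factors of each product one after the other gives an entrywise bound, and the
Frobenius norm turns it into a bound for the operator norm. -/
theorem norm_linkMatrix_sub_le {nc N : ℕ} {a a' : ℕ → ℝ} {A δ : ℝ} (hA : ∀ i, |a i| ≤ A)
    (hA' : ∀ i, |a' i| ≤ A) (hδ : ∀ i < nc * (N * N), |a i - a' i| ≤ δ) :
    ‖linkMatrix nc N a - linkMatrix nc N a'‖ ≤ nc * (N * N) * (2 * A * δ) := by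
  rcases Nat.eq_zero_or_pos (nc * (N * N)) with h0 | h0
  · have h1 : ∀ u w, |(linkMatrix nc N a - linkMatrix nc N a') u w| ≤ 0 := by
      intro u w
      rcases Nat.mul_eq_zero.1 h0 with h | h
      · subst h; simp [linkMatrix]
      · exact absurd u.2 (by omega)
    have h2 := (opNorm_sq_le_sumSq _).trans (sumSq_le_of_abs_le h1)
    rw [show (nc : ℝ) * (N * N) = 0 by exact_mod_cast h0, zero_mul]
    nlinarith
  have hA0 : 0 ≤ A := (abs_nonneg _).trans (hA 0)
  have hδ0 : 0 ≤ δ := (abs_nonneg _).trans (hδ 0 h0)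
  have h1 : ∀ u w, |(linkMatrix nc N a - linkMatrix nc N a') u w| ≤ nc * (2 * A * δ) := by
    intro u w
    have hN : 0 < N := Nat.pos_of_ne_zero (by rintro rfl; simp at h0)
    rw [Matrix.sub_apply, linkMatrix, linkMatrix, of_apply, of_apply, ← Finset.sum_sub_distrib]
    calc _ ≤ ∑ v ∈ Finset.range nc, 2 * A * δ := by
          refine (Finset.abs_sum_le_sum_abs _ _).trans (Finset.sum_le_sum fun v hv => ?_)
          have hi := hδ _ (tupleIndex_lt (Finset.mem_range.1 hv) (Nat.div_lt_of_lt_mul u.2)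
            (Nat.div_lt_of_lt_mul w.2))
          have hi' := hδ _ (tupleIndex_lt (Finset.mem_range.1 hv) (Nat.mod_lt u hN)
            (Nat.mod_lt w hN))
          set i := tupleIndex nc N v (u / N) (w / N)
          set i' := tupleIndex nc N v (u % N) (w % N)
          rw [← sub_mul, abs_mul]
          refine (mul_le_of_le_one_right (abs_nonneg _) (by split_ifs <;> simp)).trans ?_
          rw [show a i * a i' - a' i * a' i' = a i * (a i' - a' i') + (a i - a' i) * a' i' by ring]
          refine (abs_add_le _ _).trans ?_
          rw [abs_mul, abs_mul, show 2 * A * δ = A * δ + δ * A by ring]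
          exact add_le_add (mul_le_mul (hA _) hi' (abs_nonneg _) hA0)
            (mul_le_mul hi (hA' _) (abs_nonneg _) hδ0)
      _ = _ := by simp
  have h2 := (opNorm_sq_le_sumSq _).trans (sumSq_le_of_abs_le h1)
  have h3 := abs_le_of_sq_le_sq h2 (by positivity)
  rw [abs_of_nonneg (norm_nonneg _)] at h3
  refine h3.trans (le_of_eq ?_)
  push_cast
  ring

theorem linkMatrix_smul {nc N : ℕ} (r : ℝ) (a : ℕ → ℝ) :
    linkMatrix nc N (fun i => r * a i) = r ^ 2 • linkMatrix nc N a := by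
  ext u w
  simp only [linkMatrix, of_apply, Matrix.smul_apply, smul_eq_mul, Finset.mul_sum]
  exact Finset.sum_congr rfl fun v _ => by ring

/-- Rounding `p K` down, where `K = n ^ k`, changes each scaled entry by at most 1. The matrix then
changes by at most `K * (2 * K)` in norm, which is the summand 2 after division by `K ^ 2`. -/
theorem norm_linkMatrix_centred_le {k n nc N : ℕ} (hcard : n ^ k = nc * (N * N)) {p : ℝ}
    (h0 : 0 ≤ p) (h1 : p ≤ 1) {b : ℕ → ℕ} (hb : ∀ x, b x ≤ 1) :
    ‖linkMatrix nc N fun i => (centred k n ⌊p * (n : ℝ) ^ k⌋₊ b i : ℝ)‖ ≤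
      ((n : ℝ) ^ k) ^ 2 * (‖linkMatrix nc N (deviation k n p b)‖ + 2) := by
  set K := (n : ℝ) ^ k with hK
  have hK0 : 0 ≤ K := by positivity
  have hcardR : (nc : ℝ) * (N * N) = K := by rw [hK]; exact_mod_cast hcard.symm
  have hj : ⌊p * K⌋₊ ≤ n ^ k := by
    refine Nat.floor_le_of_le ?_
    push_cast
    exact mul_le_of_le_one_left hK0 h1
  have h2 := norm_linkMatrix_sub_le (nc := nc) (N := N) (δ := 1) (abs_centred_le hb hj)
    (a' := fun i => K * deviation k n p b i) (fun i => by
      rw [abs_mul, abs_of_nonneg hK0]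
      exact mul_le_of_le_one_right hK0 (abs_deviation_le h0 h1 hb i))
    (fun i hi => abs_centred_sub_deviation_le h0 b (by omega))
  rw [hcardR, linkMatrix_smul] at h2
  have h3 := norm_le_norm_add_norm_sub' (linkMatrix nc N fun i => (centred k n ⌊p * K⌋₊ b i : ℝ))
    (K ^ 2 • linkMatrix nc N (deviation k n p b))
  rw [norm_smul, Real.norm_eq_abs, abs_of_nonneg (by positivity)] at h3
  linarith

/-- Here `2 * c ≤ k` gives `nc ≤ √K` with `K = n ^ k`. The left side of the test is then at most `4
G t √K (p K) K²`, against at least `(p K)² K² / 4` on the right. -/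
theorem diagonalSmall_of_bounds {k n c q j : ℕ} (hn : 1 ≤ n) (hc : 2 * c ≤ k) {b : ℕ → ℕ}
    {G t p : ℝ} (hfac : (factor k q : ℝ) = 2 * G) (hG : 1 ≤ G) (ht : 1 ≤ t) (h1 : p ≤ 1)
    (hpK : 2 ≤ p * (n : ℝ) ^ k) (hj1 : (j : ℝ) ≤ p * (n : ℝ) ^ k)
    (hj2 : p * (n : ℝ) ^ k / 2 ≤ j) (hP : 16 * (G * t) < p * √((n : ℝ) ^ k))
    (hsum : (∑ x ∈ Finset.range (n ^ k), b x : ℝ) ≤ t * (p * (n : ℝ) ^ k)) :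
    DiagonalSmall k n (n ^ c) q j b := by
  unfold DiagonalSmall
  rify
  rw [hfac]
  have hn1 : (1 : ℝ) ≤ n := by exact_mod_cast hn
  have hnc : (n : ℝ) ^ c ≤ √((n : ℝ) ^ k) := by
    refine Real.le_sqrt_of_sq_le ?_
    rw [← pow_mul]
    exact pow_le_pow_right₀ hn1 (by omega)
  have hK0 : 0 < (n : ℝ) ^ k := by positivity
  set K := (n : ℝ) ^ k
  have hs0 : 0 < √K := Real.sqrt_pos.2 hK0
  have hPK : p * √K * √K = p * K := by rw [mul_assoc, Real.mul_self_sqrt hK0.le]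
  have hj3 : (p * K) ^ 2 / 4 ≤ (j : ℝ) * j := by nlinarith
  have h4 : K * K * ∑ x ∈ Finset.range (n ^ k), (b x : ℝ) + j * j * K ≤
      2 * (t * (p * K)) * K ^ 2 := by
    have h5 : K * K * ∑ x ∈ Finset.range (n ^ k), (b x : ℝ) ≤ K * K * (t * (p * K)) :=
      mul_le_mul_of_nonneg_left hsum (by positivity)
    have h6 : (j : ℝ) * j ≤ (p * K) * K :=
      mul_le_mul hj1 (hj1.trans (mul_le_of_le_one_left hK0.le h1)) (by positivity) (by linarith)
    have h7 : p * K ≤ t * (p * K) := le_mul_of_one_le_left (by linarith) ht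
    have h8 : (p * K) * (K * K) ≤ t * (p * K) * (K * K) :=
      mul_le_mul_of_nonneg_right h7 (by positivity)
    have h9 := mul_le_mul_of_nonneg_right h6 hK0.le
    linarith
  have h5 : 0 ≤ 2 * (t * (p * K)) * K ^ 2 :=
    mul_nonneg (mul_nonneg (by norm_num) (mul_nonneg (by linarith) (by linarith))) (by positivity)
  calc _ ≤ 2 * G * √K * (2 * (t * (p * K)) * K ^ 2) :=
        mul_le_mul (mul_le_mul_of_nonneg_left hnc (by linarith)) h4 (by positivity)
          (mul_nonneg (by linarith) hs0.le)
    _ = 16 * (G * t) * (√K * (p * K) * K ^ 2 / 4) := by ring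
    _ < p * √K * (√K * (p * K) * K ^ 2 / 4) := by
      have h8 : 0 < √K * (p * K) * K ^ 2 / 4 := by
        have : 0 < p * K := by linarith
        positivity
      exact mul_lt_mul_of_pos_right hP h8
    _ = (p * √K * √K) * (p * K) / 4 * (K * K) := by ring
    _ = (p * K) ^ 2 / 4 * (K * K) := by rw [hPK]; ring
    _ ≤ _ := mul_le_mul_of_nonneg_right hj3 (by positivity)

/-- The dimension is at most `n ^ k ≤ 2 ^ n`, hence at most `2 ^ (4 * (n + 1))`. After taking roots,
passing from the norm to the trace costs the factor 2 that turns `2 * G` into `4 * G`. -/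
theorem traceSmall_of_bounds {k n c l q j : ℕ} (hkc : k = c + 2 * l) (hn : 2 ≤ n)
    (hnk : n ^ k ≤ 2 ^ n) (hjK : j ≤ n ^ k) {b : ℕ → ℕ} (hb : ∀ x, b x ≤ 1) {G T : ℝ}
    (hfac : (factor k q : ℝ) = 2 * G) (hG : 1 ≤ G)
    (hY : ‖linkMatrix (n ^ c) (n ^ l) fun i => (centred k n j b i : ℝ)‖ ≤ ((n : ℝ) ^ k) ^ 2 * T)
    (hT : 4 * G * T * (n : ℝ) ^ k < j * j) :
    TraceSmall k n q j (traceValue k n (n ^ c) (n ^ l) (modulus k n) j b) := by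
  have hcard : n ^ k = n ^ c * (n ^ l * n ^ l) := by
    rw [← pow_add, ← pow_add]; congr 1; omega
  have hK0 : 0 < (n : ℝ) ^ k := by positivity
  unfold TraceSmall
  rify
  rw [traceValue_eq hn hcard hjK hb, hfac, ← pow_mul, ← pow_mul]
  set K := (n : ℝ) ^ k
  set Y := linkMatrix (n ^ c) (n ^ l) fun i => (centred k n j b i : ℝ)
  have hT0 : 0 ≤ K ^ 2 * T := (norm_nonneg _).trans hY
  have hdim : ((Fintype.card (Fin (n ^ l * n ^ l)) : ℕ) : ℝ) ≤ 2 ^ (4 * (n + 1)) := by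
    rw [Fintype.card_fin]
    have h9 : n ^ l * n ^ l ≤ 2 ^ (4 * (n + 1)) := by
      calc n ^ l * n ^ l ≤ n ^ c * (n ^ l * n ^ l) := Nat.le_mul_of_pos_left _ (by positivity)
        _ ≤ 2 ^ n := hcard ▸ hnk
        _ ≤ _ := Nat.pow_le_pow_right (by norm_num) (by omega)
    exact_mod_cast h9
  calc _ ≤ (2 * G * K) ^ (4 * (n + 1)) * (2 ^ (4 * (n + 1)) * (K ^ 2 * T) ^ (4 * (n + 1))) := by
        refine mul_le_mul_of_nonneg_left ?_ (by positivity)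
        exact (sumSq_le_card_mul_opNorm_pow Y n).trans (mul_le_mul hdim
          (pow_le_pow_left₀ (norm_nonneg _) hY _) (by positivity) (by positivity))
    _ = (4 * G * T * K * (K * K)) ^ (4 * (n + 1)) := by
        rw [← mul_pow, ← mul_pow]
        exact congrArg (· ^ _) (by ring)
    _ < (j * j * (K * K)) ^ (4 * (n + 1)) := by
        refine pow_lt_pow_left₀ (mul_lt_mul_of_pos_right hT (by positivity)) ?_ (by omega)
        calc (0 : ℝ) ≤ 4 * G * K * (K ^ 2 * T) := mul_nonneg (by positivity) hT0
          _ = _ := by ring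

/-- The successful guess is the floor of `p * n ^ k`, which is at least half of it. -/
theorem accepts_of_bounds {k n c l q : ℕ} (hk : 2 ≤ k) (hkc : k = c + 2 * l) (hc : 2 * c ≤ k)
    (hn : 2 ≤ n) (hnk : n ^ k ≤ 2 ^ n) (hq : q ≠ 0) (hqk : q * k ≤ n) {p t : ℝ} (h0 : 0 ≤ p)
    (h1 : p ≤ 1) (ht : 1 ≤ t) {b : ℕ → ℕ} (hb : ∀ x, b x ≤ 1)
    (hP : 2000 * (k + 2) * (k : ℝ) ^ (2 * k) * (q : ℝ) ^ (2 * k) * t ≤ p * √((n : ℝ) ^ k))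
    (hsum : (∑ x ∈ Finset.range (n ^ k), b x : ℝ) ≤ t * (p * (n : ℝ) ^ k))
    (hnorm : ‖linkMatrix (n ^ c) (n ^ l) (deviation k n p b)‖ ≤
      64 * (k + 2) * t * (p * √((n : ℝ) ^ k))) : Accepts k c l n q b := by
  have hcard : n ^ k = n ^ c * (n ^ l * n ^ l) := by
    rw [← pow_add, ← pow_add]; congr 1; omega
  have hnormc := norm_linkMatrix_centred_le hcard h0 h1 hb
  set K := (n : ℝ) ^ k with hK
  set P := p * √K with hPdef
  have hn1 : (1 : ℝ) ≤ n := by exact_mod_cast (by omega : 1 ≤ n)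
  have hK1 : 1 ≤ K := one_le_pow₀ hn1
  have hs1 : 1 ≤ √K := Real.one_le_sqrt.2 hK1
  have hsK : √K * √K = K := Real.mul_self_sqrt (by linarith)
  have hPK : P * √K = p * K := by rw [hPdef, mul_assoc, hsK]
  have hk1 : (2 : ℝ) ≤ k := by exact_mod_cast hk
  obtain ⟨G, hG⟩ : ∃ G : ℝ, G = (k : ℝ) ^ (2 * k) * (q : ℝ) ^ (2 * k) := ⟨_, rfl⟩
  have hq1 : (1 : ℝ) ≤ q := by exact_mod_cast Nat.one_le_iff_ne_zero.2 hq
  have hG1 : 1 ≤ G := by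
    rw [hG]
    exact one_le_mul_of_one_le_of_one_le (one_le_pow₀ (by linarith)) (one_le_pow₀ hq1)
  have hfac : (factor k q : ℝ) = 2 * G := by
    rw [factor, hG]; push_cast; rw [mul_pow]; ring
  have hP' : 2000 * ((k + 2) * (G * t)) ≤ P := by
    rw [hG]; refine le_trans (le_of_eq ?_) hP; ring
  have hGt : 1 ≤ G * t := one_le_mul_of_one_le_of_one_le hG1 ht
  have hkGt : 4 * (G * t) ≤ (k + 2) * (G * t) :=
    mul_le_mul_of_nonneg_right (by linarith) (by linarith)
  have hP1 : 2 ≤ P := by linarith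
  have hpK : 2 ≤ p * K := by
    rw [← hPK]; exact hP1.trans (le_mul_of_one_le_right (by linarith) hs1)
  have hK0 : 0 < K := by linarith
  set j := ⌊p * K⌋₊ with hj
  have hj1 : (j : ℝ) ≤ p * K := Nat.floor_le (by linarith)
  have hj2 : p * K / 2 ≤ j := by
    have := Nat.lt_floor_add_one (p * K)
    rw [← hj] at this
    linarith
  have hjK : j ≤ n ^ k := by
    refine Nat.floor_le_of_le ?_
    push_cast
    exact mul_le_of_le_one_left hK0.le h1
  have hdiag : DiagonalSmall k n (n ^ c) q j b :=
    diagonalSmall_of_bounds (by omega) hc hfac hG1 ht h1 hpK hj1 hj2 (by linarith) hsum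
  have htrace : TraceSmall k n q j (traceValue k n (n ^ c) (n ^ l) (modulus k n) j b) := by
    -- The 64 of the norm bound plus 2 for rounding. The trace test then needs `4 * 66 * (k + 2) * G
    -- * t < P / 4`, which the constant 2000 covers.
    refine traceSmall_of_bounds (T := 66 * (k + 2) * t * P) hkc hn hnk hjK hb hfac hG1 ?_ ?_
    · refine hnormc.trans (mul_le_mul_of_nonneg_left ?_ (by positivity))
      have : 1 ≤ (k + 2) * t * P :=
        one_le_mul_of_one_le_of_one_le (one_le_mul_of_one_le_of_one_le (by linarith) ht)
          (by linarith)
      linarith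
    · have h8 : 0 < P * K := mul_pos (by linarith) hK0
      calc 4 * G * (66 * (k + 2) * t * P) * K = 264 * ((k + 2) * (G * t)) * (P * K) := by ring
        _ < P / 4 * (P * K) := mul_lt_mul_of_pos_right (by linarith) h8
        _ = P / 4 * (P * (√K * √K)) := by rw [hsK]
        _ = (P * √K) ^ 2 / 4 := by ring
        _ = (p * K) ^ 2 / 4 := by rw [hPK]
        _ ≤ j * j := by nlinarith
  refine Or.inr ⟨hq, hqk, fun h => ?_⟩
  have h10 := Finset.sum_eq_zero_iff.1 h j (Finset.mem_range.2 (by omega))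
  rw [certificate, if_pos ⟨hdiag, htrace⟩] at h10
  exact one_ne_zero h10

end Refutation

/-! ### Probability of acceptance -/

namespace Refutation

open Matrix MeasureTheory

open scoped Matrix.Norms.L2Operator

variable {k n : ℕ}

instance (p : unitInterval) : IsProbabilityMeasure (UniformHypergraph.random n k p) :=
  inferInstanceAs (IsProbabilityMeasure (setBernoulli _ p))

theorem integrable_random (p : unitInterval) (f : UniformHypergraph n k → ℝ) :
    Integrable f (UniformHypergraph.random n k p) :=
  Integrable.of_finite (μ := setBernoulli _ p)

open Classical in
theorem integral_mem_random (p : unitInterval) (e : {e : Finset (Fin n) // e.card = k}) :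
    ∫ H, (if e ∈ H then (1 : ℝ) else 0) ∂UniformHypergraph.random n k p = p := by
  have h := integral_prod_setBernoulli p (fun _ => 1) fun e' => if e' = e then 0 else 1
  rw [Finset.prod_eq_single e (fun e' _ he' => by simp [he']) (by simp)] at h
  rw [show (p : ℝ) * 1 + (1 - p) * (if e = e then 0 else 1) = p by simp] at h
  rw [← h]
  refine integral_congr_ae (.of_forall fun H => ?_)
  simp only []
  rw [Finset.prod_eq_single e (fun e' _ he' => by simp [he']) (by simp)]
  simp

/-- The table also lists tuples in other orders and tuples with repeated vertices. The latter never
form hyperedges, so only an inequality holds. -/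
theorem integral_input_mem_le (p : unitInterval) (ξ i : ℕ) :
    ∫ H, ((H.input ξ).mem i : ℝ) ∂UniformHypergraph.random n k p ≤ p := by
  classical
  by_cases h : ∃ h : i < n ^ k,
      (Finset.univ.image (finFunctionFinEquiv.symm (⟨i, h⟩ : Fin (n ^ k)))).card = k
  · obtain ⟨hi, hc⟩ := h
    rw [← integral_mem_random p ⟨_, hc⟩]
    refine integral_mono (integrable_random p _) (integrable_random p _) fun H => ?_
    simp only []
    split_ifs with he
    · exact_mod_cast input_mem_le H ξ i
    · have h1 : (H.input ξ).mem i ≠ 1 := fun h => he (by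
        obtain ⟨_, e, heH, hei⟩ := (input_mem_eq_one_iff H ξ i).1 h
        rwa [show (⟨_, hc⟩ : {e : Finset (Fin n) // e.card = k}) = e from Subtype.ext hei.symm])
      have := input_mem_le H ξ i
      exact_mod_cast (by omega : (H.input ξ).mem i ≤ 0)
  · have h1 : ∀ H : UniformHypergraph n k, (H.input ξ).mem i = 0 := fun H => by
      have h2 : (H.input ξ).mem i ≠ 1 := fun h' => h (by
        obtain ⟨hi, e, -, hei⟩ := (input_mem_eq_one_iff H ξ i).1 h'
        exact ⟨hi, hei ▸ e.2⟩)
      have := input_mem_le H ξ i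
      omega
    simp only [h1]
    simpa using p.2.1

theorem real_lt_sum_input_le (p : unitInterval) (ξ : ℕ) {t : ℝ} (ht : 0 < t)
    (hp : 0 < (p : ℝ) * (n : ℝ) ^ k) :
    (UniformHypergraph.random n k p).real
      {H | t * (p * (n : ℝ) ^ k) < ∑ x ∈ Finset.range (n ^ k), ((H.input ξ).mem x : ℝ)} ≤ 1 / t := by
  have h1 := mul_meas_ge_le_integral_of_nonneg (μ := UniformHypergraph.random n k p)
    (f := fun H => ∑ x ∈ Finset.range (n ^ k), ((H.input ξ).mem x : ℝ))
    (.of_forall fun H => Finset.sum_nonneg fun x _ => Nat.cast_nonneg _) (integrable_random p _)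
    (t * (p * (n : ℝ) ^ k))
  rw [integral_finsetSum _ fun x _ => integrable_random p _] at h1
  have h2 : ∑ x ∈ Finset.range (n ^ k), ∫ H, ((H.input ξ).mem x : ℝ)
      ∂UniformHypergraph.random n k p ≤ p * (n : ℝ) ^ k := by
    refine (Finset.sum_le_sum fun x _ => integral_input_mem_le p ξ x).trans (le_of_eq ?_)
    simp [mul_comm]
  have h3 := h1.trans h2
  have h4 : (UniformHypergraph.random n k p).real
      {H | t * (p * (n : ℝ) ^ k) < ∑ x ∈ Finset.range (n ^ k), ((H.input ξ).mem x : ℝ)} ≤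
      (UniformHypergraph.random n k p).real
      {H | t * (p * (n : ℝ) ^ k) ≤ ∑ x ∈ Finset.range (n ^ k), ((H.input ξ).mem x : ℝ)} :=
    measureReal_mono fun H hH => by simp only [Set.mem_ofPred_eq] at hH ⊢; exact hH.le
  rw [le_div_iff₀ ht]
  refine (mul_le_mul_of_nonneg_right h4 ht.le).trans ?_
  refine le_of_mul_le_mul_right ?_ hp
  rw [one_mul]
  exact le_trans (le_of_eq (by ring)) h3

/-- Markov's inequality for the moment of order `4 * (m + 1)`, with a threshold at least twice the
base of the moment bound. The gain `2 ^ (4 * (m + 1))` has to absorb the dimension and leave a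
further factor `n`. -/
theorem real_lt_norm_le {c l : ℕ} (hk : 1 ≤ k) (hkc : k = c + 2 * l) (hn : 1 ≤ n)
    (ht : 1 ≤ Real.log n) (p : unitInterval) (ξ : ℕ)
    (hP : 8 * (k + 2) * Real.log n ≤ p * √((n : ℝ) ^ k)) :
    (UniformHypergraph.random n k p).real
      {H | 64 * (k + 2) * Real.log n * (p * √((n : ℝ) ^ k)) <
        ‖linkMatrix (n ^ c) (n ^ l) (deviation k n p (H.input ξ).mem)‖} ≤ 1 / n := by
  set t := Real.log n with htdef
  -- The choice `m ≥ k * log n` makes `2 ^ (4 * (m + 1))` at least `n ^ (2 * k)`, while `m + 1`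
  -- remains of order `log n`.
  set m := ⌈k * t⌉₊ with hm
  have hn1 : (1 : ℝ) ≤ n := by exact_mod_cast hn
  have hkt : 0 ≤ k * t := by positivity
  have hm1 : k * t ≤ m := Nat.le_ceil _
  have hm2 : (m : ℝ) + 1 ≤ (k + 2) * t := by
    have := Nat.ceil_lt_add_one hkt
    rw [← hm] at this
    linarith
  have hsplit : (p : ℝ) * (n ^ l : ℕ) * √(n ^ c : ℕ) = p * √((n : ℝ) ^ k) := by
    have h1 : (n : ℝ) ^ k = ((n : ℝ) ^ l) ^ 2 * (n : ℝ) ^ c := by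
      rw [hkc, ← pow_mul, ← pow_add]; congr 1; omega
    rw [h1, Real.sqrt_mul (by positivity), Real.sqrt_sq (by positivity)]
    push_cast
    ring
  have hint := integral_norm_pow_le (k := k) (n := n) (nc := n ^ c) (N := n ^ l) (m := m) p ξ
    (Nat.one_le_pow _ _ hn) (by rw [hsplit]; linarith)
  rw [hsplit] at hint
  set P := (p : ℝ) * √((n : ℝ) ^ k)
  set T := 64 * (k + 2) * t * P with hT
  have hP0 : 0 < P := by
    have : 0 < 8 * ((k : ℝ) + 2) * t := by positivity
    linarith
  have hT0 : 0 < T := by positivity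
  have hmarkov := mul_meas_ge_le_integral_of_nonneg (μ := UniformHypergraph.random n k p)
    (f := fun H => ‖linkMatrix (n ^ c) (n ^ l) (deviation k n p (H.input ξ).mem)‖ ^ (4 * (m + 1)))
    (.of_forall fun H => by positivity) (integrable_random p _) (T ^ (4 * (m + 1)))
  have hle : (32 * (m + 1) * P) ^ (4 * (m + 1)) ≤ (T / 2) ^ (4 * (m + 1)) := by
    refine pow_le_pow_left₀ (by positivity) ?_ _
    rw [hT]
    nlinarith
  have h16 : (n : ℝ) ^ k * n ≤ 2 ^ (4 * (m + 1)) := by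
    have h1 : Real.exp 1 ≤ 4 := by linarith [Real.exp_one_lt_d9]
    calc (n : ℝ) ^ k * n ≤ (n : ℝ) ^ k * (n : ℝ) ^ k :=
          mul_le_mul_of_nonneg_left (le_self_pow₀ hn1 (by omega)) (by positivity)
      _ = Real.exp (k * t + k * t) := by
          rw [Real.exp_add, Real.exp_nat_mul, htdef, Real.exp_log (by linarith)]
      _ ≤ Real.exp ((2 * (m + 1) : ℕ) * 1) := by
          refine Real.exp_le_exp.2 ?_
          push_cast
          linarith
      _ = Real.exp 1 ^ (2 * (m + 1)) := Real.exp_nat_mul _ _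
      _ ≤ 4 ^ (2 * (m + 1)) := pow_le_pow_left₀ (Real.exp_pos _).le h1 _
      _ = _ := by rw [show (4 : ℝ) = 2 ^ 2 by norm_num, ← pow_mul]; congr 1; ring
  have hNK : ((n ^ l : ℕ) : ℝ) * (n ^ l : ℕ) ≤ (n : ℝ) ^ k := by
    push_cast
    rw [← pow_add]
    exact pow_le_pow_right₀ hn1 (by omega)
  set E := 4 * (m + 1)
  set μ := (UniformHypergraph.random n k p).real
    {H | T < ‖linkMatrix (n ^ c) (n ^ l) (deviation k n p (H.input ξ).mem)‖}
  have hμ : T ^ E * μ ≤ (n : ℝ) ^ k * (T / 2) ^ E := by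
    refine (mul_le_mul_of_nonneg_left (measureReal_mono fun H hH => ?_) (by positivity)).trans
      (hmarkov.trans (hint.trans (mul_le_mul hNK hle (by positivity) (by positivity))))
    exact pow_le_pow_left₀ hT0.le (le_of_lt hH) _
  have hμ2 : μ * 2 ^ E ≤ (n : ℝ) ^ k := by
    refine le_of_mul_le_mul_right ?_ (show 0 < (T / 2) ^ E by positivity)
    calc μ * 2 ^ E * (T / 2) ^ E = T ^ E * μ := by
          rw [mul_assoc, ← mul_pow, mul_div_cancel₀ T two_ne_zero, mul_comm]
      _ ≤ _ := hμ
  rw [le_div_iff₀ (by linarith)]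
  refine le_of_mul_le_mul_left ?_ (show 0 < (n : ℝ) ^ k by positivity)
  calc (n : ℝ) ^ k * (μ * n) = μ * ((n : ℝ) ^ k * n) := by ring
    _ ≤ μ * 2 ^ E := mul_le_mul_of_nonneg_left h16 measureReal_nonneg
    _ ≤ _ := by rw [mul_one]; exact hμ2

/-- A union bound: the test can fail only if the table has too many ones or the norm of the link
matrix is too large. -/
theorem le_real_accepts {c l q : ℕ} (hk : 2 ≤ k) (hkc : k = c + 2 * l) (hc : 2 * c ≤ k)
    (hn : 2 ≤ n) (ht : 1 ≤ Real.log n) (hnk : n ^ k ≤ 2 ^ n) (hqk : q * k ≤ n) (p : unitInterval)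
    (hP : 2000 * (k + 2) * (k : ℝ) ^ (2 * k) * (q : ℝ) ^ (2 * k) * Real.log n ≤
      p * √((n : ℝ) ^ k)) :
    1 - (1 / Real.log n + 1 / n) ≤ (UniformHypergraph.random n k p).real
      {H | Accepts k c l n q (H.input q).mem} := by
  rcases eq_or_ne q 0 with rfl | hq
  · rw [show {H : UniformHypergraph n k | Accepts k c l n 0 (H.input 0).mem} = Set.univ from
      Set.eq_univ_of_forall fun H => Or.inl ⟨rfl, by omega⟩, probReal_univ]
    have : 0 ≤ 1 / Real.log n + 1 / n := by positivity
    linarith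
  have hn1 : (1 : ℝ) ≤ n := by exact_mod_cast (by omega : 1 ≤ n)
  have hq1 : (1 : ℝ) ≤ q := by exact_mod_cast Nat.one_le_iff_ne_zero.2 hq
  have hk1 : (1 : ℝ) ≤ k := by exact_mod_cast (by omega : 1 ≤ k)
  have hG : 1 ≤ (k : ℝ) ^ (2 * k) * (q : ℝ) ^ (2 * k) :=
    one_le_mul_of_one_le_of_one_le (one_le_pow₀ hk1) (one_le_pow₀ hq1)
  have hP8 : 8 * (k + 2) * Real.log n ≤ p * √((n : ℝ) ^ k) := by
    refine le_trans ?_ hP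
    have h1 : (k + 2) * Real.log n ≤
        (k + 2) * Real.log n * ((k : ℝ) ^ (2 * k) * (q : ℝ) ^ (2 * k)) :=
      le_mul_of_one_le_right (by positivity) hG
    have h2 : 0 ≤ (k + 2) * Real.log n := by positivity
    linarith
  have hP0 : 0 < p * √((n : ℝ) ^ k) :=
    lt_of_lt_of_le (by positivity) hP8
  have hp0 : 0 < (p : ℝ) := pos_of_mul_pos_left hP0 (Real.sqrt_nonneg _)
  have h1 := real_lt_sum_input_le (n := n) (k := k) p q (t := Real.log n) (by linarith)
    (by positivity)
  have h2 := real_lt_norm_le (by omega) hkc (by omega) ht p q hP8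
  set μ := UniformHypergraph.random n k p
  have hcover : (Set.univ : Set (UniformHypergraph n k)) ⊆
      {H | Accepts k c l n q (H.input q).mem} ∪
      ({H | Real.log n * (p * (n : ℝ) ^ k) <
        ∑ x ∈ Finset.range (n ^ k), ((H.input q).mem x : ℝ)} ∪
      {H | 64 * (k + 2) * Real.log n * (p * √((n : ℝ) ^ k)) <
        ‖linkMatrix (n ^ c) (n ^ l) (deviation k n p (H.input q).mem)‖}) := by
    intro H _
    by_contra h
    simp only [Set.mem_union, Set.mem_ofPred_eq, not_or, not_lt] at h
    exact h.1 (accepts_of_bounds hk hkc hc hn hnk hq hqk p.2.1 p.2.2 ht (input_mem_le H q) hP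
      h.2.1 h.2.2)
  have h3 := measureReal_mono (μ := μ) hcover
  rw [probReal_univ] at h3
  have h4 := h3.trans ((measureReal_union_le _ _).trans
    (add_le_add_right (measureReal_union_le _ _) _))
  linarith

end Refutation

/-- For each `k ≥ 2` there are a constant `C` and a polynomial-time algorithm `A` which, given a
`k`-uniform hypergraph `H` and (the integer part of) `ξ`, answers `true`, meaning `χ(H) > ξ`, or
`false`, meaning "fail"; it never errs, and it answers `true` with high probability. -/
theorem mainTheorem12 (k : ℕ) (hk : 2 ≤ k) :
    ∃ C : ℝ, 0 < C ∧
    ∃ A : (n : ℕ) → UniformHypergraph n k → ℕ → Bool,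
      ComputableInPolyTime A ∧
      (∀ (n : ℕ) (H : UniformHypergraph n k) (ξ : ℝ), 0 ≤ ξ →
        A n H ⌊ξ⌋₊ = true → ξ < (H.chromaticNumber : ℝ)) ∧
      ∀ (p : ℕ → unitInterval) (ξ : ℕ → ℝ),
        (∀ᶠ n : ℕ in atTop,
          0 ≤ ξ n ∧ ξ n ≤ (n : ℝ) ^ (1 / 4 : ℝ) / Real.log n ∧
          C * (ξ n ^ (2 * k) * (n : ℝ) ^ ((k : ℝ) / 2) * Real.log n ^ 3) ≤
            (p n : ℝ) * (n.choose k : ℝ)) →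
        Tendsto (fun n : ℕ => UniformHypergraph.random n k (p n) {H | A n H ⌊ξ n⌋₊ = true})
          atTop (𝓝 1) := by
  classical
  have hkc : k = k % 2 + 2 * (k / 2) := (Nat.mod_add_div k 2).symm
  have hc : 2 * (k % 2) ≤ k := by omega
  have hk1 : (1 : ℝ) ≤ k := by exact_mod_cast (by omega : 1 ≤ k)
  refine ⟨2000 * (k + 2) * (k : ℝ) ^ (2 * k), by positivity,
    fun n H q => decide (Refutation.Accepts k (k % 2) (k / 2) n q (H.input q).mem),
    Refutation.computable_of_accepts hk hkc fun n H ξ => decide_eq_true_iff,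
    fun n H ξ hξ h => ?_, fun p ξ h => ?_⟩
  · exact (Nat.floor_lt hξ).1
      (Refutation.lt_chromaticNumber_of_accepts hk hkc H (decide_eq_true_iff.1 h))
  simp only [decide_eq_true_eq]
  have hlog : Tendsto (fun n : ℕ => Real.log n) atTop atTop :=
    Real.tendsto_log_atTop.comp tendsto_natCast_atTop_atTop
  have hreal : Tendsto (fun n : ℕ => (UniformHypergraph.random n k (p n)).real
      {H | Refutation.Accepts k (k % 2) (k / 2) n ⌊ξ n⌋₊ (H.input ⌊ξ n⌋₊).mem}) atTop (𝓝 1) := by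
    have hlim : Tendsto (fun n : ℕ => 1 - (1 / Real.log n + 1 / n)) atTop (𝓝 1) := by
      have h1 := (tendsto_inv_atTop_zero.comp hlog).add (tendsto_inv_atTop_nhds_zero_nat (𝕜 := ℝ))
      simpa [Function.comp_def] using h1.const_sub 1
    refine tendsto_of_tendsto_of_tendsto_of_le_of_le' hlim tendsto_const_nhds ?_
      (.of_forall fun n => MeasureTheory.measureReal_le_one)
    have hpow : ∀ᶠ n : ℕ in atTop, (n : ℝ) ^ k / 2 ^ n < 1 :=
      (tendsto_pow_const_div_const_pow_of_one_lt k one_lt_two).eventually_lt_const one_pos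
    filter_upwards [h, hlog.eventually_ge_atTop 1, hpow, eventually_ge_atTop (k ^ 2)] with
      n ⟨h0, hle, hm⟩ ht hp2 hkn
    have hn : 2 ≤ n := by nlinarith
    have hn1 : (1 : ℝ) ≤ n := by exact_mod_cast (by omega : 1 ≤ n)
    have hq : (⌊ξ n⌋₊ : ℝ) ≤ ξ n := Nat.floor_le h0
    have hs0 : 0 < √((n : ℝ) ^ k) := Real.sqrt_pos.2 (by positivity)
    refine Refutation.le_real_accepts hk hkc hc hn ht ?_ ?_ (p n) ?_
    · rw [div_lt_one (by positivity)] at hp2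
      exact_mod_cast hp2.le
    -- The upper bound on `ξ` serves only to ensure `⌊ξ⌋ * k ≤ n`, for which both factors being at
    -- most `√n` suffices.
    · have h1 : (⌊ξ n⌋₊ : ℝ) ≤ √n := by
        refine hq.trans (hle.trans ((div_le_self (by positivity) ht).trans ?_))
        rw [Real.sqrt_eq_rpow]
        exact Real.rpow_le_rpow_of_exponent_le hn1 (by norm_num)
      have h2 : (k : ℝ) ≤ √n := Real.le_sqrt_of_sq_le (by exact_mod_cast hkn)
      have h3 := mul_le_mul h1 h2 (by positivity) (Real.sqrt_nonneg _)
      rw [Real.mul_self_sqrt (by positivity)] at h3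
      exact_mod_cast h3
    · refine le_of_mul_le_mul_right ?_ hs0
      have hsqrt : (n : ℝ) ^ ((k : ℝ) / 2) = √((n : ℝ) ^ k) := by
        rw [Real.sqrt_eq_rpow, ← Real.rpow_natCast, ← Real.rpow_mul (by positivity)]
        congr 1
        ring
      -- A single power of the logarithm is enough for the estimates.
      have hlog3 : Real.log n ≤ Real.log n ^ 3 := le_self_pow₀ ht (by norm_num)
      have hchoose : (n.choose k : ℝ) ≤ (n : ℝ) ^ k := by exact_mod_cast Nat.choose_le_pow n k
      calc 2000 * (k + 2) * (k : ℝ) ^ (2 * k) * (⌊ξ n⌋₊ : ℝ) ^ (2 * k) * Real.log n *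
            √((n : ℝ) ^ k)
          ≤ 2000 * (k + 2) * (k : ℝ) ^ (2 * k) * ξ n ^ (2 * k) * Real.log n ^ 3 *
            √((n : ℝ) ^ k) := by gcongr
        _ = 2000 * (k + 2) * (k : ℝ) ^ (2 * k) *
            (ξ n ^ (2 * k) * (n : ℝ) ^ ((k : ℝ) / 2) * Real.log n ^ 3) := by rw [hsqrt]; ring
        _ ≤ p n * n.choose k := hm
        _ ≤ p n * (n : ℝ) ^ k := mul_le_mul_of_nonneg_left hchoose (p n).2.1
        _ = p n * √((n : ℝ) ^ k) * √((n : ℝ) ^ k) := by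
          rw [mul_assoc, Real.mul_self_sqrt (by positivity)]
  have h1 := ENNReal.tendsto_ofReal hreal
  simpa [MeasureTheory.measureReal_def] using h1
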